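/- Let $N\subset\mathscr L(H)$ be a von Neumann algebra equipped with a normal, faithful, semi-finite trace $\tau\colon N_+\to[0,\infty]$. Let $\mathscr L^1_\tau(N)=\{x\in N:\tau(|x|)<\infty\}$, a two-sided ideal of $N$ with norm $\|x\|_{1,\infty}=\|x\|+\tau(|x|)$, and extend $\tau$ linearly to $\mathscr L^1_\tau(N)\to\mathbb C$. For $n\ge 0$ let $GL_n(\mathscr L^1_\tau(N))$ be the group of invertible $g\in M_n(N)$ with $g-1_n\in M_n(\mathscr L^1_\tau(N))$, let $GL_\infty$ denote the direct limit over $n$ along $g\mapsto g\oplus 1$, and put $$K_1^{alg}(\mathscr L^1_\tau(N),N)=GL_\infty(\mathscr L^1_\tau(N))\,/\,[GL_\infty(\mathscr L^1_\tau(N)),GL_\infty(N)].$$ A lift of a class $\kappa\in K_1^{alg}(\mathscr L^1_\tau(N),N)$ is a path $\sigma\colon[0,1]\to GL_n(\mathscr L^1_\tau(N))$, for some $n$, that is smooth for $\|\cdot\|_{1,\infty}$ (entrywise), with $\sigma(0)=1_n$ and $[\sigma(1)^{-1}]=\kappa$. The semi-finite Fuglede--Kadison determinant is $$\det\nolimits_\tau(\kappa)=\exp\Big(-\mathrm{Re}\,\tau\Big(\mathrm{tr}\int_0^1\frac{d\sigma}{dt}\,\sigma^{-1}\,dt\Big)\Big)\in(0,\infty),$$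 where $\sigma$ is any lift of $\kappa$ and $\mathrm{tr}$ is the sum of the diagonal entries. Then every class has a lift, $\det_\tau(\kappa)$ does not depend on the chosen lift, and for every $g\in GL_1(\mathscr L^1_\tau(N))$, that is, for every invertible $g\in N$ with $g-1\in\mathscr L^1_\tau(N)$, one has $\log|g|\in\mathscr L^1_\tau(N)$ and $$\det\nolimits_\tau([g])=e^{\tau(\log|g|)}.$$ (The right-hand side is Brown's formula for the Fuglede--Kadison determinant of $g$.) -/

import Mathlib

noncomputable section

open scoped NNReal ENNReal ContDiff ComplexStarModule

namespace FugledeKadison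

/-! ## Traces on a von Neumann algebra -/

/-- The positive cone `N₊` of a von Neumann algebra `N` acting on `H`. -/
def posCone {H : Type*} [NormedAddCommGroup H] [InnerProductSpace ℂ H] [CompleteSpace H]
    (N : VonNeumannAlgebra H) : Submodule ℝ≥0 (H →L[ℂ] H) where
  carrier := {x | x ∈ N ∧ 0 ≤ x}
  add_mem' := fun hx hy => ⟨add_mem hx.1 hy.1, add_nonneg hx.2 hy.2⟩
  zero_mem' := ⟨zero_mem N, le_rfl⟩
  smul_mem' := fun c x hx => ⟨by
    have := N.toStarSubalgebra.smul_mem (x := x) hx.1 ((c : ℝ) : ℂ)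
    have h : c • x = ((c : ℝ) : ℂ) • x := by
      ext v; simp [NNReal.smul_def]
    rw [h]; exact this, smul_nonneg c.2 hx.2⟩

/-- A normal, faithful, semi-finite trace `τ : N₊ → [0, ∞]`.  Additivity and homogeneity (with
`0 · ∞ = 0`) are the `ℝ≥0`-linearity of `toFun`. -/
structure NFSTrace {H : Type*} [NormedAddCommGroup H] [InnerProductSpace ℂ H] [CompleteSpace H]
    (N : VonNeumannAlgebra H) where
  /-- the underlying weight -/
  toFun : posCone N →ₗ[ℝ≥0] ℝ≥0∞
  /-- the trace property `τ(x* x) = τ(x x*)` -/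
  tracial : ∀ x ∈ N, ∀ (h₁ : star x * x ∈ posCone N) (h₂ : x * star x ∈ posCone N),
    toFun ⟨star x * x, h₁⟩ = toFun ⟨x * star x, h₂⟩
  /-- `τ` commutes with suprema of (bounded) increasing nets in `N₊` -/
  normal : ∀ (D : Set (posCone N)) (x : posCone N), D.Nonempty → DirectedOn (· ≤ ·) D →
    IsLUB D x → toFun x = ⨆ d ∈ D, toFun d
  faithful : ∀ x : posCone N, toFun x = 0 → x = 0
  /-- `τ(x)` is the supremum of the finite values of `τ` below `x` -/
  semifinite : ∀ x : posCone N, toFun x = ⨆ y : {y : posCone N // y ≤ x ∧ toFun y < ⊤}, toFun y.1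

section Ideal

variable {H : Type*} [NormedAddCommGroup H] [InnerProductSpace ℂ H] [CompleteSpace H]
  {N : VonNeumannAlgebra H}

open Classical in
/-- `τ` as a function of operators; it is only meant to be evaluated on `N₊`. -/
def NFSTrace.val (τ : NFSTrace N) (x : H →L[ℂ] H) : ℝ≥0∞ :=
  if h : x ∈ posCone N then τ.toFun ⟨x, h⟩ else ⊤

theorem mem_of_commute {a : H →L[ℂ] H} (h : ∀ y, y ∈ N.commutant → Commute y a) : a ∈ N := by
  rw [← N.commutant_commutant, VonNeumannAlgebra.mem_commutant_iff]
  exact fun y hy => h y hy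

theorem commute_of_mem {a y : H →L[ℂ] H} (ha : a ∈ N) (hy : y ∈ N.commutant) : Commute y a :=
  (VonNeumannAlgebra.mem_commutant_iff.1 hy a ha).symm

theorem sqrt_mem {a : H →L[ℂ] H} (ha : a ∈ N) : CFC.sqrt a ∈ N :=
  mem_of_commute fun _ hy => ((commute_of_mem ha hy).symm.cfcₙ_nnreal _).symm

theorem abs_mem {a : H →L[ℂ] H} (ha : a ∈ N) : CFC.abs a ∈ N :=
  sqrt_mem (mul_mem (star_mem ha) ha)

theorem abs_mem_posCone {a : H →L[ℂ] H} (ha : a ∈ N) : CFC.abs a ∈ posCone N :=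
  ⟨abs_mem ha, CFC.abs_nonneg a⟩

theorem norm_abs_apply (x : H →L[ℂ] H) (v : H) : ‖CFC.abs x v‖ = ‖x v‖ := by
  have h1 : ∀ y : H →L[ℂ] H, ((‖y v‖ ^ 2 : ℝ) : ℂ) = inner ℂ v ((star y * y) v) := by
    intro y
    rw [ContinuousLinearMap.star_eq_adjoint, mul_apply_eq_comp,
      ContinuousLinearMap.adjoint_inner_right, inner_self_eq_norm_sq_to_K]
    norm_cast
  have h2 : star (CFC.abs x) * CFC.abs x = star x * x := by
    rw [(CFC.abs_nonneg x).isSelfAdjoint.star_eq, CFC.abs_mul_abs]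
  have h3 := h1 (CFC.abs x)
  rw [h2, ← h1 x] at h3
  have h4 : ‖CFC.abs x v‖ ^ 2 = ‖x v‖ ^ 2 := by exact_mod_cast h3
  exact (sq_eq_sq₀ (norm_nonneg _) (norm_nonneg _)).1 h4

/-- Polar decomposition: the partial isometry lies in the algebra. -/
theorem exists_polar {x : H →L[ℂ] H} (hx : x ∈ N) :
    ∃ u ∈ N, ‖u‖ ≤ 1 ∧ x = u * CFC.abs x ∧ CFC.abs x = star u * x := by
  set a : H →L[ℂ] H := CFC.abs x with ha
  have haN : a ∈ N := abs_mem hx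
  have hsa : star a = a := (CFC.abs_nonneg x).isSelfAdjoint.star_eq
  let K : Submodule ℂ H := (LinearMap.range (a : H →ₗ[ℂ] H)).topologicalClosure
  have hKc : IsClosed (K : Set H) := Submodule.isClosed_topologicalClosure _
  have : CompleteSpace K := hKc.completeSpace_coe
  have hmem : ∀ v, a v ∈ K := fun v =>
    Submodule.le_topologicalClosure _ (LinearMap.mem_range_self (a : H →ₗ[ℂ] H) v)
  let e : H →ₗ[ℂ] K := (a : H →ₗ[ℂ] H).codRestrict K hmem
  have hdense : DenseRange e := by
    intro k
    rw [Metric.mem_closure_iff]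
    intro ε hε
    have hk : (k : H) ∈ closure (Set.range a) := k.2
    obtain ⟨_, ⟨v, rfl⟩, hb⟩ := Metric.mem_closure_iff.1 hk ε hε
    exact ⟨e v, ⟨v, rfl⟩, hb⟩
  have hnorm : ∀ v, ‖(x : H →ₗ[ℂ] H) v‖ ≤ 1 * ‖e v‖ := by
    intro v
    rw [one_mul]
    exact (norm_abs_apply x v).ge
  let w : K →L[ℂ] H := (x : H →ₗ[ℂ] H).extendOfNorm e
  have hwe : ∀ v, w (e v) = x v := LinearMap.extendOfNorm_eq hdense ⟨1, hnorm⟩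
  have hwn : ∀ k, ‖w k‖ ≤ 1 * ‖k‖ := LinearMap.norm_extendOfNorm_apply_le hdense 1 hnorm
  let u : H →L[ℂ] H := w.comp K.orthogonalProjectionOnto
  have hua : ∀ v, u (a v) = x v := by
    intro v
    have : K.orthogonalProjectionOnto (a v) = e v :=
      Submodule.orthogonalProjectionOnto_mem_subspace_eq_self (e v)
    show w (K.orthogonalProjectionOnto (a v)) = x v
    rw [this, hwe]
  have hun : ‖u‖ ≤ 1 := by
    refine ContinuousLinearMap.opNorm_le_bound _ zero_le_one fun v => ?_
    refine (hwn _).trans ?_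
    gcongr
    exact (K.norm_orthogonalProjectionOnto_apply_le v)
  have huperp : ∀ v ∈ Kᗮ, u v = 0 := by
    intro v hv
    show w (K.orthogonalProjectionOnto v) = 0
    rw [Submodule.orthogonalProjectionOnto_apply_of_mem_orthogonal hv, map_zero]
  have hxu : x = u * a := by ext v; exact (hua v).symm
  refine ⟨u, ?_, hun, hxu, ?_⟩
  · refine mem_of_commute fun y hy => ?_
    have hyx : Commute y x := commute_of_mem hx hy
    have hya : Commute y a := commute_of_mem haN hy
    have hysa : Commute (star y) a := commute_of_mem haN (star_mem hy)
    have hK : ∀ k ∈ K, y (u k) = u (y k) := by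
      intro k hk
      have hcl : IsClosed {k : H | y (u k) = u (y k)} :=
        isClosed_eq (by fun_prop) (by fun_prop)
      have hsub : Set.range a ⊆ {k : H | y (u k) = u (y k)} := by
        rintro _ ⟨v, rfl⟩
        have h1 : y (a v) = a (y v) := congrArg (fun T : H →L[ℂ] H => T v) hya.eq
        have h2 : y (x v) = x (y v) := congrArg (fun T : H →L[ℂ] H => T v) hyx.eq
        simp only [Set.mem_ofPred_eq]
        rw [hua, h1, hua, h2]
      exact hcl.closure_subset_iff.2 hsub hk
    have hP : ∀ k ∈ Kᗮ, y (u k) = u (y k) := by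
      intro k hk
      rw [huperp k hk, map_zero, huperp]
      rw [Submodule.orthogonal_closure, Submodule.mem_orthogonal]
      rintro _ ⟨v, rfl⟩
      have h1 : star y (a v) = a (star y v) := congrArg (fun T : H →L[ℂ] H => T v) hysa.eq
      show inner ℂ (a v) (y k) = 0
      rw [← ContinuousLinearMap.adjoint_inner_left, ← ContinuousLinearMap.star_eq_adjoint, h1]
      exact (Submodule.mem_orthogonal _ _).1 hk _ (hmem _)
    ext v
    obtain ⟨k, hk, l, hl, rfl⟩ := K.exists_add_mem_mem_orthogonal v
    simp only [mul_apply_eq_comp, map_add]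
    rw [hK k hk, hP l hl]
  · ext v
    have h1 : ‖u (a v)‖ = ‖a v‖ := by rw [hua, norm_abs_apply]
    have h2 : ‖star u (u (a v))‖ ≤ ‖a v‖ := by
      calc ‖star u (u (a v))‖ ≤ ‖star u‖ * ‖u (a v)‖ := (star u).le_opNorm _
        _ ≤ 1 * ‖u (a v)‖ := by gcongr; rwa [norm_star]
        _ = ‖a v‖ := by rw [one_mul, h1]
    have h3 : RCLike.re (inner ℂ (a v) (star u (u (a v)))) = ‖a v‖ ^ 2 := by
      rw [ContinuousLinearMap.star_eq_adjoint, ContinuousLinearMap.adjoint_inner_right,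
        inner_self_eq_norm_sq, h1]
    have h4 : ‖a v - star u (u (a v))‖ ^ 2 ≤ 0 := by
      rw [@norm_sub_sq ℂ, h3]
      nlinarith [norm_nonneg (star u (u (a v)))]
    have h5 : a v - star u (u (a v)) = 0 := by
      have := sq_nonneg ‖a v - star u (u (a v))‖
      exact norm_eq_zero.1 (by nlinarith [norm_nonneg (a v - star u (u (a v)))])
    rw [hua] at h5
    exact sub_eq_zero.1 h5

theorem val_of_mem (τ : NFSTrace N) {x : H →L[ℂ] H} (h : x ∈ posCone N) :
    τ.val x = τ.toFun ⟨x, h⟩ := dif_pos h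

theorem val_add (τ : NFSTrace N) {x y : H →L[ℂ] H} (hx : x ∈ posCone N) (hy : y ∈ posCone N) :
    τ.val (x + y) = τ.val x + τ.val y := by
  rw [val_of_mem τ hx, val_of_mem τ hy, val_of_mem τ (add_mem hx hy), ← map_add]
  rfl

theorem val_smul (τ : NFSTrace N) {x : H →L[ℂ] H} (c : ℝ≥0) (hx : x ∈ posCone N) :
    τ.val (c • x) = c * τ.val x := by
  rw [val_of_mem τ hx, val_of_mem τ ((posCone N).smul_mem c hx)]
  exact τ.toFun.map_smul c ⟨x, hx⟩

theorem val_mono (τ : NFSTrace N) {x y : H →L[ℂ] H} (hx : x ∈ posCone N) (hy : y ∈ posCone N)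
    (h : x ≤ y) : τ.val x ≤ τ.val y := by
  have h1 : y - x ∈ posCone N := ⟨sub_mem hy.1 hx.1, sub_nonneg.2 h⟩
  have h2 := val_add τ hx h1
  rw [add_sub_cancel] at h2
  rw [h2]
  exact le_self_add

theorem star_mul_mem {x : H →L[ℂ] H} (hx : x ∈ N) : star x * x ∈ posCone N :=
  ⟨mul_mem (star_mem hx) hx, star_mul_self_nonneg x⟩

theorem mul_star_mem {x : H →L[ℂ] H} (hx : x ∈ N) : x * star x ∈ posCone N :=
  ⟨mul_mem hx (star_mem hx), mul_star_self_nonneg x⟩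

theorem val_star_mul (τ : NFSTrace N) {x : H →L[ℂ] H} (hx : x ∈ N) :
    τ.val (star x * x) = τ.val (x * star x) := by
  rw [val_of_mem τ (star_mul_mem hx), val_of_mem τ (mul_star_mem hx)]
  exact τ.tracial x hx _ _

theorem conj_mem {a p : H →L[ℂ] H} (ha : a ∈ N) (hp : p ∈ posCone N) :
    a * p * star a ∈ posCone N :=
  ⟨mul_mem (mul_mem ha hp.1) (star_mem ha), star_right_conjugate_nonneg hp.2 a⟩

theorem val_conj_le (τ : NFSTrace N) {a p : H →L[ℂ] H} (ha : a ∈ N) (hp : p ∈ posCone N) :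
    τ.val (a * p * star a) ≤ (‖a‖₊ ^ 2 : ℝ≥0) * τ.val p := by
  set s := CFC.sqrt p with hs
  have hsN : s ∈ N := sqrt_mem hp.1
  have hss : star s = s := (CFC.sqrt_nonneg p).isSelfAdjoint.star_eq
  have hsp : s * s = p := CFC.sqrt_mul_sqrt_self p hp.2
  have h1 : a * p * star a = (a * s) * star (a * s) := by
    rw [star_mul, hss, ← hsp]; noncomm_ring
  have h2 : star (a * s) * (a * s) = star s * (star a * a) * s := by
    rw [star_mul]; noncomm_ring
  rw [h1, ← val_star_mul τ (mul_mem ha hsN), ← val_smul τ _ hp]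
  refine val_mono τ (star_mul_mem (mul_mem ha hsN)) ((posCone N).smul_mem _ hp) ?_
  rw [h2]
  refine (CStarAlgebra.star_left_conjugate_le_norm_smul
    (star_mul_self_nonneg a).isSelfAdjoint).trans (le_of_eq ?_)
  rw [hss, hsp, CStarRing.norm_star_mul_self, ← sq]
  rfl

/-- An arithmetic-geometric inequality for `a p b`. -/
theorem exists_majorant (τ : NFSTrace N) {a p b : H →L[ℂ] H} (ha : a ∈ N) (hp : p ∈ posCone N)
    (hb : b ∈ N) : ∃ r ∈ posCone N, a * p * b + star (a * p * b) ≤ r ∧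
      τ.val r ≤ (‖a‖₊ ^ 2 + ‖b‖₊ ^ 2 : ℝ≥0) * τ.val p := by
  have hps : star p = p := hp.2.isSelfAdjoint.star_eq
  refine ⟨a * p * star a + star b * p * star (star b),
    add_mem (conj_mem ha hp) (conj_mem (star_mem hb) hp), ?_, ?_⟩
  · have h := star_right_conjugate_nonneg hp.2 (a - star b)
    rw [← sub_nonneg]
    convert h using 1
    simp only [star_sub, star_mul, star_star, hps]
    noncomm_ring
  · rw [val_add τ (conj_mem ha hp) (conj_mem (star_mem hb) hp), ENNReal.coe_add, add_mul]
    refine add_le_add (val_conj_le τ ha hp) ?_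
    have := val_conj_le τ (star_mem hb) hp
    rwa [nnnorm_star] at this

theorem val_two (τ : NFSTrace N) {x : H →L[ℂ] H} (hx : x ∈ posCone N) :
    τ.val (x + x) = 2 * τ.val x := by rw [val_add τ hx hx, two_mul]

theorem val_abs_add_le (τ : NFSTrace N) {x y : H →L[ℂ] H} (hx : x ∈ N) (hy : y ∈ N) :
    τ.val (CFC.abs (x + y)) ≤ τ.val (CFC.abs x) + τ.val (CFC.abs y) := by
  obtain ⟨w, hw, hw1, -, hw2⟩ := exists_polar (add_mem hx hy)
  obtain ⟨u, hu, hu1, hu2, -⟩ := exists_polar hx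
  obtain ⟨v, hv, hv1, hv2, -⟩ := exists_polar hy
  obtain ⟨r, hr, hr1, hr2⟩ := exists_majorant τ (mul_mem (star_mem hw) hu) (abs_mem_posCone hx)
    (one_mem N)
  obtain ⟨s, hs, hs1, hs2⟩ := exists_majorant τ (mul_mem (star_mem hw) hv) (abs_mem_posCone hy)
    (one_mem N)
  have key : ∀ c : H →L[ℂ] H, ‖c‖ ≤ 1 →
      ((‖star w * c‖₊ ^ 2 + ‖(1 : H →L[ℂ] H)‖₊ ^ 2 : ℝ≥0) : ℝ≥0∞) ≤ 2 := by
    intro c hc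
    have h1 : ‖star w * c‖₊ ≤ 1 := by
      refine (nnnorm_mul_le _ _).trans ?_
      rw [nnnorm_star]
      exact mul_le_one' hw1 hc
    have h2 : ‖(1 : H →L[ℂ] H)‖₊ ≤ 1 := ContinuousLinearMap.norm_id_le
    have h3 := add_le_add (pow_le_one' h1 2) (pow_le_one' h2 2)
    have h4 : ((‖star w * c‖₊ ^ 2 + ‖(1 : H →L[ℂ] H)‖₊ ^ 2 : ℝ≥0) : ℝ≥0∞) ≤
      ((1 + 1 : ℝ≥0) : ℝ≥0∞) := ENNReal.coe_le_coe.2 h3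
    refine h4.trans (le_of_eq ?_)
    norm_num
  have habs := abs_mem_posCone (add_mem hx hy)
  have hself : star (CFC.abs (x + y)) = CFC.abs (x + y) := habs.2.isSelfAdjoint.star_eq
  have hsum : CFC.abs (x + y) = star w * u * CFC.abs x * 1 + star w * v * CFC.abs y * 1 := by
    rw [hw2, mul_one, mul_one, mul_assoc, mul_assoc, ← hu2, ← hv2, mul_add]
  have hle : CFC.abs (x + y) + CFC.abs (x + y) ≤ r + s := by
    calc CFC.abs (x + y) + CFC.abs (x + y) = CFC.abs (x + y) + star (CFC.abs (x + y)) := by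
          rw [hself]
      _ = (star w * u * CFC.abs x * 1 + star (star w * u * CFC.abs x * 1)) +
          (star w * v * CFC.abs y * 1 + star (star w * v * CFC.abs y * 1)) := by
          rw [hsum, star_add]; abel
      _ ≤ r + s := add_le_add hr1 hs1
  have hfin : 2 * τ.val (CFC.abs (x + y)) ≤ 2 * (τ.val (CFC.abs x) + τ.val (CFC.abs y)) := by
    rw [← val_two τ habs, mul_add]
    refine (val_mono τ (add_mem habs habs) (add_mem hr hs) hle).trans ?_
    rw [val_add τ hr hs]
    exact add_le_add (hr2.trans (by gcongr; exact key u hu1))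
      (hs2.trans (by gcongr; exact key v hv1))
  exact (ENNReal.mul_le_mul_iff_right (by simp) (by simp)).1 hfin

theorem val_abs_mul_mul_lt (τ : NFSTrace N) {x y z : H →L[ℂ] H} (hy : y ∈ N) (hx : x ∈ N)
    (hz : z ∈ N) (h : τ.val (CFC.abs x) < ⊤) : τ.val (CFC.abs (y * x * z)) < ⊤ := by
  have hN := mul_mem (mul_mem hy hx) hz
  obtain ⟨w, hw, -, -, hw2⟩ := exists_polar hN
  obtain ⟨u, hu, -, hu2, -⟩ := exists_polar hx
  obtain ⟨r, hr, hr1, hr2⟩ := exists_majorant τ (mul_mem (mul_mem (star_mem hw) hy) hu)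
    (abs_mem_posCone hx) hz
  have hq : CFC.abs (y * x * z) = star w * y * u * CFC.abs x * z := by
    rw [hw2, mul_assoc (star w * y) u, ← hu2]; noncomm_ring
  have habs := abs_mem_posCone hN
  have hle : CFC.abs (y * x * z) ≤ r := by
    refine le_trans ?_ hr1
    rw [← hq, habs.2.isSelfAdjoint.star_eq]
    exact le_add_of_nonneg_left habs.2
  exact (val_mono τ habs hr hle).trans_lt (hr2.trans_lt (ENNReal.mul_lt_top (by simp) h))

theorem val_abs_smul (τ : NFSTrace N) {x : H →L[ℂ] H} (c : ℂ) (hx : x ∈ N) :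
    τ.val (CFC.abs (c • x)) = ‖c‖₊ * τ.val (CFC.abs x) := by
  rw [CFC.abs_smul c x, ← val_smul τ _ (abs_mem_posCone hx)]
  rfl

/-- The trace ideal `L¹_τ(N) = {x ∈ N : τ(|x|) < ∞}`. -/
def traceIdeal (τ : NFSTrace N) : Submodule ℂ (H →L[ℂ] H) where
  carrier := {x | x ∈ N ∧ τ.val (CFC.abs x) < ⊤}
  zero_mem' := ⟨zero_mem N, by
    rw [CFC.abs_zero, val_of_mem τ (zero_mem _)]
    exact (map_zero τ.toFun).trans_lt ENNReal.zero_lt_top⟩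
  add_mem' := fun hx hy => ⟨add_mem hx.1 hy.1,
    (val_abs_add_le τ hx.1 hy.1).trans_lt (ENNReal.add_lt_top.2 ⟨hx.2, hy.2⟩)⟩
  smul_mem' := fun c x hx => ⟨N.toStarSubalgebra.smul_mem (x := x) hx.1 c, by
    rw [val_abs_smul τ c hx.1]; exact ENNReal.mul_lt_top (by simp) hx.2⟩

theorem mul_mem_traceIdeal (τ : NFSTrace N) {x y z : H →L[ℂ] H} (hy : y ∈ N)
    (hx : x ∈ traceIdeal τ) (hz : z ∈ N) : y * x * z ∈ traceIdeal τ :=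
  ⟨mul_mem (mul_mem hy hx.1) hz, val_abs_mul_mul_lt τ hy hx.1 hz hx.2⟩

/-- The trace ideal as a type, carrying the norm `‖x‖ + τ(|x|)` (not the operator norm). -/
def L1 (τ : NFSTrace N) : Type _ := ↥(traceIdeal τ)

instance (τ : NFSTrace N) : AddCommGroup (L1 τ) := inferInstanceAs (AddCommGroup (traceIdeal τ))

instance (τ : NFSTrace N) : Module ℂ (L1 τ) := inferInstanceAs (Module ℂ (traceIdeal τ))

/-- The inclusion `L¹_τ(N) → B(H)`. -/
def L1.val {τ : NFSTrace N} : L1 τ →ₗ[ℂ] (H →L[ℂ] H) := (traceIdeal τ).subtype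

instance (τ : NFSTrace N) : Norm (L1 τ) :=
  ⟨fun x => ‖x.val‖ + (τ.val (CFC.abs x.val)).toReal⟩

theorem L1.norm_def {τ : NFSTrace N} (x : L1 τ) :
    ‖x‖ = ‖x.val‖ + (τ.val (CFC.abs x.val)).toReal := rfl

theorem L1.mem {τ : NFSTrace N} (x : L1 τ) : x.val ∈ traceIdeal τ := Subtype.prop _

theorem L1.core (τ : NFSTrace N) : NormedSpace.Core ℂ (L1 τ) where
  norm_nonneg x := add_nonneg (norm_nonneg _) ENNReal.toReal_nonneg
  norm_smul c x := by
    rw [L1.norm_def, L1.norm_def, map_smul, norm_smul, val_abs_smul τ c x.mem.1,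
      ENNReal.toReal_mul, mul_add]
    rfl
  norm_triangle x y := by
    rw [L1.norm_def, L1.norm_def, L1.norm_def, map_add]
    have h1 := norm_add_le x.val y.val
    have h2 := ENNReal.toReal_mono (ENNReal.add_lt_top.2 ⟨x.mem.2, y.mem.2⟩).ne
      (val_abs_add_le τ x.mem.1 y.mem.1)
    rw [ENNReal.toReal_add x.mem.2.ne y.mem.2.ne] at h2
    linarith
  norm_eq_zero_iff x := by
    constructor
    · intro h
      rw [L1.norm_def] at h
      have h1 : ‖x.val‖ = 0 := by
        have := norm_nonneg x.val
        have := ENNReal.toReal_nonneg (a := τ.val (CFC.abs x.val))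
        linarith
      exact Subtype.ext (norm_eq_zero.1 h1)
    · rintro rfl
      rw [L1.norm_def, map_zero, CFC.abs_zero, val_of_mem τ (zero_mem _)]
      have : τ.toFun ⟨0, zero_mem _⟩ = 0 := map_zero τ.toFun
      rw [this]
      simp

instance (τ : NFSTrace N) : NormedAddCommGroup (L1 τ) := fast_instance%
  NormedAddCommGroup.ofCore (L1.core τ)

instance (τ : NFSTrace N) : NormedSpace ℂ (L1 τ) := NormedSpace.ofCore (L1.core τ)

/-- The linear extension of `τ` to the trace ideal,
`τ(x) = τ((Re x)⁺) - τ((Re x)⁻) + i (τ((Im x)⁺) - τ((Im x)⁻))`.  It is only meant to be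
evaluated on `L¹_τ(N)`, where the four terms are finite. -/
def NFSTrace.ext (τ : NFSTrace N) (x : H →L[ℂ] H) : ℂ :=
  (((τ.val (ℜ x : H →L[ℂ] H)⁺).toReal - (τ.val (ℜ x : H →L[ℂ] H)⁻).toReal : ℝ) : ℂ) +
    Complex.I *
      (((τ.val (ℑ x : H →L[ℂ] H)⁺).toReal - (τ.val (ℑ x : H →L[ℂ] H)⁻).toReal : ℝ) : ℂ)

end Ideal

/-! ## General linear groups -/

section GeneralLinear

variable {R : Type*} [Ring R]

/-- `GL_n(R)`, for a possibly non-commutative unital ring `R`. -/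
abbrev GLn (R : Type*) [Ring R] (n : ℕ) : Type _ := (Matrix (Fin n) (Fin n) R)ˣ

/-- `x ↦ x ⊕ 1_{m-n}`. -/
def pad {n : ℕ} (m : ℕ) (x : Matrix (Fin n) (Fin n) R) : Matrix (Fin m) (Fin m) R :=
  Matrix.of fun i j => if h : i.1 < n ∧ j.1 < n then x ⟨i, h.1⟩ ⟨j, h.2⟩ else if i = j then 1 else 0

theorem pad_one {n m : ℕ} : pad m (1 : Matrix (Fin n) (Fin n) R) = 1 := by
  ext i j
  simp only [pad, Matrix.of_apply, Matrix.one_apply, Fin.ext_iff]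
  split_ifs <;> rfl

theorem pad_mul {n m : ℕ} (h : n ≤ m) (x y : Matrix (Fin n) (Fin n) R) :
    pad m (x * y) = pad m x * pad m y := by
  obtain ⟨k, rfl⟩ := Nat.exists_eq_add_of_le h
  have h1 : ∀ (i : Fin n) (j : ℕ), (i : ℕ) ≠ n + j := fun i j => by omega
  have h2 : ∀ (i : Fin n) (j : ℕ), n + j ≠ (i : ℕ) := fun i j => by omega
  ext i j
  rw [Matrix.mul_apply, Fin.sum_univ_add]
  refine Fin.addCases (fun i => ?_) (fun i => ?_) i <;>
  refine Fin.addCases (fun j => ?_) (fun j => ?_) j <;>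
  simp [pad, Matrix.mul_apply, Fin.ext_iff, h1, h2]
  simp [← Fin.ext_iff]

theorem pad_self {n : ℕ} (x : Matrix (Fin n) (Fin n) R) : pad n x = x := by
  ext i j; simp [pad]

theorem pad_pad {n m k : ℕ} (h : n ≤ m) (x : Matrix (Fin n) (Fin n) R) :
    pad k (pad m x) = pad k x := by
  ext i j
  simp only [pad, Matrix.of_apply, Fin.ext_iff]
  split_ifs <;> first | rfl | omega

/-- The inclusion `GL_n(R) → GL_m(R)`, `g ↦ g ⊕ 1_{m-n}`. -/
def stab (R : Type*) [Ring R] (n m : ℕ) (h : n ≤ m) : GLn R n →* GLn R m :=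
  Units.map
    { toFun := pad m
      map_one' := pad_one
      map_mul' := pad_mul h }

theorem coe_stab {n m : ℕ} (h : n ≤ m) (g : GLn R n) :
    (stab R n m h g : Matrix (Fin m) (Fin m) R) = pad m (g : Matrix (Fin n) (Fin n) R) := rfl

instance : DirectedSystem (GLn R) (stab R · · ·) where
  map_self _ _ := Units.ext (pad_self _)
  map_map _ _ _ hij _ _ := Units.ext (pad_pad hij _)

/-- `GL_∞(R) = lim_n GL_n(R)`. -/
abbrev GLInf (R : Type*) [Ring R] : Type _ := DirectLimit (GLn R) (stab R)

/-- The canonical map `GL_n(R) → GL_∞(R)`. -/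
def GLInf.of (R : Type*) [Ring R] (n : ℕ) : GLn R n →* GLInf R :=
  MonoidHom.mk' (fun g => ⟦⟨n, g⟩⟧) fun a b => (DirectLimit.mul_def n a b).symm

theorem GLInf.of_stab {n m : ℕ} (h : n ≤ m) (g : GLn R n) :
    GLInf.of R m (stab R n m h g) = GLInf.of R n g :=
  Quotient.sound ⟨m, le_rfl, h, DirectedSystem.map_self' (stab R) _⟩

theorem GLInf.exists_of (x : GLInf R) : ∃ n g, GLInf.of R n g = x := by
  induction x using DirectLimit.induction with
  | _ n g => exact ⟨n, g, rfl⟩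

end GeneralLinear

section KTheory

variable {H : Type*} [NormedAddCommGroup H] [InnerProductSpace ℂ H] [CompleteSpace H]
  {N : VonNeumannAlgebra H}

theorem mul_mem_left (τ : NFSTrace N) (y : N) {x : N} (hx : (x : H →L[ℂ] H) ∈ traceIdeal τ) :
    ((y * x : N) : H →L[ℂ] H) ∈ traceIdeal τ := by
  simpa using mul_mem_traceIdeal τ y.2 hx (one_mem N)

theorem mul_mem_right (τ : NFSTrace N) (y : N) {x : N} (hx : (x : H →L[ℂ] H) ∈ traceIdeal τ) :
    ((x * y : N) : H →L[ℂ] H) ∈ traceIdeal τ := by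
  simpa using mul_mem_traceIdeal τ (one_mem N) hx y.2

/-- The matrices with entries in the trace ideal, `M_n(L¹_τ(N)) ⊆ M_n(N)`. -/
def matIdeal (τ : NFSTrace N) (n : ℕ) : AddSubgroup (Matrix (Fin n) (Fin n) N) where
  carrier := {x | ∀ i j, (x i j : H →L[ℂ] H) ∈ traceIdeal τ}
  zero_mem' := fun _ _ => zero_mem (traceIdeal τ)
  add_mem' := fun hx hy i j => add_mem (hx i j) (hy i j)
  neg_mem' := fun hx i j => neg_mem (hx i j)

theorem mem_matIdeal {τ : NFSTrace N} {n : ℕ} {x : Matrix (Fin n) (Fin n) N} :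
    x ∈ matIdeal τ n ↔ ∀ i j, (x i j : H →L[ℂ] H) ∈ traceIdeal τ := Iff.rfl

theorem matIdeal_mul_left (τ : NFSTrace N) {n : ℕ} (y : Matrix (Fin n) (Fin n) N)
    {x : Matrix (Fin n) (Fin n) N} (hx : x ∈ matIdeal τ n) : y * x ∈ matIdeal τ n := by
  intro i j
  rw [Matrix.mul_apply, AddSubmonoidClass.coe_finsetSum]
  exact sum_mem fun k _ => mul_mem_left τ _ (hx k j)

theorem matIdeal_mul_right (τ : NFSTrace N) {n : ℕ} (y : Matrix (Fin n) (Fin n) N)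
    {x : Matrix (Fin n) (Fin n) N} (hx : x ∈ matIdeal τ n) : x * y ∈ matIdeal τ n := by
  intro i j
  rw [Matrix.mul_apply, AddSubmonoidClass.coe_finsetSum]
  exact sum_mem fun k _ => mul_mem_right τ _ (hx i k)

/-- `GL_n(L¹_τ(N))`, the invertible `g ∈ M_n(N)` with `g - 1 ∈ M_n(L¹_τ(N))`. -/
def GLnL1 (τ : NFSTrace N) (n : ℕ) : Subgroup (GLn N n) where
  carrier := {g | (g : Matrix (Fin n) (Fin n) N) - 1 ∈ matIdeal τ n}
  one_mem' := by
    show ((1 : GLn N n) : Matrix (Fin n) (Fin n) N) - 1 ∈ matIdeal τ n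
    rw [Units.val_one, sub_self]; exact zero_mem _
  mul_mem' := fun {g h} hg hh => by
    have : ((g * h : GLn N n) : Matrix (Fin n) (Fin n) N) - 1 =
        ((g : Matrix (Fin n) (Fin n) N) - 1) * h + ((h : Matrix (Fin n) (Fin n) N) - 1) := by
      rw [Units.val_mul]; noncomm_ring
    show ((g * h : GLn N n) : Matrix (Fin n) (Fin n) N) - 1 ∈ matIdeal τ n
    rw [this]
    exact add_mem (matIdeal_mul_right τ _ hg) hh
  inv_mem' := fun {g} hg => by
    have : ((g⁻¹ : GLn N n) : Matrix (Fin n) (Fin n) N) - 1 =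
        -((g⁻¹ : GLn N n) * ((g : Matrix (Fin n) (Fin n) N) - 1)) := by
      rw [mul_sub, Units.inv_mul, mul_one, neg_sub]
    show ((g⁻¹ : GLn N n) : Matrix (Fin n) (Fin n) N) - 1 ∈ matIdeal τ n
    rw [this]
    exact neg_mem (matIdeal_mul_left τ _ hg)

theorem mem_GLnL1 {τ : NFSTrace N} {n : ℕ} {g : GLn N n} :
    g ∈ GLnL1 τ n ↔ (g : Matrix (Fin n) (Fin n) N) - 1 ∈ matIdeal τ n := Iff.rfl

theorem conj_mem_GLnL1 {τ : NFSTrace N} {n : ℕ} {g : GLn N n} (hg : g ∈ GLnL1 τ n)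
    (h : GLn N n) : h * g * h⁻¹ ∈ GLnL1 τ n := by
  have : ((h * g * h⁻¹ : GLn N n) : Matrix (Fin n) (Fin n) N) - 1 =
      h * ((g : Matrix (Fin n) (Fin n) N) - 1) * (h⁻¹ : GLn N n) := by
    rw [mul_sub, sub_mul, mul_one, Units.mul_inv, Units.val_mul, Units.val_mul]
  rw [mem_GLnL1, this]
  exact matIdeal_mul_right τ _ (matIdeal_mul_left τ _ hg)

theorem stab_mem_GLnL1 {τ : NFSTrace N} {n m : ℕ} (h : n ≤ m) {g : GLn N n}
    (hg : g ∈ GLnL1 τ n) : stab N n m h g ∈ GLnL1 τ m := by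
  rw [mem_GLnL1, coe_stab]
  intro i j
  by_cases hij : i.1 < n ∧ j.1 < n
  · have : (pad m (g : Matrix (Fin n) (Fin n) N) - 1) i j =
        ((g : Matrix (Fin n) (Fin n) N) - 1) ⟨i, hij.1⟩ ⟨j, hij.2⟩ := by
      simp [pad, hij, Matrix.one_apply, Fin.ext_iff]
    rw [this]
    exact hg _ _
  · have : (pad m (g : Matrix (Fin n) (Fin n) N) - 1) i j = 0 := by
      simp [pad, hij, Matrix.one_apply]
    rw [this]
    exact zero_mem (traceIdeal τ)

/-- `GL_∞(L¹_τ(N))`, the union of the `GL_n(L¹_τ(N))` inside `GL_∞(N)`. -/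
def GLInfL1 (τ : NFSTrace N) : Subgroup (GLInf N) where
  carrier := {x | ∃ n, ∃ g ∈ GLnL1 τ n, GLInf.of N n g = x}
  one_mem' := ⟨0, 1, one_mem _, map_one _⟩
  mul_mem' := by
    rintro _ _ ⟨n, g, hg, rfl⟩ ⟨m, h, hh, rfl⟩
    refine ⟨max n m, _, mul_mem (stab_mem_GLnL1 (le_max_left n m) hg)
      (stab_mem_GLnL1 (le_max_right n m) hh), ?_⟩
    rw [map_mul, GLInf.of_stab, GLInf.of_stab]
  inv_mem' := by
    rintro _ ⟨n, g, hg, rfl⟩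
    exact ⟨n, g⁻¹, inv_mem hg, map_inv _ _⟩

instance (τ : NFSTrace N) : (GLInfL1 τ).Normal where
  conj_mem := by
    rintro _ ⟨n, g, hg, rfl⟩ y
    obtain ⟨m, h, rfl⟩ := GLInf.exists_of y
    refine ⟨max n m, _, conj_mem_GLnL1 (stab_mem_GLnL1 (le_max_left n m) hg)
      (stab N m _ (le_max_right n m) h), ?_⟩
    rw [map_mul, map_mul, map_inv, GLInf.of_stab, GLInf.of_stab]

/-- The relative algebraic `K`-group
`K₁^alg(L¹_τ(N), N) = GL_∞(L¹_τ(N)) / [GL_∞(L¹_τ(N)), GL_∞(N)]`. -/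
abbrev K1alg (τ : NFSTrace N) : Type _ :=
  GLInfL1 τ ⧸ (⁅GLInfL1 τ, (⊤ : Subgroup (GLInf N))⁆).subgroupOf (GLInfL1 τ)

/-- The class `[g] ∈ K₁^alg(L¹_τ(N), N)` of `g ∈ GL_n(L¹_τ(N))`. -/
def K1alg.mk (τ : NFSTrace N) {n : ℕ} (g : GLnL1 τ n) : K1alg τ :=
  QuotientGroup.mk ⟨GLInf.of N n g, n, g, g.2, rfl⟩

/-- An invertible `g ∈ N` with `g - 1 ∈ L¹_τ(N)`, as an element of `GL_1(L¹_τ(N))`. -/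
def toGL1 (τ : NFSTrace N) (g : Nˣ) (hg : ((g : N) : H →L[ℂ] H) - 1 ∈ traceIdeal τ) :
    GLnL1 τ 1 :=
  ⟨Units.map (Matrix.scalar (Fin 1) : N →+* Matrix (Fin 1) (Fin 1) N).toMonoidHom g, by
    intro i j
    rw [Subsingleton.elim j i]
    simpa using hg⟩

/-! ## Smooth paths and the determinant -/

/-- The `(i, j)` entry of `g - 1`, for `g ∈ GL_n(L¹_τ(N))`, as an element of `L¹_τ(N)`. -/
def devEntry {τ : NFSTrace N} {n : ℕ} (g : GLnL1 τ n) (i j : Fin n) : L1 τ :=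
  ⟨(((g : GLn N n) : Matrix (Fin n) (Fin n) N) - 1) i j, g.2 i j⟩

/-- The smooth paths `σ : [0, 1] → GL_n(L¹_τ(N))` with `σ(0) = 1`.  Smoothness refers to the norm
`‖x‖ + τ(|x|)` of `L¹_τ(N)` in each entry; the values of `σ` outside `[0, 1]` play no role. -/
structure SmoothPath (τ : NFSTrace N) (n : ℕ) where
  /-- the path -/
  toFun : ℝ → GLnL1 τ n
  zero : toFun 0 = 1
  smooth : ∀ i j, ContDiffOn ℝ ((⊤ : ℕ∞) : WithTop ℕ∞) (fun t => devEntry (toFun t) i j)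
    (Set.Icc 0 1)

/-- The matrix `∫₀¹ (dσ/dt) σ⁻¹ dt`. -/
def SmoothPath.logInt {τ : NFSTrace N} {n : ℕ} (σ : SmoothPath τ n) :
    Matrix (Fin n) (Fin n) (H →L[ℂ] H) :=
  Matrix.of fun i k => ∫ t in (0 : ℝ)..1, ∑ j,
    (derivWithin (fun s => devEntry (σ.toFun s) i j) (Set.Icc 0 1) t).val *
      (((((σ.toFun t)⁻¹ : GLnL1 τ n) : GLn N n) : Matrix (Fin n) (Fin n) N) j k : H →L[ℂ] H)

/-- `τ̃(σ) = -τ(tr ∫₀¹ (dσ/dt) σ⁻¹ dt)`. -/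
def SmoothPath.tauTilde {τ : NFSTrace N} {n : ℕ} (σ : SmoothPath τ n) : ℂ :=
  -τ.ext σ.logInt.trace

/-- `σ` is a lift of `κ ∈ K₁^alg(L¹_τ(N), N)`, that is `[σ(1)⁻¹] = κ`. -/
def SmoothPath.IsLift {τ : NFSTrace N} {n : ℕ} (σ : SmoothPath τ n) (κ : K1alg τ) : Prop :=
  K1alg.mk τ (σ.toFun 1)⁻¹ = κ

open Classical in
/-- The semi-finite Fuglede-Kadison determinant `det_τ(κ) = exp(Re τ̃(σ))`, where `σ` is any lift
of `κ`. -/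
def detTau (τ : NFSTrace N) (κ : K1alg τ) : ℝ :=
  if h : ∃ p : (n : ℕ) × SmoothPath τ n, p.2.IsLift κ then Real.exp h.choose.2.tauTilde.re else 1

end KTheory

end FugledeKadison
end

noncomputable section

open scoped NNReal ENNReal ContDiff ComplexStarModule

namespace FugledeKadison

/-! ## The trace on the trace ideal -/

section Trace

variable {H : Type*} [NormedAddCommGroup H] [InnerProductSpace ℂ H] [CompleteSpace H]
  {N : VonNeumannAlgebra H}

/-! Write `T` for the trace and, for a path `σ` in `1 + M_n(L¹)` starting at `1`, consider `L(σ) = ∫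
T(σ' σ⁻¹)`. Loops may have nonzero `L(σ)`, so `L` itself is not a function of the end point, but its
real part is. The reason is that `L(σ*σ) = conj L(σ) + L(σ) = 2 Re L(σ)`, since the logarithmic
derivative of a product has the sum of the two traces, and that `σ*σ` runs in the positive
invertible elements, a convex set. The form `v ↦ T(v a⁻¹)` is closed because `T` is a trace, so on a
convex set it has a primitive. Hence `Re L(σ)` depends only on `σ(1)*σ(1)`, that is, on the absolute
value of the end point. This is `TracedIdeal.re_logIntegral_eq`, and no knowledge of the fundamental
group is needed.

Paths exist by polar decomposition (`TracedIdeal.Rep.exists_path`). The positive factor is joined to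
`1` by a segment. The unitary factor is a product of unitaries with non-negative real part, each of
which is joined to `1` by a segment of invertible elements. These paths are polynomial in `t`, hence
smooth.

So `logDet g = Re L(σ)`, for any path `σ` from `1` to `g`, is well defined. It is additive (multiply
paths pointwise), invariant under conjugation by all of `GL_n(N)` (conjugate the path) and stable
under `g ↦ g ⊕ 1`. It therefore kills `[GL_∞(L¹), GL_∞(N)]` and descends to the K-group. As only the
absolute value of the end point matters, Brown's formula is read off from the path `exp(t log|g|)`,
whose logarithmic derivative is the constant `log|g|`.

The analytic input is that `L¹` is a Banach space on which the linear extension of `τ` is a bounded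
trace. Boundedness comes from polar decomposition and the majorant of `exists_majorant`, the trace
property from unitary invariance and the fact that unitaries span `N`, completeness from normality.
-/

theorem isClosed_coe (N : VonNeumannAlgebra H) : IsClosed (N : Set (H →L[ℂ] H)) := by
  have : (N : Set (H →L[ℂ] H)) = ⋂ y ∈ N.commutant, {a | y * a = a * y} := by
    ext a
    simp only [SetLike.mem_coe, Set.mem_iInter]
    exact ⟨fun h y hy => (commute_of_mem h hy).eq, fun h => mem_of_commute fun y hy => h y hy⟩
  rw [this]
  exact isClosed_biInter fun y _ => isClosed_eq (by fun_prop) (by fun_prop)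

theorem smul_mem_coe (c : ℂ) {x : H →L[ℂ] H} (hx : x ∈ N) : c • x ∈ N :=
  N.toStarSubalgebra.smul_mem (x := x) hx c

theorem cfc_mem {a : H →L[ℂ] H} (ha : a ∈ N) (f : ℝ → ℝ) : cfc f a ∈ N :=
  mem_of_commute fun _ hy => ((commute_of_mem ha hy).symm.cfc_real f).symm

theorem posPart_mem {a : H →L[ℂ] H} (ha : a ∈ N) : a⁺ ∈ posCone N :=
  ⟨mem_of_commute fun _ hy => ((commute_of_mem ha hy).symm.cfcₙ_real _).symm,
    CFC.posPart_nonneg a⟩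

theorem negPart_mem {a : H →L[ℂ] H} (ha : a ∈ N) : a⁻ ∈ posCone N :=
  ⟨mem_of_commute fun _ hy => ((commute_of_mem ha hy).symm.cfcₙ_real _).symm,
    CFC.negPart_nonneg a⟩

theorem mem_traceIdeal_of_posCone {τ : NFSTrace N} {p : H →L[ℂ] H} (hp : p ∈ posCone N)
    (h : τ.val p < ⊤) : p ∈ traceIdeal τ :=
  ⟨hp.1, by rwa [CFC.abs_of_nonneg p hp.2]⟩

theorem abs_mem_traceIdeal {τ : NFSTrace N} {x : H →L[ℂ] H} (h : x ∈ traceIdeal τ) :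
    CFC.abs x ∈ traceIdeal τ :=
  mem_traceIdeal_of_posCone (abs_mem_posCone h.1) h.2

theorem star_mem_traceIdeal {τ : NFSTrace N} {x : H →L[ℂ] H} (h : x ∈ traceIdeal τ) :
    star x ∈ traceIdeal τ := by
  obtain ⟨u, hu, -, hu2, -⟩ := exists_polar h.1
  have : star x = 1 * CFC.abs x * star u := by
    conv_lhs => rw [hu2]
    rw [star_mul, (CFC.abs_nonneg x).isSelfAdjoint.star_eq, one_mul]
  rw [this]
  exact mul_mem_traceIdeal τ (one_mem N) (abs_mem_traceIdeal h) (star_mem hu)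

/-- The real number `τ(x⁺) - τ(x⁻)`. -/
def NFSTrace.reExt (τ : NFSTrace N) (x : H →L[ℂ] H) : ℝ := (τ.val x⁺).toReal - (τ.val x⁻).toReal

theorem ext_eq (τ : NFSTrace N) (x : H →L[ℂ] H) :
    τ.ext x = (τ.reExt (ℜ x : H →L[ℂ] H) : ℂ) + Complex.I * (τ.reExt (ℑ x : H →L[ℂ] H) : ℂ) := rfl

theorem val_posPart_lt {τ : NFSTrace N} {x : H →L[ℂ] H} (hs : IsSelfAdjoint x)
    (hx : x ∈ traceIdeal τ) : τ.val x⁺ < ⊤ := by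
  refine (val_mono τ (posPart_mem hx.1) (abs_mem_posCone hx.1) ?_).trans_lt hx.2
  rw [← CFC.posPart_add_negPart x]
  exact le_add_of_nonneg_right (CFC.negPart_nonneg x)

theorem val_negPart_lt {τ : NFSTrace N} {x : H →L[ℂ] H} (hs : IsSelfAdjoint x)
    (hx : x ∈ traceIdeal τ) : τ.val x⁻ < ⊤ := by
  refine (val_mono τ (negPart_mem hx.1) (abs_mem_posCone hx.1) ?_).trans_lt hx.2
  rw [← CFC.posPart_add_negPart x]
  exact le_add_of_nonneg_left (CFC.posPart_nonneg x)

/-- The identity `(a - b)⁺ + b = a + (a - b)⁻` lives in the positive cone, where `τ` is additive.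
Thus every decomposition into finite positive elements computes `reExt`, and additivity and
homogeneity follow. -/
theorem reExt_sub_eq {τ : NFSTrace N} {a b : H →L[ℂ] H} (ha : a ∈ posCone N) (hb : b ∈ posCone N)
    (ha' : τ.val a < ⊤) (hb' : τ.val b < ⊤) :
    τ.reExt (a - b) = (τ.val a).toReal - (τ.val b).toReal := by
  have hs : IsSelfAdjoint (a - b) := ha.2.isSelfAdjoint.sub hb.2.isSelfAdjoint
  have hx : a - b ∈ traceIdeal τ :=
    sub_mem (mem_traceIdeal_of_posCone ha ha') (mem_traceIdeal_of_posCone hb hb')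
  have h1 : (a - b)⁺ + b = a + (a - b)⁻ := by
    have := CFC.posPart_sub_negPart (a - b) hs
    rw [sub_eq_sub_iff_add_eq_add] at this
    exact this
  have h2 := congrArg (fun y => (τ.val y).toReal) h1
  simp only [val_add τ (posPart_mem hx.1) hb, val_add τ ha (negPart_mem hx.1)] at h2
  rw [ENNReal.toReal_add (val_posPart_lt hs hx).ne hb'.ne,
    ENNReal.toReal_add ha'.ne (val_negPart_lt hs hx).ne] at h2
  rw [NFSTrace.reExt]
  linarith

theorem reExt_add {τ : NFSTrace N} {x y : H →L[ℂ] H} (hxs : IsSelfAdjoint x)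
    (hys : IsSelfAdjoint y) (hx : x ∈ traceIdeal τ) (hy : y ∈ traceIdeal τ) :
    τ.reExt (x + y) = τ.reExt x + τ.reExt y := by
  have h1 : x + y = (x⁺ + y⁺) - (x⁻ + y⁻) := by
    conv_lhs => rw [← CFC.posPart_sub_negPart x hxs, ← CFC.posPart_sub_negPart y hys]
    abel
  have hxp := val_posPart_lt hxs hx
  have hyp := val_posPart_lt hys hy
  have hxn := val_negPart_lt hxs hx
  have hyn := val_negPart_lt hys hy
  have e1 := val_add τ (posPart_mem hx.1) (posPart_mem hy.1)
  have e2 := val_add τ (negPart_mem hx.1) (negPart_mem hy.1)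
  rw [h1, reExt_sub_eq (add_mem (posPart_mem hx.1) (posPart_mem hy.1))
    (add_mem (negPart_mem hx.1) (negPart_mem hy.1)) (e1 ▸ ENNReal.add_lt_top.2 ⟨hxp, hyp⟩)
    (e2 ▸ ENNReal.add_lt_top.2 ⟨hxn, hyn⟩), e1, e2, ENNReal.toReal_add hxp.ne hyp.ne,
    ENNReal.toReal_add hxn.ne hyn.ne, NFSTrace.reExt, NFSTrace.reExt]
  ring

theorem reExt_neg (τ : NFSTrace N) (x : H →L[ℂ] H) : τ.reExt (-x) = -τ.reExt x := by
  rw [NFSTrace.reExt, NFSTrace.reExt, CFC.posPart_neg, CFC.negPart_neg, neg_sub]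

theorem reExt_smul {τ : NFSTrace N} {x : H →L[ℂ] H} (hxs : IsSelfAdjoint x)
    (hx : x ∈ traceIdeal τ) (c : ℝ) : τ.reExt (c • x) = c * τ.reExt x := by
  have key : ∀ c : ℝ≥0, τ.reExt (c • x) = c * τ.reExt x := by
    intro c
    have h1 : c • x = c • x⁺ - c • x⁻ := by
      rw [← smul_sub, CFC.posPart_sub_negPart x hxs]
    have e1 := val_smul τ c (posPart_mem hx.1)
    have e2 := val_smul τ c (negPart_mem hx.1)
    rw [h1, reExt_sub_eq ((posCone N).smul_mem c (posPart_mem hx.1))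
      ((posCone N).smul_mem c (negPart_mem hx.1))
      (e1 ▸ ENNReal.mul_lt_top (by simp) (val_posPart_lt hxs hx))
      (e2 ▸ ENNReal.mul_lt_top (by simp) (val_negPart_lt hxs hx)), e1, e2,
      ENNReal.toReal_mul, ENNReal.toReal_mul, NFSTrace.reExt]
    simp only [ENNReal.coe_toReal]
    ring
  rcases le_total 0 c with hc | hc
  · exact key ⟨c, hc⟩
  · obtain ⟨d, hd⟩ : ∃ d : ℝ≥0, c = -(d : ℝ) := ⟨(-c).toNNReal, by
      rw [Real.coe_toNNReal _ (by linarith), neg_neg]⟩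
    have h2 : c • x = -(d • x) := by rw [hd, neg_smul]; rfl
    rw [h2, reExt_neg, key d, hd]
    simp

theorem realPart_mem_traceIdeal {τ : NFSTrace N} {x : H →L[ℂ] H} (hx : x ∈ traceIdeal τ) :
    (ℜ x : H →L[ℂ] H) ∈ traceIdeal τ := by
  rw [realPart_apply_coe, ← Complex.coe_smul]
  exact (traceIdeal τ).smul_mem _ (add_mem hx (star_mem_traceIdeal hx))

theorem imaginaryPart_mem_traceIdeal {τ : NFSTrace N} {x : H →L[ℂ] H} (hx : x ∈ traceIdeal τ) :
    (ℑ x : H →L[ℂ] H) ∈ traceIdeal τ := by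
  rw [imaginaryPart_apply_coe, ← Complex.coe_smul]
  exact (traceIdeal τ).smul_mem _
    ((traceIdeal τ).smul_mem _ (sub_mem hx (star_mem_traceIdeal hx)))

theorem ext_add {τ : NFSTrace N} {x y : H →L[ℂ] H} (hx : x ∈ traceIdeal τ)
    (hy : y ∈ traceIdeal τ) : τ.ext (x + y) = τ.ext x + τ.ext y := by
  rw [ext_eq, ext_eq, ext_eq, map_add, map_add, AddSubgroup.coe_add, AddSubgroup.coe_add,
    reExt_add (ℜ x).2 (ℜ y).2 (realPart_mem_traceIdeal hx) (realPart_mem_traceIdeal hy),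
    reExt_add (ℑ x).2 (ℑ y).2 (imaginaryPart_mem_traceIdeal hx) (imaginaryPart_mem_traceIdeal hy)]
  push_cast
  ring

theorem ext_real_smul {τ : NFSTrace N} {x : H →L[ℂ] H} (hx : x ∈ traceIdeal τ) (c : ℝ) :
    τ.ext ((c : ℂ) • x) = c * τ.ext x := by
  rw [ext_eq, ext_eq, Complex.coe_smul, map_smul, map_smul]
  have h1 := reExt_smul (ℜ x).2 (realPart_mem_traceIdeal hx) c
  have h2 := reExt_smul (ℑ x).2 (imaginaryPart_mem_traceIdeal hx) c
  rw [selfAdjoint.val_smul, selfAdjoint.val_smul, h1, h2]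
  push_cast
  ring

theorem ext_I_smul (τ : NFSTrace N) (x : H →L[ℂ] H) :
    τ.ext (Complex.I • x) = Complex.I * τ.ext x := by
  rw [ext_eq, ext_eq, realPart_I_smul, imaginaryPart_I_smul, AddSubgroup.coe_neg, reExt_neg]
  push_cast
  linear_combination (-(τ.reExt (ℑ x : H →L[ℂ] H) : ℂ)) * Complex.I_mul_I

theorem ext_smul {τ : NFSTrace N} {x : H →L[ℂ] H} (hx : x ∈ traceIdeal τ) (c : ℂ) :
    τ.ext (c • x) = c * τ.ext x := by
  have h1 : c • x = (c.re : ℂ) • x + Complex.I • ((c.im : ℂ) • x) := by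
    rw [smul_smul, ← add_smul, mul_comm Complex.I, Complex.re_add_im]
  have hx1 := (traceIdeal τ).smul_mem (c.re : ℂ) hx
  have hx2 := (traceIdeal τ).smul_mem (c.im : ℂ) hx
  rw [h1, ext_add hx1 ((traceIdeal τ).smul_mem _ hx2), ext_I_smul, ext_real_smul hx,
    ext_real_smul hx]
  linear_combination (τ.ext x) * Complex.re_add_im c

theorem ext_star (τ : NFSTrace N) (x : H →L[ℂ] H) : τ.ext (star x) = star (τ.ext x) := by
  have h1 : (ℜ (star x) : H →L[ℂ] H) = ℜ x := by
    rw [realPart_apply_coe, realPart_apply_coe, star_star, add_comm]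
  have h2 : (ℑ (star x) : H →L[ℂ] H) = -ℑ x := by
    rw [imaginaryPart_apply_coe, imaginaryPart_apply_coe, star_star, ← neg_sub x, smul_neg,
      smul_neg]
  rw [ext_eq, ext_eq, h1, h2, reExt_neg]
  simp

theorem ext_of_isSelfAdjoint (τ : NFSTrace N) {x : H →L[ℂ] H} (hx : IsSelfAdjoint x) :
    τ.ext x = (τ.reExt x : ℂ) := by
  rw [ext_eq, hx.coe_realPart, hx.imaginaryPart]
  simp [NFSTrace.reExt]

theorem ext_of_nonneg (τ : NFSTrace N) {x : H →L[ℂ] H} (hx : 0 ≤ x) :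
    τ.ext x = ((τ.val x).toReal : ℂ) := by
  have h0 : τ.val 0 = 0 := by
    rw [val_of_mem τ (zero_mem _)]
    exact map_zero τ.toFun
  rw [ext_of_isSelfAdjoint τ hx.isSelfAdjoint, NFSTrace.reExt,
    (CFC.posPart_eq_self x).2 hx, (CFC.negPart_eq_zero_iff x hx.isSelfAdjoint).2 hx, h0]
  simp

end Trace

/-! ### Norm estimates for the trace and the trace property. -/

section Bounds

variable {H : Type*} [NormedAddCommGroup H] [InnerProductSpace ℂ H] [CompleteSpace H]
  {N : VonNeumannAlgebra H}

/-- With polar decompositions `|yxz| = w* y u |x| z`, and twice this self-adjoint element has a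
majorant of trace at most `(‖w* y u‖² + ‖z‖²) τ|x|`. For contractions the two squares add up to at
most `2`, so the factor `2` cancels and the constant is sharp. -/
theorem val_abs_mul_mul_le_of_norm_le_one (τ : NFSTrace N) {y x z : H →L[ℂ] H} (hy : y ∈ N)
    (hx : x ∈ N) (hz : z ∈ N) (hy1 : ‖y‖ ≤ 1) (hz1 : ‖z‖ ≤ 1) :
    τ.val (CFC.abs (y * x * z)) ≤ τ.val (CFC.abs x) := by
  have hN := mul_mem (mul_mem hy hx) hz
  obtain ⟨w, hw, hw1, -, hw2⟩ := exists_polar hN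
  obtain ⟨u, hu, hu1, hu2, -⟩ := exists_polar hx
  obtain ⟨r, hr, hr1, hr2⟩ := exists_majorant τ (mul_mem (mul_mem (star_mem hw) hy) hu)
    (abs_mem_posCone hx) hz
  have hq : CFC.abs (y * x * z) = star w * y * u * CFC.abs x * z := by
    rw [hw2, mul_assoc (star w * y) u, ← hu2]; noncomm_ring
  have habs := abs_mem_posCone hN
  have hle : CFC.abs (y * x * z) + CFC.abs (y * x * z) ≤ r := by
    refine le_trans (le_of_eq ?_) hr1
    rw [← hq, habs.2.isSelfAdjoint.star_eq]
  have h1 : ‖star w * y * u‖₊ ≤ 1 := by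
    refine (nnnorm_mul_le _ _).trans (mul_le_one' ((nnnorm_mul_le _ _).trans ?_) hu1)
    rw [nnnorm_star]
    exact mul_le_one' hw1 hy1
  have h3 := add_le_add (pow_le_one' h1 2) (pow_le_one' (show ‖z‖₊ ≤ 1 from hz1) 2)
  have h4 : ((‖star w * y * u‖₊ ^ 2 + ‖z‖₊ ^ 2 : ℝ≥0) : ℝ≥0∞) ≤ 2 := by
    refine (ENNReal.coe_le_coe.2 h3).trans (le_of_eq ?_)
    norm_num
  have hfin : 2 * τ.val (CFC.abs (y * x * z)) ≤ 2 * τ.val (CFC.abs x) := by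
    rw [← val_two τ habs]
    exact (val_mono τ (add_mem habs habs) hr hle).trans (hr2.trans (by gcongr))
  exact (ENNReal.mul_le_mul_iff_right (by simp) (by simp)).1 hfin

/-- By homogeneity the two outer factors may be normalised to contractions. -/
theorem val_abs_mul_mul_le (τ : NFSTrace N) {y x z : H →L[ℂ] H} (hy : y ∈ N)
    (hx : x ∈ N) (hz : z ∈ N) :
    τ.val (CFC.abs (y * x * z)) ≤ ‖y‖₊ * ‖z‖₊ * τ.val (CFC.abs x) := by
  have key : ∀ v : H →L[ℂ] H, v ∈ N → ∃ w ∈ N, ‖w‖ ≤ 1 ∧ v = (‖v‖ : ℂ) • w := by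
    intro v hv
    rcases eq_or_ne v 0 with rfl | h0
    · exact ⟨0, zero_mem N, by simp, by simp⟩
    · have hn : (‖v‖ : ℂ) ≠ 0 := by simpa using h0
      refine ⟨(‖v‖ : ℂ)⁻¹ • v, smul_mem_coe _ hv, ?_, ?_⟩
      · rw [norm_smul, norm_inv, Complex.norm_real, norm_norm,
          inv_mul_cancel₀ (by simpa using h0)]
      · rw [smul_smul, mul_inv_cancel₀ hn, one_smul]
  obtain ⟨y', hy', hy1, hy2⟩ := key y hy
  obtain ⟨z', hz', hz1, hz2⟩ := key z hz
  have h1 : y * x * z = ((‖y‖ : ℂ) * ‖z‖) • (y' * x * z') := by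
    conv_lhs => rw [hy2, hz2]
    simp only [smul_mul_assoc, mul_smul_comm, smul_smul]
    rw [mul_comm]
  have h2 : (‖((‖y‖ : ℂ) * ‖z‖)‖₊ : ℝ≥0∞) = ‖y‖₊ * ‖z‖₊ := by
    rw [nnnorm_mul, ENNReal.coe_mul]
    congr 2 <;> (ext; simp)
  rw [h1, val_abs_smul τ _ (mul_mem (mul_mem hy' hx) hz'), h2]
  gcongr
  exact val_abs_mul_mul_le_of_norm_le_one τ hy' hx hz' hy1 hz1

theorem val_abs_star_le (τ : NFSTrace N) {x : H →L[ℂ] H} (hx : x ∈ N) :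
    τ.val (CFC.abs (star x)) ≤ τ.val (CFC.abs x) := by
  obtain ⟨u, hu, hu1, hu2, -⟩ := exists_polar hx
  have : star x = 1 * CFC.abs x * star u := by
    conv_lhs => rw [hu2]
    rw [star_mul, (CFC.abs_nonneg x).isSelfAdjoint.star_eq, one_mul]
  rw [this]
  refine (val_abs_mul_mul_le_of_norm_le_one τ (one_mem N) (abs_mem hx) (star_mem hu)
    ContinuousLinearMap.norm_id_le (by rwa [norm_star])).trans (le_of_eq ?_)
  rw [CFC.cfcAbs_cfcAbs]

theorem L1.val_injective (τ : NFSTrace N) : Function.Injective (L1.val (τ := τ)) :=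
  Subtype.val_injective

theorem L1.norm_val_le {τ : NFSTrace N} (x : L1 τ) : ‖x.val‖ ≤ ‖x‖ :=
  le_add_of_nonneg_right ENNReal.toReal_nonneg

theorem L1.trace_abs_le {τ : NFSTrace N} (x : L1 τ) : (τ.val (CFC.abs x.val)).toReal ≤ ‖x‖ :=
  le_add_of_nonneg_left (norm_nonneg _)

/-- An operator in the trace ideal as an element of `L1 τ`. -/
def L1.mk {τ : NFSTrace N} (x : H →L[ℂ] H) (hx : x ∈ traceIdeal τ) : L1 τ := ⟨x, hx⟩

@[simp]
theorem L1.val_mk {τ : NFSTrace N} (x : H →L[ℂ] H) (hx : x ∈ traceIdeal τ) :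
    (L1.mk x hx).val = x := rfl

/-- The inclusion `L¹_τ(N) → B(H)` is bounded. -/
def L1.valL (τ : NFSTrace N) : L1 τ →L[ℂ] (H →L[ℂ] H) :=
  L1.val.mkContinuous 1 fun x => by rw [one_mul]; exact x.norm_val_le

@[simp]
theorem L1.valL_apply {τ : NFSTrace N} (x : L1 τ) : L1.valL τ x = x.val := rfl

theorem norm_reExt_le {τ : NFSTrace N} {x : H →L[ℂ] H} (hs : IsSelfAdjoint x)
    (hx : x ∈ traceIdeal τ) : |τ.reExt x| ≤ (τ.val (CFC.abs x)).toReal := by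
  rw [← CFC.posPart_add_negPart x, val_add τ (posPart_mem hx.1) (negPart_mem hx.1),
    ENNReal.toReal_add (val_posPart_lt hs hx).ne (val_negPart_lt hs hx).ne, NFSTrace.reExt]
  rw [abs_le]
  constructor <;> linarith [ENNReal.toReal_nonneg (a := τ.val x⁺),
    ENNReal.toReal_nonneg (a := τ.val x⁻)]

theorem val_abs_realPart_le (τ : NFSTrace N) {x : H →L[ℂ] H} (hx : x ∈ N) :
    τ.val (CFC.abs (ℜ x : H →L[ℂ] H)) ≤ τ.val (CFC.abs x) := by
  have h2 : (‖((2⁻¹ : ℝ) : ℂ)‖₊ : ℝ≥0∞) = 2⁻¹ := by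
    rw [Complex.nnnorm_real]
    have : ‖(2⁻¹ : ℝ)‖₊ = 2⁻¹ := by ext; simp
    rw [this, ENNReal.coe_inv (by simp)]
    rfl
  rw [realPart_apply_coe, ← Complex.coe_smul,
    val_abs_smul τ _ (add_mem hx (star_mem hx)), h2]
  have h1 := (val_abs_add_le τ hx (star_mem hx)).trans
    (add_le_add le_rfl (val_abs_star_le τ hx))
  rw [← two_mul] at h1
  calc _ ≤ 2⁻¹ * (2 * τ.val (CFC.abs x)) := by gcongr
    _ = τ.val (CFC.abs x) := by
      rw [← mul_assoc, ENNReal.inv_mul_cancel (by simp) (by simp), one_mul]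

theorem norm_ext_le {τ : NFSTrace N} {x : H →L[ℂ] H} (hx : x ∈ traceIdeal τ) :
    ‖τ.ext x‖ ≤ 2 * (τ.val (CFC.abs x)).toReal := by
  have key : ∀ y ∈ traceIdeal τ, τ.val (CFC.abs y) ≤ τ.val (CFC.abs x) →
      |τ.reExt (ℜ y : H →L[ℂ] H)| ≤ (τ.val (CFC.abs x)).toReal := fun y hy hle =>
    (norm_reExt_le (ℜ y).2 (realPart_mem_traceIdeal hy)).trans
      (ENNReal.toReal_mono hx.2.ne ((val_abs_realPart_le τ hy.1).trans hle))
  have h1 := key x hx le_rfl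
  -- The imaginary part of `x` is the real part of `-i x`, so the same bound serves twice. The
  -- constant `2` of the conclusion comes from adding the two parts and is harmless, as only
  -- continuity is wanted.
  have hy : (-Complex.I) • x ∈ traceIdeal τ := (traceIdeal τ).smul_mem _ hx
  have h2 := key _ hy (le_of_eq (by rw [val_abs_smul τ _ hx.1]; simp))
  have h3 : (ℜ ((-Complex.I) • x) : H →L[ℂ] H) = ℑ x := by
    rw [neg_smul, map_neg, realPart_I_smul, neg_neg]
  rw [h3] at h2
  rw [ext_eq, two_mul]
  refine (norm_add_le _ _).trans (add_le_add ?_ ?_)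
  · rwa [Complex.norm_real]
  · rwa [norm_mul, Complex.norm_I, one_mul, Complex.norm_real]

/-- The trace as a bounded functional on `L¹_τ(N)`. -/
def L1.trace (τ : NFSTrace N) : L1 τ →L[ℂ] ℂ :=
  LinearMap.mkContinuous
    { toFun := fun x => τ.ext x.val
      map_add' := fun x y => by rw [map_add]; exact ext_add x.mem y.mem
      map_smul' := fun c x => by rw [map_smul]; exact ext_smul x.mem c } 2
    fun x => (norm_ext_le x.mem).trans (by gcongr; exact x.trace_abs_le)

theorem L1.trace_apply {τ : NFSTrace N} (x : L1 τ) : L1.trace τ x = τ.ext x.val := rfl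

/-- Every element of the trace ideal is a combination of four positive ones. -/
theorem exists_posCone_decomposition {τ : NFSTrace N} (x : L1 τ) :
    ∃ p : Fin 4 → L1 τ, (∀ i, 0 ≤ (p i).val) ∧
      x = (p 0 - p 1) + Complex.I • (p 2 - p 3) := by
  have hr := realPart_mem_traceIdeal x.mem
  have hi := imaginaryPart_mem_traceIdeal x.mem
  have hp : ∀ y : H →L[ℂ] H, IsSelfAdjoint y → y ∈ traceIdeal τ → y⁺ ∈ traceIdeal τ :=
    fun y hs hy => mem_traceIdeal_of_posCone (posPart_mem hy.1) (val_posPart_lt hs hy)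
  have hn : ∀ y : H →L[ℂ] H, IsSelfAdjoint y → y ∈ traceIdeal τ → y⁻ ∈ traceIdeal τ :=
    fun y hs hy => mem_traceIdeal_of_posCone (negPart_mem hy.1) (val_negPart_lt hs hy)
  refine ⟨![L1.mk _ (hp _ (ℜ x.val).2 hr), L1.mk _ (hn _ (ℜ x.val).2 hr),
    L1.mk _ (hp _ (ℑ x.val).2 hi), L1.mk _ (hn _ (ℑ x.val).2 hi)], ?_, ?_⟩
  · intro i
    fin_cases i
    · exact CFC.posPart_nonneg _
    · exact CFC.negPart_nonneg _
    · exact CFC.posPart_nonneg _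
    · exact CFC.negPart_nonneg _
  · apply L1.val_injective
    simp only [map_add, map_sub, map_smul, Matrix.cons_val, L1.val_mk]
    rw [CFC.posPart_sub_negPart _ (ℜ x.val).2, CFC.posPart_sub_negPart _ (ℑ x.val).2,
      realPart_add_I_smul_imaginaryPart]

/-- With `s = √p`, the trace property exchanges `(us)(us)*` for `(us)*(us) = s u*u s = p`. -/
theorem val_unitary_conj (τ : NFSTrace N) {u p : H →L[ℂ] H} (hu : u ∈ N) (hu1 : star u * u = 1)
    (hp : p ∈ posCone N) : τ.val (u * p * star u) = τ.val p := by
  set s := CFC.sqrt p with hs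
  have hsN : s ∈ N := sqrt_mem hp.1
  have hss : star s = s := (CFC.sqrt_nonneg p).isSelfAdjoint.star_eq
  have hsp : s * s = p := CFC.sqrt_mul_sqrt_self p hp.2
  have h1 : u * p * star u = (u * s) * star (u * s) := by
    rw [star_mul, hss, ← hsp]; noncomm_ring
  have h2 : star (u * s) * (u * s) = p := by
    rw [star_mul, mul_assoc, ← mul_assoc (star u), hu1, one_mul, hss, hsp]
  rw [h1, ← val_star_mul τ (mul_mem hu hsN), h2]

theorem ext_unitary_conj {τ : NFSTrace N} {u x : H →L[ℂ] H} (hu : u ∈ N) (hu1 : star u * u = 1)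
    (hx : x ∈ traceIdeal τ) : τ.ext (u * x * star u) = τ.ext x := by
  let c : L1 τ →ₗ[ℂ] L1 τ :=
    { toFun := fun y => L1.mk (u * y.val * star u) (mul_mem_traceIdeal τ hu y.mem (star_mem hu))
      map_add' := fun y z => L1.val_injective τ (by simp [mul_add, add_mul])
      map_smul' := fun a y => L1.val_injective τ (by simp) }
  suffices h : ∀ y, L1.trace τ (c y) = L1.trace τ y from h ⟨x, hx⟩
  have hpos : ∀ p : L1 τ, 0 ≤ p.val → L1.trace τ (c p) = L1.trace τ p := by
    intro p hp
    rw [L1.trace_apply, L1.trace_apply, ext_of_nonneg τ hp,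
      ext_of_nonneg τ (show 0 ≤ (c p).val from star_right_conjugate_nonneg hp u)]
    congr 2
    exact val_unitary_conj τ hu hu1 ⟨p.mem.1, hp⟩
  intro y
  obtain ⟨p, hp, rfl⟩ := exists_posCone_decomposition y
  simp only [map_add, map_sub, map_smul, hpos _ (hp _)]

theorem exists_sum_four_unitary {y : H →L[ℂ] H} (hy : y ∈ N) :
    ∃ (u : Fin 4 → H →L[ℂ] H) (c : Fin 4 → ℂ), y = ∑ i, c i • u i ∧
      ∀ i, u i ∈ N ∧ star (u i) * u i = 1 ∧ u i * star (u i) = 1 := by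
  have : IsClosed (N.toStarSubalgebra : Set (H →L[ℂ] H)) := isClosed_coe N
  obtain ⟨u, c, h, -⟩ :=
    CStarAlgebra.exists_sum_four_unitary (A := N.toStarSubalgebra) ⟨y, hy⟩
  refine ⟨fun i => ((u i : N.toStarSubalgebra) : H →L[ℂ] H), c, ?_, fun i => ⟨?_, ?_, ?_⟩⟩
  · simpa using congrArg (Subtype.val) h
  · exact (u i : N.toStarSubalgebra).2
  · exact congrArg Subtype.val (Unitary.star_mul_self_of_mem (u i).2)
  · exact congrArg Subtype.val (Unitary.mul_star_self_of_mem (u i).2)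

/-- The trace property on the trace ideal. -/
theorem ext_mul_comm {τ : NFSTrace N} {x y : H →L[ℂ] H} (hx : x ∈ traceIdeal τ) (hy : y ∈ N) :
    τ.ext (x * y) = τ.ext (y * x) := by
  have hr : ∀ z ∈ N, x * z ∈ traceIdeal τ := fun z hz => by
    simpa using mul_mem_traceIdeal τ (one_mem N) hx hz
  have hl : ∀ z ∈ N, z * x ∈ traceIdeal τ := fun z hz => by
    simpa using mul_mem_traceIdeal τ hz hx (one_mem N)
  -- For unitary `u`, conjugating `xu` by `u` gives `ux`, so unitary invariance is the trace
  -- property. The general case follows by linearity, `y` being a combination of four unitaries of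
  -- `N`.
  have hu : ∀ u ∈ N, star u * u = 1 → u * star u = 1 → τ.ext (x * u) = τ.ext (u * x) := by
    intro u hu h1 h2
    rw [← ext_unitary_conj hu h1 (hr u hu)]
    congr 1
    rw [mul_assoc, mul_assoc, h2, mul_one]
  obtain ⟨u, c, rfl, h⟩ := exists_sum_four_unitary hy
  have e1 : ∀ i, x * u i ∈ traceIdeal τ := fun i => hr _ (h i).1
  have e2 : ∀ i, u i * x ∈ traceIdeal τ := fun i => hl _ (h i).1
  have h1 : L1.trace τ (∑ i, c i • L1.mk _ (e1 i)) = L1.trace τ (∑ i, c i • L1.mk _ (e2 i)) := by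
    rw [map_sum, map_sum]
    refine Finset.sum_congr rfl fun i _ => ?_
    rw [map_smul, map_smul, L1.trace_apply, L1.trace_apply, L1.val_mk, L1.val_mk,
      hu _ (h i).1 (h i).2.1 (h i).2.2]
  rw [L1.trace_apply, L1.trace_apply] at h1
  simpa only [map_sum, map_smul, L1.val_mk, Finset.mul_sum, Finset.sum_mul, mul_smul_comm,
    smul_mul_assoc] using h1

end Bounds

/-! ### Lower semicontinuity of the trace and completeness of `L¹`. -/

section Completeness

variable {H : Type*} [NormedAddCommGroup H] [InnerProductSpace ℂ H] [CompleteSpace H]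
  {N : VonNeumannAlgebra H}

/-- A continuous cutoff function, vanishing for `t ≤ 1 / (m + 1)` and increasing in `m`. -/
def cutoff (m : ℕ) (t : ℝ) : ℝ := min 1 (max 0 ((m + 1) * t - 1))

theorem continuous_cutoff (m : ℕ) : Continuous (cutoff m) := by
  unfold cutoff; fun_prop

theorem cutoff_nonneg (m : ℕ) (t : ℝ) : 0 ≤ cutoff m t := le_min zero_le_one (le_max_left _ _)

theorem cutoff_le_one (m : ℕ) (t : ℝ) : cutoff m t ≤ 1 := min_le_left _ _

theorem cutoff_mono {t : ℝ} (ht : 0 ≤ t) : Monotone fun m => cutoff m t := by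
  intro m k h
  have : (m : ℝ) ≤ k := by exact_mod_cast h
  unfold cutoff
  dsimp only
  gcongr

/-- The cutoff vanishes where `(m + 1) t ≤ 1`. Applied to an operator `a`, the inequality bounds
`f(a)²` by a multiple of the truncation of `a`. -/
theorem cutoff_le_mul (t : ℝ) (m : ℕ) :
    cutoff m t * cutoff m t ≤ (m + 1) * (cutoff m t * cutoff m t * t) := by
  rcases le_total ((m + 1) * t) 1 with h | h
  · have : cutoff m t = 0 := by
      unfold cutoff
      rw [max_eq_left (by linarith), min_eq_right zero_le_one]
    simp [this]
  · nlinarith [mul_self_nonneg (cutoff m t)]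

theorem abs_cutoff_sub_le {t : ℝ} (ht : 0 ≤ t) (m : ℕ) :
    |cutoff m t * cutoff m t * t - t| ≤ 2 / (m + 1) := by
  have hm : (0 : ℝ) < m + 1 := by positivity
  have h0 := cutoff_nonneg m t
  have h1 := cutoff_le_one m t
  have h2 : cutoff m t * cutoff m t ≤ 1 := by nlinarith
  rw [abs_le]
  rcases le_total ((m + 1) * t) 2 with h | h
  · have h3 : t ≤ 2 / (m + 1) := by rw [le_div_iff₀ hm]; linarith
    constructor
    · nlinarith [mul_nonneg (mul_nonneg h0 h0) ht]
    · nlinarith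
  · have : cutoff m t = 1 := by
      unfold cutoff
      rw [max_eq_right (by linarith), min_eq_left (by linarith)]
    rw [this]
    have : (0 : ℝ) ≤ 2 / (m + 1) := by positivity
    constructor <;> simp <;> linarith

/-- The spectral truncation `f(a)² a` of `a` by the cutoff function `f`. -/
def truncation (a : H →L[ℂ] H) (m : ℕ) : H →L[ℂ] H :=
  cfc (fun t : ℝ => cutoff m t * cutoff m t * t) a

theorem truncation_eq {a : H →L[ℂ] H} (ha : 0 ≤ a) (m : ℕ) :
    truncation a m = cfc (cutoff m) a * a * cfc (cutoff m) a := by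
  have hc := (continuous_cutoff m).continuousOn (s := spectrum ℝ a)
  have h : truncation a m = cfc (fun t : ℝ => cutoff m t * t * cutoff m t) a := by
    unfold truncation
    congr 1
    ext t
    ring
  rw [h, cfc_mul (fun t => cutoff m t * t) (cutoff m) a (hc.mul continuousOn_id) hc,
    cfc_mul (cutoff m) (fun t => t) a hc continuousOn_id, cfc_id' ℝ a]

theorem truncation_mem {a : H →L[ℂ] H} (ha : a ∈ posCone N) (m : ℕ) :
    truncation a m ∈ posCone N :=
  ⟨cfc_mem ha.1 _, cfc_nonneg fun _ ht => mul_nonneg (mul_self_nonneg _)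
    (spectrum_nonneg_of_nonneg ha.2 ht)⟩

theorem truncation_mono {a : H →L[ℂ] H} (ha : 0 ≤ a) : Monotone (truncation a) := by
  intro m k h
  refine cfc_mono (fun t ht => ?_)
    (((continuous_cutoff m).mul (continuous_cutoff m)).mul continuous_id).continuousOn
    (((continuous_cutoff k).mul (continuous_cutoff k)).mul continuous_id).continuousOn
  have ht0 : 0 ≤ t := spectrum_nonneg_of_nonneg ha ht
  have := cutoff_mono ht0 h
  have h0 := cutoff_nonneg m t
  have h1 := cutoff_nonneg k t
  dsimp only at this
  gcongr

theorem tendsto_truncation {a : H →L[ℂ] H} (ha : 0 ≤ a) :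
    Filter.Tendsto (truncation a) Filter.atTop (nhds a) := by
  rw [tendsto_iff_norm_sub_tendsto_zero]
  refine squeeze_zero (fun _ => norm_nonneg _) (fun m => ?_)
    (g := fun m : ℕ => 2 / ((m : ℝ) + 1)) ?_
  · have h : truncation a m - a = cfc (fun t : ℝ => cutoff m t * cutoff m t * t - t) a := by
      rw [cfc_sub (fun t : ℝ => cutoff m t * cutoff m t * t) (fun t => t) a
        (((continuous_cutoff m).mul (continuous_cutoff m)).mul continuous_id).continuousOn
        continuousOn_id, cfc_id' ℝ a]
      rfl
    rw [h]
    exact norm_cfc_le (by positivity) fun t ht =>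
      abs_cutoff_sub_le (spectrum_nonneg_of_nonneg ha ht) m
  · have := tendsto_one_div_add_atTop_nhds_zero_nat (𝕜 := ℝ) |>.const_mul 2
    simpa [div_eq_mul_inv] using this

/-- The truncations increase and converge to `a` in norm, so `a` is their least upper bound and
normality applies. -/
theorem val_eq_iSup_truncation (τ : NFSTrace N) {a : H →L[ℂ] H} (ha : a ∈ posCone N) :
    τ.val a = ⨆ m, τ.val (truncation a m) := by
  let d : ℕ → posCone N := fun m => ⟨truncation a m, truncation_mem ha m⟩
  have hd : Monotone d := fun m k h => truncation_mono ha.2 h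
  have hlub : IsLUB (Set.range d) ⟨a, ha⟩ := by
    refine ⟨?_, fun y hy => ?_⟩
    · rintro _ ⟨m, rfl⟩
      exact (truncation_mono ha.2).ge_of_tendsto (tendsto_truncation ha.2) m
    · exact show a ≤ (y : H →L[ℂ] H) from le_of_tendsto' (tendsto_truncation ha.2)
        fun m => (show d m ≤ y from hy ⟨m, rfl⟩)
  have h := τ.normal (Set.range d) ⟨a, ha⟩ (Set.range_nonempty d)
    hd.directed_le.directedOn_range hlub
  rw [val_of_mem τ ha, h, iSup_range]
  refine iSup_congr fun m => ?_
  rw [val_of_mem τ (truncation_mem ha m)]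

/-- Lower semicontinuity of the trace for the operator norm. -/
theorem val_le_of_tendsto {τ : NFSTrace N} {ι : Type*} {l : Filter ι} [l.NeBot]
    {u : ι → H →L[ℂ] H} {a : H →L[ℂ] H} {C : ℝ≥0∞} (hu : ∀ k, u k ∈ posCone N)
    (ha : Filter.Tendsto u l (nhds a)) (hC : ∀ᶠ k in l, τ.val (u k) ≤ C) : τ.val a ≤ C := by
  have haN : a ∈ posCone N :=
    ⟨(isClosed_coe N).mem_of_tendsto ha (Filter.Eventually.of_forall fun k => (hu k).1),
      ge_of_tendsto' ha fun k => (hu k).2⟩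
  rw [val_eq_iSup_truncation τ haN]
  refine iSup_le fun m => ENNReal.le_of_forall_lt_one_mul_le fun r hr => ?_
  lift r to ℝ≥0 using (hr.trans ENNReal.one_lt_top).ne
  have hr1 : (r : ℝ) < 1 := by exact_mod_cast hr
  have hm : (0 : ℝ) < m + 1 := by positivity
  -- Let `b = f(a)` for the cutoff `f`. If `‖a - u k‖ ≤ ε`, then `b (a - u k) b ≤ ε b² ≤ ε (m + 1)
  -- f(a)² a`. This choice of `ε` makes the right side `(1 - r) f(a)² a`, leaving `r f(a)² a ≤ b (u
  -- k) b`, whose trace is at most `C` because `b` is a contraction.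
  have hε : 0 < (1 - (r : ℝ)) / (m + 1) := div_pos (by linarith) hm
  obtain ⟨k, hk1, hk2⟩ := (hC.and (Metric.tendsto_nhds.1 ha _ hε)).exists
  set b := cfc (cutoff m) a with hb
  have hbN : b ∈ N := cfc_mem haN.1 _
  have hbs : star b = b := (cfc_predicate (cutoff m) a : IsSelfAdjoint b).star_eq
  have hb1 : ‖b‖ ≤ 1 := norm_cfc_le zero_le_one fun t _ => by
    rw [Real.norm_of_nonneg (cutoff_nonneg m t)]; exact cutoff_le_one m t
  have hle1 : a - u k ≤ algebraMap ℝ (H →L[ℂ] H) ((1 - (r : ℝ)) / (m + 1)) := by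
    refine (IsSelfAdjoint.le_algebraMap_norm_self
      (haN.2.isSelfAdjoint.sub (hu k).2.isSelfAdjoint)).trans ?_
    refine algebraMap_mono _ ?_
    rw [← dist_eq_norm, dist_comm]
    exact hk2.le
  have hle2 := star_right_conjugate_le_conjugate hle1 b
  have hbb : b * b ≤ ((m : ℝ) + 1) • truncation a m := by
    have hc := (continuous_cutoff m).continuousOn (s := spectrum ℝ a)
    have hc2 := (((continuous_cutoff m).mul (continuous_cutoff m)).mul
      continuous_id).continuousOn (s := spectrum ℝ a)
    rw [hb, ← cfc_mul (cutoff m) (cutoff m) a hc hc, truncation,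
      ← cfc_smul ((m : ℝ) + 1) (fun t => cutoff m t * cutoff m t * t) a hc2]
    exact cfc_mono (fun t _ => cutoff_le_mul t m)
      (hc.mul hc) (hc2.const_smul ((m : ℝ) + 1))
  have hfin : r • truncation a m ≤ b * u k * star b := by
    have h1 : b * (a - u k) * star b = truncation a m - b * u k * star b := by
      rw [truncation_eq haN.2, hbs]; noncomm_ring
    have h2 : b * algebraMap ℝ (H →L[ℂ] H) ((1 - (r : ℝ)) / (m + 1)) * star b =
        ((1 - (r : ℝ)) / (m + 1)) • (b * b) := by
      rw [hbs, Algebra.algebraMap_eq_smul_one, mul_smul_comm, mul_one, smul_mul_assoc]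
    rw [h1, h2] at hle2
    have h3 := hle2.trans (smul_le_smul_of_nonneg_left hbb hε.le)
    rw [smul_smul, div_mul_cancel₀ _ hm.ne', sub_smul, one_smul, sub_le_sub_iff_left] at h3
    exact h3
  rw [← val_smul τ r (truncation_mem haN m)]
  refine (val_mono τ ((posCone N).smul_mem r (truncation_mem haN m)) (conj_mem hbN (hu k))
    hfin).trans ((val_conj_le τ hbN (hu k)).trans ?_)
  have h5 : ((‖b‖₊ ^ 2 : ℝ≥0) : ℝ≥0∞) ≤ 1 := by exact_mod_cast pow_le_one' (show ‖b‖₊ ≤ 1 from hb1) 2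
  calc _ ≤ 1 * C := by gcongr
    _ = C := one_mul C

theorem val_abs_le_of_tendsto {τ : NFSTrace N} {ι : Type*} {l : Filter ι} [l.NeBot]
    {u : ι → H →L[ℂ] H} {a : H →L[ℂ] H} {C : ℝ≥0∞} (hu : ∀ k, u k ∈ N)
    (ha : Filter.Tendsto u l (nhds a)) (hC : ∀ᶠ k in l, τ.val (CFC.abs (u k)) ≤ C) :
    τ.val (CFC.abs a) ≤ C :=
  val_le_of_tendsto (fun k => abs_mem_posCone (hu k)) ((CFC.continuous_abs.tendsto a).comp ha) hC

/-- A Cauchy sequence has a limit `a` in operator norm. Lower semicontinuity, applied to the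
differences `u k - u j` as `k` grows, bounds `τ|a - u j|`, which puts `a` in the ideal and gives
convergence for the trace part of the norm. -/
instance (τ : NFSTrace N) : CompleteSpace (L1 τ) := by
  refine Metric.complete_of_cauchySeq_tendsto fun u hu => ?_
  obtain ⟨a, ha⟩ := cauchySeq_tendsto_of_complete 
    ((L1.valL τ).uniformContinuous.comp_cauchySeq hu)
  have haN : a ∈ N :=
    (isClosed_coe N).mem_of_tendsto ha (Filter.Eventually.of_forall fun k => (u k).mem.1)
  have key : ∀ ε > 0, ∃ K, ∀ j ≥ K, τ.val (CFC.abs (a - (u j).val)) ≤ ENNReal.ofReal ε := by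
    intro ε hε
    obtain ⟨K, hK⟩ := Metric.cauchySeq_iff.1 hu ε hε
    refine ⟨K, fun j hj => val_abs_le_of_tendsto (fun k => sub_mem (u k).mem.1 (u j).mem.1)
      (ha.sub_const _) ?_⟩
    filter_upwards [Filter.eventually_ge_atTop K] with k hk
    have h1 := hK k hk j hj
    rw [dist_eq_norm] at h1
    rw [← map_sub, ENNReal.le_ofReal_iff_toReal_le (u k - u j).mem.2.ne hε.le]
    exact ((u k - u j).trace_abs_le).trans h1.le
  have haI : a ∈ traceIdeal τ := by
    obtain ⟨K, hK⟩ := key 1 one_pos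
    have h1 : a - (u K).val ∈ traceIdeal τ :=
      ⟨sub_mem haN (u K).mem.1, (hK K le_rfl).trans_lt ENNReal.ofReal_lt_top⟩
    simpa using add_mem h1 (u K).mem
  refine ⟨L1.mk a haI, ?_⟩
  rw [tendsto_iff_norm_sub_tendsto_zero, Metric.tendsto_atTop]
  intro ε hε
  obtain ⟨K, hK⟩ := key (ε / 2) (half_pos hε)
  obtain ⟨K', hK'⟩ := Metric.tendsto_atTop.1 ha (ε / 2) (half_pos hε)
  refine ⟨max K K', fun j hj => ?_⟩
  have h1 := hK j (le_of_max_le_left hj)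
  have h2 := hK' j (le_of_max_le_right hj)
  rw [dist_zero_right, norm_norm, ← neg_sub, norm_neg, L1.norm_def]
  have h3 := ENNReal.toReal_le_of_le_ofReal (half_pos hε).le h1
  rw [dist_eq_norm, ← neg_sub, norm_neg] at h2
  calc ‖a - (u j).val‖ + (τ.val (CFC.abs (a - (u j).val))).toReal < ε / 2 + ε / 2 :=
        add_lt_add_of_lt_of_le h2 h3
    _ = ε := add_halves ε

end Completeness

/-! ## Ideals with a trace in Banach algebras -/

/-- A two-sided ideal `J` of a Banach algebra `A`, normed in its own right, with a bounded trace. -/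
structure TracedIdeal (A J : Type*) [NormedRing A] [NormedAlgebra ℝ A]
    [NormedAddCommGroup J] [NormedSpace ℝ J] where
  /-- the inclusion -/
  incl : J →L[ℝ] A
  incl_injective : Function.Injective incl
  /-- right multiplication by elements of the algebra -/
  mulR : J →L[ℝ] A →L[ℝ] J
  /-- left multiplication by elements of the algebra -/
  mulL : A →L[ℝ] J →L[ℝ] J
  incl_mulR : ∀ x a, incl (mulR x a) = incl x * a
  incl_mulL : ∀ a x, incl (mulL a x) = a * incl x
  /-- the trace -/
  trace : J →L[ℝ] ℂ
  trace_comm : ∀ x a, trace (mulR x a) = trace (mulL a x)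

namespace TracedIdeal

variable {A J : Type*} [NormedRing A] [NormedAlgebra ℝ A] [NormedAddCommGroup J]
  [NormedSpace ℝ J] (I : TracedIdeal A J)

/-- The invertible element `1 + x` as a function of `x`. -/
def oneAdd (x : J) : A := 1 + I.incl x

/-- A `C¹` path `t ↦ 1 + x t` of invertible elements. -/
structure IsPath (x : ℝ → J) : Prop where
  contDiffOn : ContDiffOn ℝ 1 x (Set.Icc 0 1)
  isUnit : ∀ t ∈ Set.Icc (0 : ℝ) 1, IsUnit (I.oneAdd (x t))

/-- The logarithmic derivative `T (x' (1 + x)⁻¹)`. -/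
def logDeriv (x : ℝ → J) (t : ℝ) : ℂ :=
  I.trace (I.mulR (derivWithin x (Set.Icc 0 1) t) (Ring.inverse (I.oneAdd (x t))))

/-- The integral of the logarithmic derivative along a path. -/
def logIntegral (x : ℝ → J) : ℂ := ∫ t in (0 : ℝ)..1, I.logDeriv x t

/-- The element with `1 + (x ∘ y) = (1 + x) (1 + y)`. -/
def circ (x y : J) : J := I.mulR x (I.oneAdd y) + y

theorem oneAdd_circ (x y : J) : I.oneAdd (I.circ x y) = I.oneAdd x * I.oneAdd y := by
  simp only [oneAdd, circ, map_add, incl_mulR]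
  noncomm_ring

theorem mulR_mulR (x : J) (a b : A) : I.mulR (I.mulR x a) b = I.mulR x (a * b) :=
  I.incl_injective (by simp only [incl_mulR, mul_assoc])

theorem mulL_mulR (x : J) (a b : A) : I.mulL a (I.mulR x b) = I.mulR (I.mulL a x) b :=
  I.incl_injective (by simp only [incl_mulL, incl_mulR, mul_assoc])

theorem mulR_one (x : J) : I.mulR x 1 = x := I.incl_injective (by simp [incl_mulR])

theorem trace_conj (x : J) {a b : A} (h : b * a = 1) :
    I.trace (I.mulL a (I.mulR x b)) = I.trace x := by
  rw [← I.trace_comm, mulR_mulR, h, mulR_one]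

theorem contDiff_oneAdd {n : WithTop ℕ∞} : ContDiff ℝ n I.oneAdd :=
  contDiff_const.add I.incl.contDiff

theorem derivWithin_eq {x : ℝ → J} {x' : J} {t : ℝ} (ht : t ∈ Set.Icc (0 : ℝ) 1)
    (h : HasDerivWithinAt x x' (Set.Icc 0 1) t) : derivWithin x (Set.Icc 0 1) t = x' :=
  h.derivWithin (uniqueDiffOn_Icc zero_lt_one t ht)

theorem logIntegral_congr_deriv {x y : ℝ → J}
    (h : ∀ t ∈ Set.Icc (0 : ℝ) 1, I.logDeriv x t = I.logDeriv y t) :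
    I.logIntegral x = I.logIntegral y := by
  refine intervalIntegral.integral_congr fun t ht => h t ?_
  rwa [Set.uIcc_of_le zero_le_one] at ht

variable {I}

theorem IsPath.hasDerivWithinAt {x : ℝ → J} (hx : I.IsPath x) {t : ℝ}
    (ht : t ∈ Set.Icc (0 : ℝ) 1) :
    HasDerivWithinAt x (derivWithin x (Set.Icc 0 1) t) (Set.Icc 0 1) t :=
  ((hx.contDiffOn.differentiableOn one_ne_zero) t ht).hasDerivWithinAt

theorem IsPath.continuousOn_derivWithin {x : ℝ → J} (hx : I.IsPath x) :
    ContinuousOn (derivWithin x (Set.Icc 0 1)) (Set.Icc 0 1) :=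
  hx.contDiffOn.continuousOn_derivWithin (uniqueDiffOn_Icc zero_lt_one) le_rfl

theorem contDiffOn_circ {n : WithTop ℕ∞} {x y : ℝ → J} (hx : ContDiffOn ℝ n x (Set.Icc 0 1))
    (hy : ContDiffOn ℝ n y (Set.Icc 0 1)) :
    ContDiffOn ℝ n (fun t => I.circ (x t) (y t)) (Set.Icc 0 1) :=
  ((I.mulR.contDiff.comp_contDiffOn hx).clm_apply (I.contDiff_oneAdd.comp_contDiffOn hy)).add hy

theorem IsPath.circ {x y : ℝ → J} (hx : I.IsPath x) (hy : I.IsPath y) :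
    I.IsPath fun t => I.circ (x t) (y t) where
  contDiffOn := contDiffOn_circ hx.contDiffOn hy.contDiffOn
  isUnit t ht := by rw [oneAdd_circ]; exact (hx.isUnit t ht).mul (hy.isUnit t ht)

/-- The logarithmic derivative is itself conjugated by `k`, which the trace does not see. It matters
that `k` is any invertible element of `A`, not only one of `1 + J`: this is what later kills the
mixed commutators. -/
theorem logIntegral_conj {x : ℝ → J} (hx : I.IsPath x) (k : Aˣ) :
    I.logIntegral (fun t => I.mulL k (I.mulR (x t) (k⁻¹ : Aˣ))) = I.logIntegral x := by
  refine I.logIntegral_congr_deriv fun t ht => ?_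
  have hdx := hx.hasDerivWithinAt ht
  have h1 : HasDerivWithinAt (fun t => I.mulL k (I.mulR (x t) (k⁻¹ : Aˣ)))
      (I.mulL k (I.mulR (derivWithin x (Set.Icc 0 1) t) (k⁻¹ : Aˣ))) (Set.Icc 0 1) t :=
    (I.mulL k ∘L I.mulR.flip ((k⁻¹ : Aˣ) : A)).hasFDerivAt.comp_hasDerivWithinAt t hdx
  obtain ⟨g, hg⟩ := hx.isUnit t ht
  have h2 : I.oneAdd (I.mulL k (I.mulR (x t) (k⁻¹ : Aˣ))) = (k * g * k⁻¹ : Aˣ) := by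
    rw [Units.val_mul, Units.val_mul, hg, oneAdd, oneAdd, incl_mulL, incl_mulR, mul_add,
      add_mul, mul_one, Units.mul_inv, mul_assoc]
  rw [logDeriv, derivWithin_eq ht h1, logDeriv, h2, ← hg, Ring.inverse_unit, Ring.inverse_unit,
    mul_inv_rev, mul_inv_rev, inv_inv, Units.val_mul, Units.val_mul, ← mulL_mulR, mulR_mulR,
    ← mul_assoc, ← mul_assoc, Units.inv_mul, one_mul, ← mulR_mulR, trace_conj _ _ (Units.inv_mul k)]

/-- The product rule reads `(gh)'(gh)⁻¹ = g'g⁻¹ + g (h'h⁻¹) g⁻¹`, and the trace ignores the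
conjugation by `g`. -/
theorem logDeriv_circ {x y : ℝ → J} (hx : I.IsPath x) (hy : I.IsPath y) {t : ℝ}
    (ht : t ∈ Set.Icc (0 : ℝ) 1) :
    I.logDeriv (fun t => I.circ (x t) (y t)) t = I.logDeriv x t + I.logDeriv y t := by
  set x' := derivWithin x (Set.Icc 0 1) t with hx'
  set y' := derivWithin y (Set.Icc 0 1) t with hy'
  have hdx := hx.hasDerivWithinAt ht
  have hdy := hy.hasDerivWithinAt ht
  have h1 : HasDerivWithinAt (fun t => I.oneAdd (y t)) (I.incl y') (Set.Icc 0 1) t :=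
    (I.incl.hasFDerivAt.comp_hasDerivWithinAt t hdy).const_add 1
  have h2 : HasDerivWithinAt (fun t => I.circ (x t) (y t))
      (I.mulR x' (I.oneAdd (y t)) + I.mulR (x t) (I.incl y') + y') (Set.Icc 0 1) t :=
    ((I.mulR.hasFDerivAt.comp_hasDerivWithinAt t hdx).clm_apply h1).add hdy
  obtain ⟨g, hg⟩ := hx.isUnit t ht
  obtain ⟨h, hh⟩ := hy.isUnit t ht
  have h3 : I.mulR (x t) (I.incl y') + y' = I.mulL (I.oneAdd (x t)) y' := by
    apply I.incl_injective
    rw [map_add, incl_mulR, incl_mulL, oneAdd, add_mul, one_mul, add_comm]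
  rw [logDeriv, derivWithin_eq ht h2, oneAdd_circ, logDeriv, logDeriv, ← hx', ← hy',
    add_assoc, h3, ← hg, ← hh, ← Units.val_mul, Ring.inverse_unit, Ring.inverse_unit,
    Ring.inverse_unit, map_add, add_apply, map_add, mulR_mulR, mul_inv_rev, Units.val_mul,
    ← mul_assoc, Units.mul_inv, one_mul, ← mulR_mulR, ← mulL_mulR, ← mulL_mulR,
    I.trace_conj _ (Units.inv_mul g)]

section Complete

variable [CompleteSpace A]

theorem IsPath.continuousOn_inverse {x : ℝ → J} (hx : I.IsPath x) :
    ContinuousOn (fun t => Ring.inverse (I.oneAdd (x t))) (Set.Icc 0 1) := by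
  intro t ht
  obtain ⟨u, hu⟩ := hx.isUnit t ht
  have h1 : ContinuousAt Ring.inverse (I.oneAdd (x t)) := by
    rw [← hu]; exact NormedRing.inverse_continuousAt u
  exact ContinuousAt.comp_continuousWithinAt (f := fun t => I.oneAdd (x t)) h1
    ((I.contDiff_oneAdd (n := 0)).continuous.comp_continuousOn hx.contDiffOn.continuousOn t ht)

theorem IsPath.continuousOn_mulR {x : ℝ → J} (hx : I.IsPath x) :
    ContinuousOn (fun t => I.mulR (derivWithin x (Set.Icc 0 1) t)
      (Ring.inverse (I.oneAdd (x t)))) (Set.Icc 0 1) :=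
  (I.mulR.continuous.comp_continuousOn hx.continuousOn_derivWithin).clm_apply
    hx.continuousOn_inverse

theorem IsPath.continuousOn_logDeriv {x : ℝ → J} (hx : I.IsPath x) :
    ContinuousOn (I.logDeriv x) (Set.Icc 0 1) :=
  I.trace.continuous.comp_continuousOn hx.continuousOn_mulR

theorem IsPath.intervalIntegrable_logDeriv {x : ℝ → J} (hx : I.IsPath x) :
    IntervalIntegrable (I.logDeriv x) MeasureTheory.volume 0 1 := by
  apply ContinuousOn.intervalIntegrable
  rw [Set.uIcc_of_le zero_le_one]
  exact hx.continuousOn_logDeriv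

theorem logIntegral_circ {x y : ℝ → J} (hx : I.IsPath x) (hy : I.IsPath y) :
    I.logIntegral (fun t => I.circ (x t) (y t)) = I.logIntegral x + I.logIntegral y := by
  rw [logIntegral, logIntegral, logIntegral, ← intervalIntegral.integral_add
    hx.intervalIntegrable_logDeriv hy.intervalIntegrable_logDeriv]
  refine intervalIntegral.integral_congr fun t ht => ?_
  rw [Set.uIcc_of_le zero_le_one] at ht
  exact logDeriv_circ hx hy ht

/-- The logarithmic derivative as a `1`-form. -/
theorem exists_primitive {P : Set A} (hP : Convex ℝ P) (hu : ∀ a ∈ P, IsUnit a) :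
    ∃ F : J → ℂ, ∀ x : ℝ → J, I.IsPath x → (∀ t ∈ Set.Icc (0 : ℝ) 1, I.oneAdd (x t) ∈ P) →
      I.logIntegral x = F (x 1) - F (x 0) := by
  let s : Set J := {x | I.oneAdd x ∈ P}
  have hs : Convex ℝ s := by
    intro x hx y hy a b ha hb hab
    show I.oneAdd (a • x + b • y) ∈ P
    have : I.oneAdd (a • x + b • y) = a • I.oneAdd x + b • I.oneAdd y := by
      simp only [oneAdd, map_add, map_smul, smul_add]
      rw [add_add_add_comm, ← add_smul, hab, one_smul]
    rw [this]
    exact hP hx hy ha hb hab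
  let Φ : A →L[ℝ] J →L[ℝ] ℂ := (ContinuousLinearMap.compL ℝ J J ℂ I.trace) ∘L I.mulR.flip
  have hΦ : ∀ a v, Φ a v = I.trace (I.mulR v a) := fun _ _ => rfl
  let form : J → J →L[ℝ] ℂ := fun x => Φ (Ring.inverse (I.oneAdd x))
  let dform : J → J →L[ℝ] J →L[ℝ] ℂ := fun x =>
    Φ ∘L (-(ContinuousLinearMap.mulLeftRight ℝ A (Ring.inverse (I.oneAdd x))
      (Ring.inverse (I.oneAdd x)))) ∘L I.incl
  have hform : ∀ x ∈ s, HasFDerivWithinAt form (dform x) s x := by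
    intro x hx
    obtain ⟨g, hg⟩ := hu _ hx
    have h1 : HasFDerivAt Ring.inverse (-(ContinuousLinearMap.mulLeftRight ℝ A
        (Ring.inverse (I.oneAdd x)) (Ring.inverse (I.oneAdd x)))) (I.oneAdd x) := by
      rw [← hg, Ring.inverse_unit]
      exact hasFDerivAt_ringInverse g
    have h2 : HasFDerivAt I.oneAdd I.incl x := I.incl.hasFDerivAt.const_add 1
    exact (Φ.hasFDerivAt.comp x (h1.comp x h2)).hasFDerivWithinAt
  -- The form is closed: with `a = (1 + x)⁻¹` its derivative is `(u, v) ↦ -T(v a u a)`, which is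
  -- symmetric by the trace property. On the convex set `s` the Poincaré lemma then yields a
  -- primitive.
  have hsymm : ∀ x u v, dform x u v = dform x v u := by
    intro x
    set a := Ring.inverse (I.oneAdd x) with ha
    have h1 : ∀ u v, dform x u v = -I.trace (I.mulR (I.mulR v a) (I.incl (I.mulR u a))) := by
      intro u v
      have : dform x u v = I.trace (I.mulR v (-(a * I.incl u * a))) := rfl
      rw [this, map_neg, map_neg, mulR_mulR, incl_mulR, mul_assoc]
    intro u v
    rw [h1, h1, I.trace_comm]
    congr 2
    apply I.incl_injective
    simp only [incl_mulL, incl_mulR, mul_assoc]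
  obtain ⟨F, hF⟩ := hs.exists_forall_hasFDerivWithinAt_of_hasFDerivWithinAt_symmetric hform
    fun a _ u _ v _ => hsymm a u v
  refine ⟨F, fun x hx hxP => ?_⟩
  have hd : ∀ t ∈ Set.Icc (0 : ℝ) 1,
      HasDerivWithinAt (F ∘ x) (I.logDeriv x t) (Set.Icc 0 1) t := fun t ht =>
    (hF (x t) (hxP t ht)).comp_hasDerivWithinAt t (hx.hasDerivWithinAt ht) fun r hr => hxP r hr
  refine intervalIntegral.integral_eq_sub_of_hasDerivAt_of_le zero_le_one
    (f := F ∘ x) (fun t ht => (hd t ht).continuousWithinAt) (fun t ht => ?_)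
    hx.intervalIntegrable_logDeriv
  exact (hd t (Set.Ioo_subset_Icc_self ht)).hasDerivAt (Icc_mem_nhds ht.1 ht.2)

/-- The real part of the integral of the logarithmic derivative depends on the end points only. -/
theorem re_logIntegral_eq [StarRing A] (S : J →L[ℝ] J) (hS : ∀ x, I.incl (S x) = star (I.incl x))
    (hT : ∀ x, I.trace (S x) = star (I.trace x)) {P : Set A} (hP : Convex ℝ P)
    (hu : ∀ a ∈ P, IsUnit a) (hstar : ∀ a, IsUnit a → star a * a ∈ P)
    {x y : ℝ → J} (hx : I.IsPath x) (hy : I.IsPath y) (hx0 : x 0 = 0) (hy0 : y 0 = 0)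
    (h1 : star (I.oneAdd (x 1)) * I.oneAdd (x 1) = star (I.oneAdd (y 1)) * I.oneAdd (y 1)) :
    (I.logIntegral x).re = (I.logIntegral y).re := by
  obtain ⟨F, hF⟩ := I.exists_primitive hP hu
  have hS1 : ∀ x, I.oneAdd (S x) = star (I.oneAdd x) := fun x => by
    rw [oneAdd, oneAdd, hS, star_add, star_one]
  have hSp : ∀ {x : ℝ → J}, I.IsPath x → I.IsPath fun t => S (x t) := fun {x} hx =>
    { contDiffOn := S.contDiff.comp_contDiffOn hx.contDiffOn
      isUnit := fun t ht => by rw [hS1]; exact (hx.isUnit t ht).star }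
  -- For the adjoint path, `T((σ*)' (σ*)⁻¹) = T((σ*)⁻¹ (σ')*)` is the conjugate of `T(σ' σ⁻¹)`. The
  -- trace property restores the order of the factors.
  have hSd : ∀ {x : ℝ → J}, I.IsPath x → I.logIntegral (fun t => S (x t)) =
      star (I.logIntegral x) := by
    intro x hx
    have e : ∀ f : ℝ → ℂ, star (∫ t in (0 : ℝ)..1, f t) = ∫ t in (0 : ℝ)..1, star (f t) := by
      intro f
      rw [intervalIntegral.integral_of_le zero_le_one, intervalIntegral.integral_of_le zero_le_one]
      exact integral_conj.symm
    rw [logIntegral, logIntegral, e]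
    refine intervalIntegral.integral_congr fun t ht => ?_
    rw [Set.uIcc_of_le zero_le_one] at ht
    obtain ⟨g, hg⟩ := hx.isUnit t ht
    have hd : HasDerivWithinAt (fun t => S (x t)) (S (derivWithin x (Set.Icc 0 1) t))
        (Set.Icc 0 1) t := S.hasFDerivAt.comp_hasDerivWithinAt t (hx.hasDerivWithinAt ht)
    rw [logDeriv, derivWithin_eq ht hd, logDeriv, hS1, ← hg, ← Units.coe_star,
      Ring.inverse_unit, Ring.inverse_unit, I.trace_comm (derivWithin _ _ _), ← hT]
    congr 1
    apply I.incl_injective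
    rw [hS, incl_mulR, incl_mulL, hS, star_mul, ← Units.coe_star, star_inv]
  -- The path `σ*σ` stays in `P`, where the primitive is available, and its integral is the
  -- conjugate of that of `σ` plus that of `σ`.
  have key : ∀ {x : ℝ → J}, I.IsPath x → ((2 * (I.logIntegral x).re : ℝ) : ℂ) =
      F (I.circ (S (x 1)) (x 1)) - F (I.circ (S (x 0)) (x 0)) := by
    intro x hx
    rw [← hF _ ((hSp hx).circ hx) fun t ht => by
      rw [oneAdd_circ, hS1]; exact hstar _ (hx.isUnit t ht), logIntegral_circ (hSp hx) hx, hSd hx]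
    rw [add_comm]
    exact (Complex.add_conj _).symm
  have h2 : I.circ (S (x 1)) (x 1) = I.circ (S (y 1)) (y 1) := by
    apply I.incl_injective
    apply add_left_cancel (a := (1 : A))
    show I.oneAdd _ = I.oneAdd _
    rw [oneAdd_circ, oneAdd_circ, hS1, hS1, h1]
  have h3 := key hx
  rw [h2, hx0, ← hy0, ← key hy] at h3
  have h4 : 2 * (I.logIntegral x).re = 2 * (I.logIntegral y).re := by exact_mod_cast h3
  linarith

end Complete

end TracedIdeal

/-! ## The ideal of matrices over the trace ideal -/

section MatrixIdeal

variable {H : Type*} [NormedAddCommGroup H] [InnerProductSpace ℂ H] [CompleteSpace H]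
  {N : VonNeumannAlgebra H}

/-- Real scalars suffice, as paths are differentiated in a real variable. Over them the adjoint is
linear. -/
instance : Module ℝ N where
  smul c x := ⟨c • (x : H →L[ℂ] H), by
    rw [← Complex.coe_smul]; exact smul_mem_coe _ x.2⟩
  one_smul x := Subtype.ext (one_smul ℝ (x : H →L[ℂ] H))
  mul_smul a b x := Subtype.ext (mul_smul a b (x : H →L[ℂ] H))
  smul_zero a := Subtype.ext (smul_zero a)
  smul_add a x y := Subtype.ext (smul_add a (x : H →L[ℂ] H) y)
  add_smul a b x := Subtype.ext (add_smul a b (x : H →L[ℂ] H))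
  zero_smul x := Subtype.ext (zero_smul ℝ (x : H →L[ℂ] H))

@[simp]
theorem coe_real_smul (c : ℝ) (x : N) : ((c • x : N) : H →L[ℂ] H) = c • (x : H →L[ℂ] H) := rfl

instance : Algebra ℝ N :=
  Algebra.ofModule (fun c x y => Subtype.ext (smul_mul_assoc c (x : H →L[ℂ] H) y))
    fun c x y => Subtype.ext (mul_smul_comm c (x : H →L[ℂ] H) y)

instance : NormedAlgebra ℝ N where
  norm_smul_le c x := norm_smul_le c (x : H →L[ℂ] H)

instance : CompleteSpace N := (isClosed_coe N).completeSpace_coe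

attribute [local instance] Matrix.linftyOpNormedRing Matrix.linftyOpNormedAlgebra

/-- Right multiplication on the trace ideal. -/
def L1.mulRight {τ : NFSTrace N} (x : L1 τ) (a : N) : L1 τ :=
  L1.mk (x.val * a) (by simpa using mul_mem_traceIdeal τ (one_mem N) x.mem a.2)

/-- Left multiplication on the trace ideal. -/
def L1.mulLeft {τ : NFSTrace N} (a : N) (x : L1 τ) : L1 τ :=
  L1.mk (a * x.val) (by simpa using mul_mem_traceIdeal τ a.2 x.mem (one_mem N))

/-- The adjoint on the trace ideal. -/
def L1.adj {τ : NFSTrace N} (x : L1 τ) : L1 τ := L1.mk (star x.val) (star_mem_traceIdeal x.mem)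

@[simp]
theorem L1.val_mulRight {τ : NFSTrace N} (x : L1 τ) (a : N) :
    (x.mulRight a).val = x.val * a := rfl

@[simp]
theorem L1.val_mulLeft {τ : NFSTrace N} (x : L1 τ) (a : N) :
    (L1.mulLeft a x).val = a * x.val := rfl

@[simp]
theorem L1.val_adj {τ : NFSTrace N} (x : L1 τ) : x.adj.val = star x.val := rfl

theorem L1.norm_le_of_val_le {τ : NFSTrace N} {x y : L1 τ} {C : ℝ≥0} (h1 : ‖y.val‖ ≤ C * ‖x.val‖)
    (h2 : τ.val (CFC.abs y.val) ≤ C * τ.val (CFC.abs x.val)) : ‖y‖ ≤ C * ‖x‖ := by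
  rw [L1.norm_def, L1.norm_def, mul_add]
  refine add_le_add h1 ?_
  have := ENNReal.toReal_mono (ENNReal.mul_lt_top (by simp) x.mem.2).ne h2
  rwa [ENNReal.toReal_mul] at this

theorem L1.norm_mulRight_le {τ : NFSTrace N} (x : L1 τ) (a : N) :
    ‖x.mulRight a‖ ≤ ‖x‖ * ‖a‖ := by
  rw [mul_comm]
  refine L1.norm_le_of_val_le (C := ‖a‖₊) ((norm_mul_le _ _).trans (mul_comm _ _).le) ?_
  have h := val_abs_mul_mul_le τ (one_mem N) x.mem.1 a.2
  rw [one_mul] at h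
  refine h.trans ?_
  have h1 : ((‖(1 : H →L[ℂ] H)‖₊ : ℝ≥0) : ℝ≥0∞) ≤ 1 := by
    exact_mod_cast (ContinuousLinearMap.norm_id_le : ‖(1 : H →L[ℂ] H)‖ ≤ 1)
  calc _ ≤ 1 * (‖(a : H →L[ℂ] H)‖₊ : ℝ≥0∞) * τ.val (CFC.abs x.val) := by gcongr
    _ = _ := by rw [one_mul]; rfl

theorem L1.norm_adj_le {τ : NFSTrace N} (x : L1 τ) : ‖x.adj‖ ≤ ‖x‖ := by
  have := L1.norm_le_of_val_le (C := 1) (x := x) (y := x.adj) (by simp)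
    (by simpa using val_abs_star_le τ x.mem.1)
  simpa using this

theorem L1.norm_mulLeft_le {τ : NFSTrace N} (x : L1 τ) (a : N) :
    ‖L1.mulLeft a x‖ ≤ ‖a‖ * ‖x‖ := by
  refine L1.norm_le_of_val_le (C := ‖a‖₊) (norm_mul_le _ _) ?_
  have h := val_abs_mul_mul_le τ a.2 x.mem.1 (one_mem N)
  rw [mul_one] at h
  refine h.trans ?_
  have h1 : ((‖(1 : H →L[ℂ] H)‖₊ : ℝ≥0) : ℝ≥0∞) ≤ 1 := by
    exact_mod_cast (ContinuousLinearMap.norm_id_le : ‖(1 : H →L[ℂ] H)‖ ≤ 1)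
  calc _ ≤ (‖(a : H →L[ℂ] H)‖₊ : ℝ≥0∞) * 1 * τ.val (CFC.abs x.val) := by gcongr
    _ = _ := by rw [mul_one]; rfl

theorem L1.val_real_smul {τ : NFSTrace N} (c : ℝ) (x : L1 τ) : (c • x).val = c • x.val :=
  (L1.valL τ).map_smul_of_tower c x

/-- The matrices over `L¹_τ(N)`. -/
abbrev MatL1 (τ : NFSTrace N) (n : ℕ) : Type _ := Fin n → Fin n → L1 τ

theorem norm_entry_le {n : ℕ} (a : Matrix (Fin n) (Fin n) N) (i j : Fin n) : ‖a i j‖ ≤ ‖a‖ := by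
  have h : ‖a i j‖₊ ≤ ‖a‖₊ := by
    rw [Matrix.linfty_opNNNorm_def]
    refine le_trans ?_ (Finset.le_sup (f := fun i => ∑ j, ‖a i j‖₊) (Finset.mem_univ i))
    exact Finset.single_le_sum (f := fun j => ‖a i j‖₊) (fun _ _ => zero_le) (Finset.mem_univ j)
  exact h

/-- Matrices over `N` carry the row-sum norm, matrices over the ideal the largest entry norm. The
comparison costs the factor `n` in the bound for `matIncl`. -/
theorem norm_matrix_le {n : ℕ} {a : Matrix (Fin n) (Fin n) N} {C : ℝ} (hC : 0 ≤ C)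
    (h : ∀ i j, ‖a i j‖ ≤ C) : ‖a‖ ≤ n * C := by
  lift C to ℝ≥0 using hC
  have : ‖a‖₊ ≤ n * C := by
    rw [Matrix.linfty_opNNNorm_def]
    refine Finset.sup_le fun i _ => ?_
    refine (Finset.sum_le_card_nsmul _ _ C fun j _ => h i j).trans (le_of_eq ?_)
    simp
  exact this

theorem norm_matL1_entry_le {τ : NFSTrace N} {n : ℕ} (x : MatL1 τ n) (i j : Fin n) :
    ‖x i j‖ ≤ ‖x‖ := (norm_le_pi_norm (x i) j).trans (norm_le_pi_norm x i)

instance (n : ℕ) : @CompleteSpace (Matrix (Fin n) (Fin n) N)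
    (Matrix.linftyOpNormedRing (n := Fin n)
      (α := N)).toSeminormedRing.toPseudoMetricSpace.toUniformSpace :=
  inferInstanceAs (CompleteSpace (Fin n → Fin n → N))

variable {τ : NFSTrace N} {n : ℕ}

/-- The inclusion of the matrices over the trace ideal. -/
def matIncl (τ : NFSTrace N) (n : ℕ) : MatL1 τ n →L[ℝ] Matrix (Fin n) (Fin n) N :=
  LinearMap.mkContinuous
    { toFun := fun x => Matrix.of fun i j => (⟨(x i j).val, (x i j).mem.1⟩ : N)
      map_add' := fun x y => rfl
      map_smul' := fun c x => by
        refine Matrix.ext fun i j => Subtype.ext ?_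
        exact L1.val_real_smul c (x i j) } n
    fun x => norm_matrix_le (norm_nonneg x) fun i j =>
      (x i j).norm_val_le.trans (norm_matL1_entry_le x i j)

/-- Right multiplication on the matrices over the trace ideal. -/
def matMulR (τ : NFSTrace N) (n : ℕ) :
    MatL1 τ n →L[ℝ] Matrix (Fin n) (Fin n) N →L[ℝ] MatL1 τ n :=
  (LinearMap.mk₂ ℝ (fun (x : MatL1 τ n) (a : Matrix (Fin n) (Fin n) N) i k =>
      ∑ j, (x i j).mulRight (a j k))
    (fun x y a => by
      ext i k; apply L1.val_injective
      simp [add_mul, Finset.sum_add_distrib])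
    (fun c x a => by
      ext i k; apply L1.val_injective
      simp [Finset.smul_sum])
    (fun x a b => by
      ext i k; apply L1.val_injective
      simp [mul_add, Finset.sum_add_distrib])
    (fun c x a => by
      ext i k; apply L1.val_injective
      simp [Finset.smul_sum])).mkContinuous₂ n
    fun x a => by
      refine (pi_norm_le_iff_of_nonneg (by positivity)).2 fun i =>
        (pi_norm_le_iff_of_nonneg (by positivity)).2 fun k => ?_
      refine (norm_sum_le_of_le (f := fun j => (x i j).mulRight (a j k)) Finset.univ
        (n := fun _ => ‖x‖ * ‖a‖) fun j _ =>
        (L1.norm_mulRight_le _ _).trans ?_).trans (le_of_eq (by simp [mul_assoc]))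
      exact mul_le_mul (norm_matL1_entry_le x i j) (norm_entry_le a j k) (norm_nonneg _)
        (norm_nonneg _)

/-- Left multiplication on the matrices over the trace ideal. -/
def matMulL (τ : NFSTrace N) (n : ℕ) :
    Matrix (Fin n) (Fin n) N →L[ℝ] MatL1 τ n →L[ℝ] MatL1 τ n :=
  (LinearMap.mk₂ ℝ (fun (a : Matrix (Fin n) (Fin n) N) (x : MatL1 τ n) i k =>
      ∑ j, L1.mulLeft (a i j) (x j k))
    (fun x y a => by
      ext i k; apply L1.val_injective
      simp [add_mul, Finset.sum_add_distrib])
    (fun c x a => by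
      ext i k; apply L1.val_injective
      simp [Finset.smul_sum])
    (fun x a b => by
      ext i k; apply L1.val_injective
      simp [mul_add, Finset.sum_add_distrib])
    (fun c x a => by
      ext i k; apply L1.val_injective
      simp [Finset.smul_sum])).mkContinuous₂ n
    fun a x => by
      refine (pi_norm_le_iff_of_nonneg (by positivity)).2 fun i =>
        (pi_norm_le_iff_of_nonneg (by positivity)).2 fun k => ?_
      refine (norm_sum_le_of_le (f := fun j => L1.mulLeft (a i j) (x j k)) Finset.univ
        (n := fun _ => ‖a‖ * ‖x‖) fun j _ =>
        (L1.norm_mulLeft_le _ _).trans ?_).trans (le_of_eq (by simp [mul_assoc]))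
      exact mul_le_mul (norm_entry_le a i j) (norm_matL1_entry_le x j k) (norm_nonneg _)
        (norm_nonneg _)

/-- The trace on the matrices over the trace ideal. -/
def matTrace (τ : NFSTrace N) (n : ℕ) : MatL1 τ n →L[ℝ] ℂ :=
  ∑ i, (L1.trace τ).restrictScalars ℝ ∘L
    ContinuousLinearMap.proj (R := ℝ) (φ := fun _ => L1 τ) i ∘L
      ContinuousLinearMap.proj (R := ℝ) (φ := fun _ => Fin n → L1 τ) i

/-- The matrices over the trace ideal as an ideal with a trace. -/
def matTraced (τ : NFSTrace N) (n : ℕ) :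
    TracedIdeal (Matrix (Fin n) (Fin n) N) (MatL1 τ n) where
  incl := matIncl τ n
  incl_injective := fun x y h => by
    ext i j
    have h1 : ((matIncl τ n x i j : N) : H →L[ℂ] H) = (matIncl τ n y i j : N) :=
      congrArg (fun a : Matrix (Fin n) (Fin n) N => (a i j : H →L[ℂ] H)) h
    exact L1.val_injective τ h1
  mulR := matMulR τ n
  mulL := matMulL τ n
  incl_mulR := fun x a => by
    refine Matrix.ext fun i k => Subtype.ext ?_
    rw [Matrix.mul_apply, AddSubmonoidClass.coe_finsetSum]
    exact map_sum L1.val (fun j => (x i j).mulRight (a j k)) _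
  incl_mulL := fun a x => by
    refine Matrix.ext fun i k => Subtype.ext ?_
    rw [Matrix.mul_apply, AddSubmonoidClass.coe_finsetSum]
    exact map_sum L1.val (fun j => L1.mulLeft (a i j) (x j k)) _
  trace := matTrace τ n
  trace_comm := fun x a => by
    have h1 : ∀ y : MatL1 τ n, matTrace τ n y = ∑ i, L1.trace τ (y i i) := fun y => by
      simp only [matTrace, sum_apply]
      rfl
    refine (h1 _).trans (Eq.trans ?_ (h1 _).symm)
    show ∑ i, L1.trace τ (∑ j, (x i j).mulRight (a j i)) =
      ∑ i, L1.trace τ (∑ j, L1.mulLeft (a i j) (x j i))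
    simp only [map_sum]
    rw [Finset.sum_comm]
    refine Finset.sum_congr rfl fun j _ => Finset.sum_congr rfl fun i _ => ?_
    exact ext_mul_comm (x i j).mem (a j i).2

theorem matTraced_incl_apply (x : MatL1 τ n) (i j : Fin n) :
    (((matTraced τ n).incl x) i j : H →L[ℂ] H) = (x i j).val := rfl

theorem matTraced_mulR_apply (x : MatL1 τ n) (a : Matrix (Fin n) (Fin n) N) (i k : Fin n) :
    (matTraced τ n).mulR x a i k = ∑ j, (x i j).mulRight (a j k) := rfl

theorem matTraced_trace_apply (x : MatL1 τ n) :
    (matTraced τ n).trace x = ∑ i, L1.trace τ (x i i) := by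
  have : (matTraced τ n).trace x = matTrace τ n x := rfl
  rw [this]
  simp only [matTrace, sum_apply]
  rfl

/-- The adjoint of a matrix over the trace ideal. -/
def matStar (τ : NFSTrace N) (n : ℕ) : MatL1 τ n →L[ℝ] MatL1 τ n :=
  LinearMap.mkContinuous
    { toFun := fun x i j => (x j i).adj
      map_add' := fun x y => by
        ext i j; apply L1.val_injective
        simp
      map_smul' := fun c x => by
        ext i j; apply L1.val_injective
        simp } 1
    fun x => (pi_norm_le_iff_of_nonneg (by positivity)).2 fun i =>
      (pi_norm_le_iff_of_nonneg (by positivity)).2 fun j => by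
        rw [one_mul]
        exact (L1.norm_adj_le _).trans (norm_matL1_entry_le x j i)

theorem matTraced_incl_matStar (x : MatL1 τ n) :
    (matTraced τ n).incl (matStar τ n x) = star ((matTraced τ n).incl x) := rfl

theorem matTraced_trace_matStar (x : MatL1 τ n) :
    (matTraced τ n).trace (matStar τ n x) = star ((matTraced τ n).trace x) := by
  rw [matTraced_trace_apply, matTraced_trace_apply, star_sum]
  exact Finset.sum_congr rfl fun i _ => ext_star τ (x i i).val

end MatrixIdeal

/-! ## Faithful representations -/

section Operators

variable {K : Type*} [NormedAddCommGroup K] [InnerProductSpace ℂ K] [CompleteSpace K]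

theorem isUnit_of_smul_one_le {a : K →L[ℂ] K} {c : ℝ} (hc : 0 < c) (h : c • 1 ≤ a) :
    IsUnit a := by
  refine CStarAlgebra.isUnit_of_le (c • 1) h ?_
  exact IsStrictlyPositive.smul hc isStrictlyPositive_one

theorem convex_isStrictlyPositive : Convex ℝ {a : K →L[ℂ] K | IsStrictlyPositive a} := by
  rintro a (ha : IsStrictlyPositive a) b (hb : IsStrictlyPositive b) s t hs ht hst
  show IsStrictlyPositive (s • a + t • b)
  rcases hs.eq_or_lt with rfl | hs
  · rw [zero_add] at hst
    subst hst
    rwa [zero_smul, zero_add, one_smul]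
  · exact (IsStrictlyPositive.smul hs ha).add_nonneg (smul_nonneg ht hb.nonneg)

/-- The segment from `1` to a unitary operator with non-negative real part consists of invertible
operators. -/
theorem isUnit_segment_of_unitary {v : K →L[ℂ] K} (h1 : star v * v = 1) (h2 : v * star v = 1)
    (h : 0 ≤ v + star v) {t : ℝ} (ht : t ∈ Set.Icc (0 : ℝ) 1) : IsUnit (1 + t • (v - 1)) := by
  -- For `a = 1 + t (v - 1)` both `a*a` and `aa*` equal `(1 - t)² + t² + t (1 - t)(v + v*)`, which
  -- is bounded below by a positive scalar. A left inverse of `a*a` and a right inverse of `aa*`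
  -- then give one of each for `a`.
  have h3 : ((1 - t) ^ 2 + t ^ 2) • (1 : K →L[ℂ] K) ≤
      ((1 - t) ^ 2 + t ^ 2) • (1 : K →L[ℂ] K) + (t * (1 - t)) • (v + star v) :=
    le_add_of_nonneg_right (smul_nonneg (mul_nonneg ht.1 (by linarith [ht.2])) h)
  have hpos : 0 < (1 - t) ^ 2 + t ^ 2 := by nlinarith [sq_nonneg (1 - 2 * t)]
  have h4 := isUnit_of_smul_one_le hpos h3
  have e1 : star (1 + t • (v - 1)) * (1 + t • (v - 1)) =
      ((1 - t) ^ 2 + t ^ 2) • (1 : K →L[ℂ] K) + (t * (1 - t)) • (v + star v) := by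
    simp only [star_add, star_smul, star_sub, star_one, star_trivial, mul_add, add_mul, mul_sub,
      sub_mul, smul_mul_assoc, mul_smul_comm, h1, one_mul, mul_one, smul_sub, smul_add]
    module
  have e2 : (1 + t • (v - 1)) * star (1 + t • (v - 1)) =
      ((1 - t) ^ 2 + t ^ 2) • (1 : K →L[ℂ] K) + (t * (1 - t)) • (v + star v) := by
    simp only [star_add, star_smul, star_sub, star_one, star_trivial, mul_add, add_mul, mul_sub,
      sub_mul, smul_mul_assoc, mul_smul_comm, h2, one_mul, mul_one, smul_sub, smul_add]
    module
  rw [← e1] at h4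
  have h5 := h4
  rw [e1, ← e2] at h5
  obtain ⟨a, ha⟩ := h4.exists_left_inv
  obtain ⟨b, hb⟩ := h5.exists_right_inv
  exact isUnit_iff_exists_and_exists.2
    ⟨⟨star (1 + t • (v - 1)) * b, by rw [← mul_assoc, hb]⟩,
      ⟨a * star (1 + t • (v - 1)), by rw [mul_assoc, ha]⟩⟩

/-- The positive and negative parts of an operator are separated by a projection. -/
theorem exists_projection_split (a : K →L[ℂ] K) :
    ∃ p : K →L[ℂ] K, p * p = p ∧ star p = p ∧ a⁺ * p = a⁺ ∧ a⁻ * p = 0 ∧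
      ∀ y, Commute y a → Commute (star y) a → Commute y p := by
  -- The projection onto the kernel of `a⁻` replaces a spectral projection. The kernel contains the
  -- range of `a⁺`, since `a⁻ a⁺ = 0`.
  let V : Submodule ℂ K := LinearMap.ker ((a⁻ : K →L[ℂ] K) : K →ₗ[ℂ] K)
  have hV : IsClosed (V : Set K) := isClosed_eq (a⁻ : K →L[ℂ] K).continuous continuous_const
  have : CompleteSpace V := hV.completeSpace_coe
  have hp := isStarProjection_starProjection (U := V)
  set p := V.starProjection with hpdef
  have hps : star p = p := hp.isSelfAdjoint.star_eq
  have hpV : ∀ z : K →L[ℂ] K, (∀ v, z v ∈ V) → p * z = z := fun z hz => by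
    ext v
    exact Submodule.starProjection_eq_self_iff.2 (hz v)
  have hap : a⁺ * p = a⁺ := by
    have h1 : p * a⁺ = a⁺ := hpV _ fun v => by
      have : a⁻ * a⁺ = 0 := CFC.negPart_mul_posPart a
      exact congrArg (fun T : K →L[ℂ] K => T v) this
    have h2 := congrArg star h1
    rwa [star_mul, hps, (CFC.posPart_nonneg a).isSelfAdjoint.star_eq] at h2
  refine ⟨p, hp.isIdempotentElem, hps, hap, ?_, fun y hy hy' => ?_⟩
  · ext v
    exact (V.starProjection_apply_mem v : p v ∈ V)
  -- An operator commuting with `a` leaves the kernel of `a⁻` invariant. Invariance under `y` gives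
  -- `p y p = y p`, invariance under `y*` gives `p y p = p y`.
  · have hinv : ∀ z : K →L[ℂ] K, Commute z a → p * (z * p) = z * p := fun z hz => by
      refine hpV _ fun v => ?_
      have h1 : Commute z a⁻ := (hz.symm.cfcₙ_real _).symm
      show a⁻ (z (p v)) = 0
      have h2 : a⁻ (z (p v)) = z (a⁻ (p v)) :=
        (congrArg (fun T : K →L[ℂ] K => T (p v)) h1.eq).symm
      have h3 : a⁻ (p v) = 0 := V.starProjection_apply_mem v
      rw [h2, h3, map_zero]
    have h1 := hinv y hy
    have h2 := congrArg star (hinv (star y) hy')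
    simp only [star_mul, star_star, hps] at h2
    rw [commute_iff_eq, ← h1, ← mul_assoc, h2]

end Operators

/-- A faithful representation of the algebra on a Hilbert space, whose image is a commutant and such
that the ideal is closed under adjoints and multiplication by `i`. -/
structure TracedIdeal.Rep {A J : Type*} [NormedRing A] [NormedAlgebra ℝ A] [StarRing A]
    [NormedAddCommGroup J] [NormedSpace ℝ J] (I : TracedIdeal A J) (K : Type*)
    [NormedAddCommGroup K] [InnerProductSpace ℂ K] [CompleteSpace K] where
  /-- the representation -/
  rep : A →⋆ₐ[ℝ] (K →L[ℂ] K)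
  rep_injective : Function.Injective rep
  /-- a set of operators whose commutant is the image -/
  gen : Set (K →L[ℂ] K)
  star_mem : ∀ y ∈ gen, star y ∈ gen
  mem_range : ∀ b, b ∈ Set.range rep ↔ ∀ y ∈ gen, Commute y b
  /-- the adjoint on the ideal -/
  adj : J →L[ℝ] J
  incl_adj : ∀ x, I.incl (adj x) = star (I.incl x)
  trace_adj : ∀ x, I.trace (adj x) = star (I.trace x)
  exists_I_smul : ∀ x, ∃ y, rep (I.incl y) = Complex.I • rep (I.incl x)

namespace TracedIdeal.Rep

variable {A J : Type*} [NormedRing A] [NormedAlgebra ℝ A] [StarRing A]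
  [NormedAddCommGroup J] [NormedSpace ℝ J] {I : TracedIdeal A J} {K : Type*}
  [NormedAddCommGroup K] [InnerProductSpace ℂ K] [CompleteSpace K] (R : I.Rep K)

/-- Commutants contain the inverses of their invertible elements, so invertibility may be tested
among the operators on `K`. -/
theorem inverse_mem_range {a b : K →L[ℂ] K} (ha : a ∈ Set.range R.rep)
    (h1 : a * b = 1) (h2 : b * a = 1) : b ∈ Set.range R.rep := by
  rw [R.mem_range] at ha ⊢
  intro y hy
  have h := (ha y hy).eq
  calc y * b = (b * a) * y * b := by rw [h2, one_mul]
    _ = b * (y * a) * b := by rw [mul_assoc b a, h]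
    _ = b * y := by rw [mul_assoc, mul_assoc, h1, mul_one]

theorem isUnit_of_rep {a : A} (h : IsUnit (R.rep a)) : IsUnit a := by
  obtain ⟨u, hu⟩ := h
  obtain ⟨b, hb⟩ := R.inverse_mem_range (b := (u⁻¹ : (K →L[ℂ] K)ˣ)) ⟨a, hu.symm⟩
    (Units.mul_inv u) (Units.inv_mul u)
  refine ⟨⟨a, b, R.rep_injective ?_, R.rep_injective ?_⟩, rfl⟩
  · rw [map_mul, hb, ← hu, Units.mul_inv, map_one]
  · rw [map_mul, hb, ← hu, Units.inv_mul, map_one]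

/-- The positive invertible elements. -/
def posUnits : Set A := {a | IsStrictlyPositive (R.rep a)}

theorem convex_posUnits : Convex ℝ R.posUnits := by
  intro a ha b hb s t hs ht hst
  show IsStrictlyPositive (R.rep (s • a + t • b))
  rw [map_add, map_smul, map_smul]
  exact convex_isStrictlyPositive ha hb hs ht hst

theorem isUnit_of_mem_posUnits {a : A} (ha : a ∈ R.posUnits) : IsUnit a :=
  R.isUnit_of_rep (IsStrictlyPositive.isUnit ha)

theorem star_mul_self_mem_posUnits {a : A} (ha : IsUnit a) : star a * a ∈ R.posUnits := by
  show IsStrictlyPositive (R.rep (star a * a))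
  rw [map_mul, map_star]
  have := ha.map R.rep
  exact IsStrictlyPositive.iff_of_unital.2 ⟨star_mul_self_nonneg _, this.star.mul this⟩

/-- The real part of the integral of the logarithmic derivative is determined by the absolute value
of the end point. -/
theorem re_logIntegral_eq [CompleteSpace A] (R : I.Rep K) {x y : ℝ → J} (hx : I.IsPath x) (hy : I.IsPath y)
    (hx0 : x 0 = 0) (hy0 : y 0 = 0)
    (h1 : star (I.oneAdd (x 1)) * I.oneAdd (x 1) = star (I.oneAdd (y 1)) * I.oneAdd (y 1)) :
    (I.logIntegral x).re = (I.logIntegral y).re :=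
  TracedIdeal.re_logIntegral_eq R.adj R.incl_adj R.trace_adj R.convex_posUnits
    (fun _ => R.isUnit_of_mem_posUnits) (fun _ => R.star_mul_self_mem_posUnits) hx hy hx0 hy0 h1

/-- The image of the ideal. -/
def opIdeal : AddSubgroup (K →L[ℂ] K) where
  carrier := {b | ∃ x, R.rep (I.incl x) = b}
  zero_mem' := ⟨0, by rw [map_zero, map_zero]⟩
  add_mem' := by
    rintro _ _ ⟨x, rfl⟩ ⟨y, rfl⟩
    exact ⟨x + y, by rw [map_add, map_add]⟩
  neg_mem' := by
    rintro _ ⟨x, rfl⟩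
    exact ⟨-x, by rw [map_neg, map_neg]⟩

theorem opIdeal_mul_right {a b : K →L[ℂ] K} (ha : a ∈ R.opIdeal)
    (hb : b ∈ Set.range (R.rep)) : a * b ∈ R.opIdeal := by
  obtain ⟨x, rfl⟩ := ha
  obtain ⟨b, rfl⟩ := hb
  exact ⟨I.mulR x b, by rw [TracedIdeal.incl_mulR, map_mul]⟩

theorem opIdeal_mul_left {a b : K →L[ℂ] K} (ha : a ∈ R.opIdeal)
    (hb : b ∈ Set.range (R.rep)) : b * a ∈ R.opIdeal := by
  obtain ⟨x, rfl⟩ := ha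
  obtain ⟨b, rfl⟩ := hb
  exact ⟨I.mulL b x, by rw [TracedIdeal.incl_mulL, map_mul]⟩

theorem opIdeal_star {a : K →L[ℂ] K} (ha : a ∈ R.opIdeal) :
    star a ∈ R.opIdeal := by
  obtain ⟨x, rfl⟩ := ha
  exact ⟨R.adj x, by rw [R.incl_adj, map_star]⟩

theorem opIdeal_I_smul {a : K →L[ℂ] K} (ha : a ∈ R.opIdeal) : Complex.I • a ∈ R.opIdeal := by
  obtain ⟨x, rfl⟩ := ha
  exact R.exists_I_smul x

theorem opIdeal_subset_range {a : K →L[ℂ] K} (ha : a ∈ R.opIdeal) :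
    a ∈ Set.range (R.rep) := by
  obtain ⟨x, rfl⟩ := ha
  exact ⟨_, rfl⟩

/-- There is a smooth path of invertible elements of `1 + J` from `1` to `b`. -/
def Reachable (b : K →L[ℂ] K) : Prop :=
  ∃ x : ℝ → J, ContDiffOn ℝ ∞ x (Set.Icc 0 1) ∧
    (∀ t ∈ Set.Icc (0 : ℝ) 1, IsUnit (I.oneAdd (x t))) ∧ x 0 = 0 ∧
    R.rep (I.oneAdd (x 1)) = b

theorem reachable_mul {a b : K →L[ℂ] K} (ha : R.Reachable a)
    (hb : R.Reachable b) : R.Reachable (a * b) := by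
  obtain ⟨x, hx, hxu, hx0, rfl⟩ := ha
  obtain ⟨y, hy, hyu, hy0, rfl⟩ := hb
  refine ⟨fun t => I.circ (x t) (y t), TracedIdeal.contDiffOn_circ hx hy,
    fun t ht => ?_, ?_, ?_⟩
  · rw [TracedIdeal.oneAdd_circ]
    exact (hxu t ht).mul (hyu t ht)
  · show I.circ (x 0) (y 0) = 0
    rw [circ, hx0, hy0, map_zero, zero_apply, zero_add]
  · rw [TracedIdeal.oneAdd_circ, map_mul]

theorem reachable_of_segment {b : K →L[ℂ] K} (hb : b - 1 ∈ R.opIdeal)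
    (h : ∀ t ∈ Set.Icc (0 : ℝ) 1, IsUnit (1 + t • (b - 1))) : R.Reachable b := by
  obtain ⟨x, hx⟩ := hb
  have h1 : ∀ t : ℝ, R.rep (I.oneAdd (t • x)) = 1 + t • (b - 1) := by
    intro t
    rw [TracedIdeal.oneAdd, map_smul, map_add, map_one, ← hx]
    rw [map_smul]
  refine ⟨fun t => t • x, (contDiff_id.smul contDiff_const).contDiffOn, fun t ht => ?_,
    zero_smul ℝ x, ?_⟩
  · apply R.isUnit_of_rep
    rw [h1]
    exact h t ht
  · rw [h1, one_smul, add_sub_cancel]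

theorem reachable_of_isStrictlyPositive {b : K →L[ℂ] K} (hb : b - 1 ∈ R.opIdeal)
    (h : IsStrictlyPositive b) : R.Reachable b := by
  refine R.reachable_of_segment hb fun t ht => ?_
  have h1 := convex_isStrictlyPositive (isStrictlyPositive_one (A := K →L[ℂ] K)) h
    (sub_nonneg.2 ht.2) ht.1 (sub_add_cancel 1 t)
  convert! IsStrictlyPositive.isUnit h1 using 1
  module

theorem reachable_of_unitary_nonneg {v : K →L[ℂ] K} (hv : v - 1 ∈ R.opIdeal)
    (h1 : star v * v = 1) (h2 : v * star v = 1) (h : 0 ≤ v + star v) : R.Reachable v :=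
  R.reachable_of_segment hv fun _ ht => isUnit_segment_of_unitary h1 h2 h ht

/-- Let `p` split `a = u + u*` into its positive and negative parts and let `q = 1 - p`. Then `u =
(p + iq)² (p - uq)(up + q)`. The three different factors are unitary, and adding to each its adjoint
gives `2p`, `2p + a⁻` and `a⁺ + 2q`, all non-negative, so a segment joins each factor to `1`. -/
theorem reachable_of_unitary {u : K →L[ℂ] K} (hu : u - 1 ∈ R.opIdeal)
    (h1 : star u * u = 1) (h2 : u * star u = 1) : R.Reachable u := by
  have huN : u ∈ Set.range (R.rep) := by
    obtain ⟨x, hx⟩ := R.opIdeal_subset_range hu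
    exact ⟨x + 1, by rw [map_add, map_one, hx, sub_add_cancel]⟩
  have hsN : star u ∈ Set.range (R.rep) := by
    obtain ⟨x, rfl⟩ := huN
    exact ⟨star x, map_star _ _⟩
  set a : K →L[ℂ] K := u + star u with ha
  have has : IsSelfAdjoint a := IsSelfAdjoint.add_star_self u
  obtain ⟨p, hpp, hps, hap, hnp, hpc⟩ := exists_projection_split a
  have hcu : ∀ y, Commute y u → Commute y (star u) → Commute y a := fun y h3 h4 =>
    h3.add_right h4
  have hus : Commute u (star u) := h2.trans h1.symm
  have hup : u * p = p * u :=
    (hpc u (hcu u (Commute.refl u) hus) (hcu _ hus.symm (Commute.refl _))).eq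
  have hsp : star u * p = p * star u := by
    have := congrArg star hup
    rw [star_mul, star_mul, hps] at this
    exact this.symm
  have hyN : ∀ y ∈ R.gen, Commute (y) a := fun y hy =>
    hcu _ ((R.mem_range _).1 huN y hy) ((R.mem_range _).1 hsN y hy)
  have hpN : p ∈ Set.range (R.rep) := (R.mem_range _).2 fun y hy => by
    refine hpc _ (hyN y hy) ?_
    exact hyN _ (R.star_mem y hy)
  have hnN : a⁻ ∈ Set.range (R.rep) := (R.mem_range _).2 fun y hy =>
    ((hyN y hy).symm.cfcₙ_real _).symm
  have hap' : a * p = a⁺ := by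
    conv_lhs => rw [← CFC.posPart_sub_negPart a has]
    rw [sub_mul, hap, hnp, sub_zero]
  have haq : a * (1 - p) = -a⁻ := by
    rw [mul_sub, mul_one, hap']
    nth_rw 1 [← CFC.posPart_sub_negPart a has]
    abel
  have hpa : 0 ≤ a⁺ := CFC.posPart_nonneg a
  have hna : 0 ≤ a⁻ := CFC.negPart_nonneg a
  have hp0 : 0 ≤ p := by
    have := star_mul_self_nonneg p
    rwa [hps, hpp] at this
  have hqq : (1 - p) * (1 - p) = 1 - p := by
    rw [mul_sub, sub_mul, sub_mul, hpp]; simp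
  have hqs : star (1 - p) = 1 - p := by rw [star_sub, star_one, hps]
  have hq0 : 0 ≤ 1 - p := by
    have := star_mul_self_nonneg (1 - p)
    rwa [hqs, hqq] at this
  have hpq : p * (1 - p) = 0 := by rw [mul_sub, mul_one, hpp, sub_self]
  have hqp : (1 - p) * p = 0 := by rw [sub_mul, one_mul, hpp, sub_self]
  have huq : u * (1 - p) = (1 - p) * u := by rw [mul_sub, sub_mul, hup, mul_one, one_mul]
  have hsq : star u * (1 - p) = (1 - p) * star u := by
    rw [mul_sub, sub_mul, hsp, mul_one, one_mul]
  set q := 1 - p with hq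
  have hqN : q ∈ Set.range (R.rep) := by
    obtain ⟨x, hx⟩ := hpN
    exact ⟨1 - x, by rw [map_sub, map_one, hx]⟩
  -- On the range of `q` the unitary stays away from `1`: from `(u - 1)*(u - 1) = 2 - a` one gets
  -- `(2 + a⁻) q = (u - 1)*(u - 1) q`, and `2 + a⁻` is invertible. This is what keeps all the
  -- factors in `1 + J`.
  have hqJ : q ∈ R.opIdeal := by
    have h3 : IsUnit (2 + a⁻) := by
      refine isUnit_of_smul_one_le two_pos ?_
      have : (2 : ℝ) • (1 : K →L[ℂ] K) = 2 := by
        rw [two_smul, one_add_one_eq_two]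
      rw [this]
      exact le_add_of_nonneg_right hna
    obtain ⟨w, hw⟩ := h3
    have hwN : (w : K →L[ℂ] K) ∈ Set.range (R.rep) := by
      obtain ⟨x, hx⟩ := hnN
      refine ⟨1 + 1 + x, ?_⟩
      rw [map_add, map_add, map_one, hx, hw, one_add_one_eq_two]
    have h4 : (w : K →L[ℂ] K) * q = star (u - 1) * (u - 1) * q := by
      have e1 : star (u - 1) * (u - 1) = 2 - a := by
        rw [ha, star_sub, star_one, sub_mul, mul_sub, h1, ← one_add_one_eq_two]
        noncomm_ring
      have e2 : a⁻ * q = a⁻ := by rw [hq, mul_sub, hnp, mul_one, sub_zero]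
      rw [e1, sub_mul, haq, hw, add_mul, e2, sub_neg_eq_add]
    have h5 : q = ((w⁻¹ : (K →L[ℂ] K)ˣ) : K →L[ℂ] K) *
        (star (u - 1) * (u - 1) * q) := by
      rw [← h4, ← mul_assoc, Units.inv_mul, one_mul]
    rw [h5]
    refine R.opIdeal_mul_left (R.opIdeal_mul_right (R.opIdeal_mul_left hu ?_) hqN)
      (R.inverse_mem_range hwN (Units.mul_inv w) (Units.inv_mul w))
    obtain ⟨x, hx⟩ := R.opIdeal_subset_range hu
    exact ⟨star x, by rw [map_star, hx]⟩
  have hp1 : p + q = 1 := by rw [hq]; abel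
  have hv : R.Reachable (u * p + q) := by
    have hst : star (u * p + q) = star u * p + q := by rw [star_add, star_mul, hps, hqs, hsp]
    refine R.reachable_of_unitary_nonneg ?_ ?_ ?_ ?_
    · have : u * p + q - 1 = (u - 1) * p := by rw [sub_mul, one_mul, hq]; abel
      rw [this]
      exact R.opIdeal_mul_right hu hpN
    · calc star (u * p + q) * (u * p + q)
          = star u * (p * u) * p + star u * (p * q) + (q * u) * p + q * q := by
            rw [hst]; noncomm_ring
        _ = (star u * u) * (p * p) + u * (q * p) + q := by
            rw [← hup, hpq, ← huq, hqq]; noncomm_ring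
        _ = 1 := by rw [h1, hpp, hqp, one_mul, mul_zero, add_zero, hp1]
    · calc (u * p + q) * star (u * p + q)
          = u * (p * star u) * p + u * (p * q) + (q * star u) * p + q * q := by
            rw [hst]; noncomm_ring
        _ = (u * star u) * (p * p) + star u * (q * p) + q := by
            rw [← hsp, hpq, ← hsq, hqq]; noncomm_ring
        _ = 1 := by rw [h2, hpp, hqp, one_mul, mul_zero, add_zero, hp1]
    · have : u * p + q + star (u * p + q) = a⁺ + (q + q) := by
        rw [hst, ← hap', ha, add_mul]; abel
      rw [this]
      exact add_nonneg hpa (add_nonneg hq0 hq0)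
  have hw : R.Reachable (p - u * q) := by
    have hst : star (p - u * q) = p - star u * q := by rw [star_sub, star_mul, hps, hqs, hsq]
    refine R.reachable_of_unitary_nonneg ?_ ?_ ?_ ?_
    · have : p - u * q - 1 = -(u * q + q) := by rw [← hp1]; abel
      rw [this]
      exact neg_mem (add_mem (R.opIdeal_mul_left hqJ huN) hqJ)
    · calc star (p - u * q) * (p - u * q)
          = p * p - (p * u) * q - star u * (q * p) + star u * (q * u) * q := by
            rw [hst]; noncomm_ring
        _ = p - u * (p * q) + (star u * u) * (q * q) := by
            rw [← hup, hqp, ← huq, hpp]; noncomm_ring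
        _ = 1 := by rw [h1, hqq, hpq, one_mul, mul_zero, sub_zero, hp1]
    · calc (p - u * q) * star (p - u * q)
          = p * p - (p * star u) * q - u * (q * p) + u * (q * star u) * q := by
            rw [hst]; noncomm_ring
        _ = p - star u * (p * q) + (u * star u) * (q * q) := by
            rw [← hsp, hqp, ← hsq, hpp]; noncomm_ring
        _ = 1 := by rw [h2, hqq, hpq, one_mul, mul_zero, sub_zero, hp1]
    · have : p - u * q + star (p - u * q) = p + p + a⁻ := by
        rw [hst, ← neg_neg a⁻, ← haq, ha, add_mul]; abel
      rw [this]
      exact add_nonneg (add_nonneg hp0 hp0) hna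
  -- The symmetry `p - q` cannot be joined to `1` by a segment when `q ≠ 0`, since the midpoint is
  -- `p`. It is reached by two quarter turns, as the square of `p + iq`.
  have hk : R.Reachable (p + Complex.I • q) := by
    have hst : star (p + Complex.I • q) = p - Complex.I • q := by
      have hI : star Complex.I = -Complex.I := Complex.conj_I
      rw [star_add, star_smul, hps, hqs, hI, neg_smul, sub_eq_add_neg]
    have h3 : (p - Complex.I • q) * (p + Complex.I • q) = 1 := by
      simp only [sub_mul, mul_add, smul_mul_assoc, mul_smul_comm, hpp, hpq, hqp, hqq, smul_zero,
        smul_smul, Complex.I_mul_I, neg_smul, one_smul, sub_zero, zero_sub,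
        smul_neg, neg_neg, hp1]
    have h4 : (p + Complex.I • q) * (p - Complex.I • q) = 1 := by
      simp only [mul_sub, add_mul, smul_mul_assoc, mul_smul_comm, hpp, hpq, hqp, hqq, smul_zero,
        smul_smul, Complex.I_mul_I, add_zero, zero_add, neg_smul, one_smul, sub_neg_eq_add, hp1]
    refine R.reachable_of_unitary_nonneg ?_ ?_ ?_ ?_
    · have : p + Complex.I • q - 1 = Complex.I • q - q := by rw [← hp1]; abel
      rw [this]
      exact sub_mem (R.opIdeal_I_smul hqJ) hqJ
    · rw [hst, h3]
    · rw [hst, h4]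
    · rw [hst]
      have : p + Complex.I • q + (p - Complex.I • q) = p + p := by abel
      rw [this]
      exact add_nonneg hp0 hp0
  have hu' : u = (p + Complex.I • q) * (p + Complex.I • q) * ((p - u * q) * (u * p + q)) := by
    have e1 : (p + Complex.I • q) * (p + Complex.I • q) = p - q := by
      simp only [add_mul, mul_add, smul_mul_assoc, mul_smul_comm, hpp, hpq, hqp, hqq, smul_zero,
        smul_smul, Complex.I_mul_I, add_zero, zero_add, neg_smul, one_smul, sub_eq_add_neg]
    have e2 : (p - u * q) * (u * p + q) = u * p - u * q := by
      calc (p - u * q) * (u * p + q)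
          = (p * u) * p + p * q - u * (q * u) * p - u * (q * q) := by noncomm_ring
        _ = u * (p * p) + p * q - u * u * (q * p) - u * (q * q) := by
          rw [← hup, ← huq]; noncomm_ring
        _ = u * p - u * q := by rw [hpp, hpq, hqp, hqq]; simp
    rw [e1, e2]
    calc u = u * (p + q) := by rw [hp1, mul_one]
      _ = u * (p * p) - u * (p * q) - u * (q * p) + u * (q * q) := by
        rw [hpp, hpq, hqp, hqq]; simp [mul_add]
      _ = (u * p) * p - (u * p) * q - (u * q) * p + (u * q) * q := by noncomm_ring
      _ = (p * u) * p - (p * u) * q - (q * u) * p + (q * u) * q := by rw [hup, huq]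
      _ = (p - q) * (u * p - u * q) := by noncomm_ring
  rw [hu']
  exact R.reachable_mul (R.reachable_mul hk hk) (R.reachable_mul hw hv)

/-- The group of invertible elements of `1 + J` is smoothly path connected. -/
theorem exists_path (R : I.Rep K) {g : A} (hg : IsUnit g)
    (hgJ : ∃ x, I.oneAdd x = g) :
    ∃ x : ℝ → J, ContDiffOn ℝ ∞ x (Set.Icc 0 1) ∧
      (∀ t ∈ Set.Icc (0 : ℝ) 1, IsUnit (I.oneAdd (x t))) ∧ x 0 = 0 ∧
      I.oneAdd (x 1) = g := by
  suffices h : R.Reachable (R.rep g) by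
    obtain ⟨x, hx, hxu, hx0, hx1⟩ := h
    exact ⟨x, hx, hxu, hx0, R.rep_injective hx1⟩
  have hG : IsUnit (R.rep g) := hg.map (R.rep)
  have hGJ : R.rep g - 1 ∈ R.opIdeal := by
    obtain ⟨x, rfl⟩ := hgJ
    exact ⟨x, by rw [TracedIdeal.oneAdd, map_add, map_one, add_sub_cancel_left]⟩
  set G := R.rep g with hGdef
  have hGN : G ∈ Set.range (R.rep) := ⟨g, rfl⟩
  have hsN : star G ∈ Set.range (R.rep) := ⟨star g, map_star _ _⟩
  set h := CFC.abs G with hh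
  have hh0 : 0 ≤ h := CFC.abs_nonneg G
  have hhs : star h = h := hh0.isSelfAdjoint.star_eq
  have hhh : h * h = star G * G := CFC.abs_mul_abs G
  have hhN : h ∈ Set.range (R.rep) := (R.mem_range _).2 fun y hy => by
    exact Commute.cfcAbs_right ((R.mem_range _).1 hGN y hy).symm
      ((R.mem_range _).1 hGN _ (R.star_mem y hy)).symm
  have hhu : IsUnit h := by
    have h1 : IsUnit (h * h) := by rw [hhh]; exact hG.star.mul hG
    exact ((Commute.refl h).isUnit_mul_iff.1 h1).1
  have hhp : IsStrictlyPositive h := IsStrictlyPositive.iff_of_unital.2 ⟨hh0, hhu⟩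
  -- Here `(1 + h)(h - 1) = h² - 1 = G*G - 1 = (G - 1)*G + (G - 1)` lies in the ideal, and `1 + h`
  -- is invertible with inverse in the algebra.
  have hhJ : h - 1 ∈ R.opIdeal := by
    have h1 : IsUnit (1 + h) := by
      refine isUnit_of_smul_one_le one_pos ?_
      rw [one_smul]
      exact le_add_of_nonneg_right hh0
    obtain ⟨w, hw⟩ := h1
    have hwN : (w : K →L[ℂ] K) ∈ Set.range (R.rep) := by
      obtain ⟨x, hx⟩ := hhN
      exact ⟨1 + x, by rw [map_add, map_one, hx, hw]⟩
    have h2 : (w : K →L[ℂ] K) * (h - 1) = star (G - 1) * G + (G - 1) := by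
      rw [hw, star_sub, star_one, sub_mul, ← hhh]
      noncomm_ring
    have h3 : h - 1 = ((w⁻¹ : (K →L[ℂ] K)ˣ) : K →L[ℂ] K) *
        (star (G - 1) * G + (G - 1)) := by
      rw [← h2, ← mul_assoc, Units.inv_mul, one_mul]
    rw [h3]
    exact R.opIdeal_mul_left (add_mem (R.opIdeal_mul_right (R.opIdeal_star hGJ) hGN) hGJ)
      (R.inverse_mem_range hwN (Units.mul_inv w) (Units.inv_mul w))
  obtain ⟨k, hk⟩ := hhu
  set k' : K →L[ℂ] K := ((k⁻¹ : (K →L[ℂ] K)ˣ) : K →L[ℂ] K) with hk'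
  have hkk1 : h * k' = 1 := by rw [← hk]; exact Units.mul_inv k
  have hkk2 : k' * h = 1 := by rw [← hk]; exact Units.inv_mul k
  have hks : star k' = k' := by
    have h1 := congrArg star hkk1
    rw [star_mul, hhs, star_one] at h1
    calc star k' = star k' * (h * k') := by rw [hkk1, mul_one]
      _ = k' := by rw [← mul_assoc, h1, one_mul]
  -- The polar part `G h⁻¹` is an isometry, and unitary because it is invertible.
  have hu : R.Reachable (G * k') := by
    have e1 : star (G * k') * (G * k') = 1 := by
      rw [star_mul, hks, mul_assoc, ← mul_assoc (star G), ← hhh, mul_assoc, hkk1, mul_one, hkk2]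
    refine R.reachable_of_unitary ?_ e1 ?_
    · have h1 : G * k' - 1 = ((G - 1) - (h - 1)) * k' := by
        rw [sub_sub_sub_cancel_right, sub_mul, hkk1]
      rw [h1]
      exact R.opIdeal_mul_right (sub_mem hGJ hhJ) (R.inverse_mem_range hhN hkk1 hkk2)
    · have h1 : IsUnit (G * k') := hG.mul (Units.isUnit _)
      obtain ⟨w, hw⟩ := h1
      rw [← hw] at e1 ⊢
      have h2 : star (w : K →L[ℂ] K) = (w⁻¹ : (K →L[ℂ] K)ˣ) :=
        Units.eq_inv_of_mul_eq_one_right e1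
      rw [h2, Units.mul_inv]
  have := R.reachable_mul hu (R.reachable_of_isStrictlyPositive hhJ hhp)
  rwa [mul_assoc, hkk2, mul_one] at this

end TracedIdeal.Rep

/-! ## Matrices as operators on `Hⁿ` -/

section Representation

variable {H : Type*} [NormedAddCommGroup H] [InnerProductSpace ℂ H] {n : ℕ}

/-- The Hilbert space `Hⁿ`. -/
abbrev HPow (H : Type*) (n : ℕ) : Type _ := PiLp 2 fun _ : Fin n => H

/-- The operator on `Hⁿ` given by a matrix of operators. -/
def matOp (a : Matrix (Fin n) (Fin n) (H →L[ℂ] H)) : HPow H n →L[ℂ] HPow H n :=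
  ((PiLp.continuousLinearEquiv 2 ℂ fun _ : Fin n => H).symm : (Fin n → H) →L[ℂ] HPow H n) ∘L
    (ContinuousLinearMap.pi fun i => ∑ j, a i j ∘L
      ContinuousLinearMap.proj (R := ℂ) (φ := fun _ : Fin n => H) j) ∘L
    (PiLp.continuousLinearEquiv 2 ℂ fun _ : Fin n => H : HPow H n →L[ℂ] Fin n → H)

theorem matOp_apply (a : Matrix (Fin n) (Fin n) (H →L[ℂ] H)) (x : HPow H n) (i : Fin n) :
    matOp a x i = ∑ j, a i j (x j) := by
  simp [matOp]

/-- The `(i, j)` entry of an operator on `Hⁿ`. -/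
def opEntry (b : HPow H n →L[ℂ] HPow H n) (i j : Fin n) : H →L[ℂ] H :=
  (ContinuousLinearMap.proj (R := ℂ) (φ := fun _ : Fin n => H) i) ∘L
    (PiLp.continuousLinearEquiv 2 ℂ fun _ : Fin n => H : HPow H n →L[ℂ] Fin n → H) ∘L b ∘L
    ((PiLp.continuousLinearEquiv 2 ℂ fun _ : Fin n => H).symm : (Fin n → H) →L[ℂ] HPow H n) ∘L
    (ContinuousLinearMap.single ℂ (fun _ : Fin n => H) j)

theorem opEntry_apply (b : HPow H n →L[ℂ] HPow H n) (i j : Fin n) (v : H) :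
    opEntry b i j v = b (WithLp.toLp 2 (Pi.single j v)) i := rfl

theorem matOp_opEntry (b : HPow H n →L[ℂ] HPow H n) :
    matOp (Matrix.of (opEntry b)) = b := by
  ext x i
  rw [matOp_apply]
  have h1 : x = ∑ j, WithLp.toLp 2 (Pi.single j (x j)) := by
    ext k
    simp [Pi.single_apply]
  conv_rhs => rw [h1, map_sum]
  simp only [Matrix.of_apply, opEntry_apply, WithLp.ofLp_sum, Finset.sum_apply]

theorem opEntry_matOp (a : Matrix (Fin n) (Fin n) (H →L[ℂ] H)) (i j : Fin n) :
    opEntry (matOp a) i j = a i j := by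
  ext v
  rw [opEntry_apply, matOp_apply, Finset.sum_eq_single j]
  · simp
  · intro k _ hk
    simp [hk]
  · simp

theorem matOp_injective :
    Function.Injective (matOp : Matrix (Fin n) (Fin n) (H →L[ℂ] H) → _) := by
  intro a b h
  ext1 i j
  rw [← opEntry_matOp a, h, opEntry_matOp]

theorem matOp_mul (a b : Matrix (Fin n) (Fin n) (H →L[ℂ] H)) :
    matOp (a * b) = matOp a * matOp b := by
  ext x i
  rw [mul_apply_eq_comp, matOp_apply, matOp_apply]
  simp only [matOp_apply, Matrix.mul_apply, sum_apply, map_sum, mul_apply_eq_comp]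
  exact Finset.sum_comm

variable [CompleteSpace H] {N : VonNeumannAlgebra H}

theorem matOp_star (a : Matrix (Fin n) (Fin n) (H →L[ℂ] H)) :
    matOp (star a) = star (matOp a) := by
  rw [ContinuousLinearMap.star_eq_adjoint, ContinuousLinearMap.eq_adjoint_iff]
  intro x y
  simp only [PiLp.inner_apply, matOp_apply, sum_inner, inner_sum]
  rw [Finset.sum_comm]
  refine Finset.sum_congr rfl fun i _ => Finset.sum_congr rfl fun j _ => ?_
  rw [Matrix.star_apply, ContinuousLinearMap.star_eq_adjoint,
    ContinuousLinearMap.adjoint_inner_left]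

/-- The diagonal action of an operator on `Hⁿ`. -/
def diagOp (n : ℕ) (y : H →L[ℂ] H) : HPow H n →L[ℂ] HPow H n := matOp (Matrix.diagonal fun _ => y)

theorem star_diagOp (y : H →L[ℂ] H) : star (diagOp n y) = diagOp n (star y) := by
  rw [diagOp, diagOp, ← matOp_star, Matrix.star_eq_conjTranspose, Matrix.diagonal_conjTranspose]
  rfl

/-- The representation of `M_n(N)` on `Hⁿ`. -/
def rep (N : VonNeumannAlgebra H) (n : ℕ) :
    Matrix (Fin n) (Fin n) N →⋆ₐ[ℝ] (HPow H n →L[ℂ] HPow H n) where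
  toFun a := matOp (a.map ((↑) : N → H →L[ℂ] H))
  map_one' := by
    ext x i
    rw [matOp_apply, Finset.sum_eq_single i (fun j _ hj => by simp [hj.symm]) (by simp)]
    simp
  map_mul' a b := by
    rw [← matOp_mul]
    congr 1
    ext1 i j
    simp [Matrix.mul_apply, AddSubmonoidClass.coe_finsetSum]
  map_zero' := by
    ext x i
    rw [matOp_apply]
    simp
  map_add' a b := by
    ext x i
    simp [matOp_apply, Finset.sum_add_distrib]
  commutes' r := by
    ext x i
    rw [matOp_apply, Finset.sum_eq_single i
      (fun j _ hj => by simp [Algebra.algebraMap_eq_smul_one, hj.symm]) (by simp)]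
    simp [Algebra.algebraMap_eq_smul_one]
  map_star' a := by
    rw [← matOp_star]
    rfl

theorem rep_apply (a : Matrix (Fin n) (Fin n) N) :
    rep N n a = matOp (a.map ((↑) : N → H →L[ℂ] H)) := rfl

theorem rep_injective : Function.Injective (rep N n) := by
  intro a b h
  have := matOp_injective h
  ext1 i j
  exact Subtype.ext (congrFun (congrFun this i) j)

/-- A matrix commutes with the diagonal operator of `y` exactly when each entry commutes with `y`.
By the double commutant property `M_n(N)` is thus the commutant of the diagonal copy of the
commutant of `N`. -/
theorem mem_range_rep {b : HPow H n →L[ℂ] HPow H n} :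
    b ∈ Set.range (rep N n) ↔ ∀ y ∈ N.commutant, Commute (diagOp n y) b := by
  constructor
  · rintro ⟨a, rfl⟩ y hy
    rw [commute_iff_eq, rep_apply, diagOp, ← matOp_mul, ← matOp_mul]
    congr 1
    ext1 i j
    simp only [Matrix.diagonal_mul, Matrix.mul_diagonal, Matrix.map_apply]
    exact (commute_of_mem (a i j).2 hy).eq
  · intro h
    have hN : ∀ i j, opEntry b i j ∈ N := by
      intro i j
      refine mem_of_commute fun y hy => ?_
      have h1 := (h y hy).eq
      rw [← matOp_opEntry b, diagOp, ← matOp_mul, ← matOp_mul] at h1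
      have h2 := congrFun (congrFun (matOp_injective h1) i) j
      simp only [Matrix.diagonal_mul, Matrix.mul_diagonal, Matrix.of_apply] at h2
      exact h2
    refine ⟨Matrix.of fun i j => ⟨opEntry b i j, hN i j⟩, ?_⟩
    rw [rep_apply]
    exact matOp_opEntry b


attribute [local instance] Matrix.linftyOpNormedRing Matrix.linftyOpNormedAlgebra

/-- The representation of the matrices over `N` on `Hⁿ` as a representation of the traced ideal. -/
def matRep (τ : NFSTrace N) (n : ℕ) : (matTraced τ n).Rep (HPow H n) where
  rep := rep N n
  rep_injective := rep_injective
  gen := diagOp n '' {y | y ∈ N.commutant}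
  star_mem := by
    rintro _ ⟨y, hy, rfl⟩
    have h : star y ∈ N.commutant := star_mem hy
    exact ⟨star y, h, (star_diagOp y).symm⟩
  mem_range b := by
    rw [mem_range_rep, Set.forall_mem_image]
    rfl
  adj := matStar τ n
  incl_adj := matTraced_incl_matStar
  trace_adj := matTraced_trace_matStar
  exists_I_smul x := by
    refine ⟨Complex.I • x, ?_⟩
    ext v i
    rw [smul_apply, PiLp.smul_apply, rep_apply, rep_apply, matOp_apply, matOp_apply,
      Finset.smul_sum]
    rfl

end Representation

/-! ## The logarithm of the determinant on `GL_n(L¹_τ(N))` -/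

section LogDet

variable {H : Type*} [NormedAddCommGroup H] [InnerProductSpace ℂ H] [CompleteSpace H]
  {N : VonNeumannAlgebra H} {τ : NFSTrace N} {n m : ℕ}

attribute [local instance] Matrix.linftyOpNormedRing Matrix.linftyOpNormedAlgebra

/-- The matrix `g - 1` over the trace ideal. -/
def dev (g : GLnL1 τ n) : MatL1 τ n := fun i j => devEntry g i j

theorem oneAdd_dev (g : GLnL1 τ n) :
    (matTraced τ n).oneAdd (dev g) = ((g : GLn N n) : Matrix (Fin n) (Fin n) N) := by
  have : (matTraced τ n).incl (dev g) = ((g : GLn N n) : Matrix (Fin n) (Fin n) N) - 1 := rfl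
  rw [TracedIdeal.oneAdd, this, add_sub_cancel]

theorem isUnit_oneAdd_dev (g : GLnL1 τ n) : IsUnit ((matTraced τ n).oneAdd (dev g)) := by
  rw [oneAdd_dev]
  exact Units.isUnit _

theorem inverse_oneAdd_dev (g : GLnL1 τ n) : Ring.inverse ((matTraced τ n).oneAdd (dev g)) =
    (((g⁻¹ : GLnL1 τ n) : GLn N n) : Matrix (Fin n) (Fin n) N) := by
  rw [oneAdd_dev, Ring.inverse_unit]
  rfl

theorem eq_of_oneAdd_eq {x : MatL1 τ n} {g : GLnL1 τ n}
    (h : (matTraced τ n).oneAdd x = ((g : GLn N n) : Matrix (Fin n) (Fin n) N)) : x = dev g := by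
  rw [← oneAdd_dev] at h
  exact (matTraced τ n).incl_injective (add_left_cancel h)

theorem dev_injective : Function.Injective (dev : GLnL1 τ n → MatL1 τ n) := by
  intro g h hgh
  apply Subtype.ext
  apply Units.ext
  rw [← oneAdd_dev, hgh, oneAdd_dev]

theorem dev_one : dev (1 : GLnL1 τ n) = 0 := by
  refine (eq_of_oneAdd_eq ?_).symm
  rw [TracedIdeal.oneAdd, map_zero, add_zero]
  rfl

theorem dev_mul (g h : GLnL1 τ n) : dev (g * h) = (matTraced τ n).circ (dev g) (dev h) := by
  refine (eq_of_oneAdd_eq ?_).symm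
  rw [TracedIdeal.oneAdd_circ, oneAdd_dev, oneAdd_dev]
  rfl

/-- An invertible element `1 + x` as an element of `GL_n(L¹_τ(N))`. -/
def ofDev (x : MatL1 τ n) (hx : IsUnit ((matTraced τ n).oneAdd x)) : GLnL1 τ n :=
  ⟨hx.unit, by
    rw [mem_GLnL1, IsUnit.unit_spec, TracedIdeal.oneAdd, add_sub_cancel_left]
    exact fun i j => (x i j).mem⟩

theorem dev_ofDev (x : MatL1 τ n) (hx : IsUnit ((matTraced τ n).oneAdd x)) :
    dev (ofDev x hx) = x := (eq_of_oneAdd_eq rfl).symm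

/-- A smooth path in the ideal, starting at `0`, and consisting of quasi-invertible elements. -/
structure IsSmoothPath (x : ℝ → MatL1 τ n) : Prop where
  contDiffOn : ContDiffOn ℝ ∞ x (Set.Icc 0 1)
  isUnit : ∀ t ∈ Set.Icc (0 : ℝ) 1, IsUnit ((matTraced τ n).oneAdd (x t))
  zero : x 0 = 0

theorem IsSmoothPath.isPath {x : ℝ → MatL1 τ n} (hx : IsSmoothPath x) :
    (matTraced τ n).IsPath x where
  contDiffOn := hx.contDiffOn.of_le (by exact_mod_cast le_top)
  isUnit := hx.isUnit

theorem SmoothPath.isSmoothPath_dev (σ : SmoothPath τ n) :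
    IsSmoothPath fun t => dev (σ.toFun t) where
  contDiffOn := contDiffOn_pi.2 fun i => contDiffOn_pi.2 fun j => σ.smooth i j
  isUnit _ _ := isUnit_oneAdd_dev _
  zero := by rw [σ.zero, dev_one]

theorem IsSmoothPath.exists_smoothPath {x : ℝ → MatL1 τ n} (hx : IsSmoothPath x) :
    ∃ σ : SmoothPath τ n, ∀ t ∈ Set.Icc (0 : ℝ) 1, dev (σ.toFun t) = x t := by
  classical
  -- Outside `[0, 1]` invertibility may fail, and the path takes the default value `1`.
  let s : ℝ → GLnL1 τ n := fun t =>
    if ht : t ∈ Set.Icc (0 : ℝ) 1 then ofDev (x t) (hx.isUnit t ht) else 1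
  have hs : ∀ t ∈ Set.Icc (0 : ℝ) 1, dev (s t) = x t := fun t ht => by
    simp only [s, dif_pos ht, dev_ofDev]
  refine ⟨⟨s, dev_injective ?_, fun i j => ?_⟩, hs⟩
  · rw [hs 0 ⟨le_rfl, zero_le_one⟩, hx.zero, dev_one]
  · refine (contDiffOn_pi.1 (contDiffOn_pi.1 hx.contDiffOn i) j).congr fun t ht => ?_
    exact congrFun (congrFun (hs t ht) i) j

/-- The integral in `logInt` is taken in operator norm, for which the trace is not assumed
continuous. The diagonal terms of its integrand are continuous into the Banach space `L¹`, so their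
integrals already exist there, and both the inclusion and the bounded trace commute with them. -/
theorem tauTilde_eq (σ : SmoothPath τ n) :
    σ.tauTilde = -(matTraced τ n).logIntegral fun t => dev (σ.toFun t) := by
  set x : ℝ → MatL1 τ n := fun t => dev (σ.toFun t) with hxdef
  have hx := σ.isSmoothPath_dev.isPath
  set f : ℝ → MatL1 τ n := fun t => (matTraced τ n).mulR (derivWithin x (Set.Icc 0 1) t)
    (Ring.inverse ((matTraced τ n).oneAdd (x t))) with hf
  have hfc : ContinuousOn f (Set.Icc 0 1) := hx.continuousOn_mulR
  have hfi : ∀ i, IntervalIntegrable (fun t => f t i i) MeasureTheory.volume 0 1 := fun i => by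
    apply ContinuousOn.intervalIntegrable
    rw [Set.uIcc_of_le zero_le_one]
    exact continuousOn_pi.1 (continuousOn_pi.1 hfc i) i
  have h1 : ∀ i, σ.logInt i i = L1.valL τ (∫ t in (0 : ℝ)..1, f t i i) := by
    intro i
    rw [← (L1.valL τ).intervalIntegral_comp_comm (hfi i)]
    refine intervalIntegral.integral_congr fun t ht => ?_
    rw [Set.uIcc_of_le zero_le_one] at ht
    have hd := hx.hasDerivWithinAt ht
    rw [hasDerivWithinAt_pi] at hd
    dsimp only [f]
    rw [matTraced_mulR_apply, inverse_oneAdd_dev, map_sum]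
    refine Finset.sum_congr rfl fun j _ => ?_
    have hdij := hasDerivWithinAt_pi.1 (hd i) j
    rw [← TracedIdeal.derivWithin_eq ht hdij]
    rfl
  have h2 : σ.logInt.trace = L1.valL τ (∑ i, ∫ t in (0 : ℝ)..1, f t i i) := by
    rw [map_sum, Matrix.trace]
    exact Finset.sum_congr rfl fun i _ => h1 i
  rw [SmoothPath.tauTilde, h2, L1.valL_apply, ← L1.trace_apply, map_sum, TracedIdeal.logIntegral]
  congr 1
  have h3 : ∀ i, IntervalIntegrable (fun t => L1.trace τ (f t i i)) MeasureTheory.volume 0 1 :=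
    fun i => by
      apply ContinuousOn.intervalIntegrable
      rw [Set.uIcc_of_le zero_le_one]
      exact (L1.trace τ).continuous.comp_continuousOn
        (continuousOn_pi.1 (continuousOn_pi.1 hfc i) i)
  have h4 : (matTraced τ n).logDeriv x = fun t => ∑ i, L1.trace τ (f t i i) :=
    funext fun t => matTraced_trace_apply _
  rw [h4, intervalIntegral.integral_finsetSum fun i _ => h3 i]
  exact Finset.sum_congr rfl fun i _ => ((L1.trace τ).intervalIntegral_comp_comm (hfi i)).symm

theorem exists_isSmoothPath (g : GLnL1 τ n) :
    ∃ x : ℝ → MatL1 τ n, IsSmoothPath x ∧ x 1 = dev g := by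
  obtain ⟨x, hx, hu, h0, h1⟩ := (matRep τ n).exists_path (g := ((g : GLn N n) : Matrix _ _ N))
    (Units.isUnit _) ⟨dev g, oneAdd_dev g⟩
  exact ⟨x, ⟨hx, hu, h0⟩, eq_of_oneAdd_eq h1⟩

/-- The logarithm of the determinant, computed along some path. -/
def logDet (g : GLnL1 τ n) : ℝ :=
  ((matTraced τ n).logIntegral (exists_isSmoothPath g).choose).re

/-- The path may end at any element with the same absolute value as `g`. This freedom is used for
Brown's formula. -/
theorem logDet_eq_of_star_mul_self {g : GLnL1 τ n} {x : ℝ → MatL1 τ n} (hx : IsSmoothPath x)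
    (h : star ((matTraced τ n).oneAdd (x 1)) * (matTraced τ n).oneAdd (x 1) =
      star ((g : GLn N n) : Matrix (Fin n) (Fin n) N) * ((g : GLn N n) : Matrix _ _ N)) :
    logDet g = ((matTraced τ n).logIntegral x).re := by
  obtain ⟨hy, hy1⟩ := (exists_isSmoothPath g).choose_spec
  refine (matRep τ n).re_logIntegral_eq hy.isPath hx.isPath hy.zero hx.zero ?_
  rw [hy1, h, oneAdd_dev]

theorem logDet_eq {g : GLnL1 τ n} {x : ℝ → MatL1 τ n} (hx : IsSmoothPath x) (h : x 1 = dev g) :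
    logDet g = ((matTraced τ n).logIntegral x).re :=
  logDet_eq_of_star_mul_self hx (by rw [h, oneAdd_dev])

theorem logDet_mul (g h : GLnL1 τ n) : logDet (g * h) = logDet g + logDet h := by
  obtain ⟨x, hx, hx1⟩ := exists_isSmoothPath g
  obtain ⟨y, hy, hy1⟩ := exists_isSmoothPath h
  have hz : IsSmoothPath fun t => (matTraced τ n).circ (x t) (y t) :=
    { contDiffOn := TracedIdeal.contDiffOn_circ hx.contDiffOn hy.contDiffOn
      isUnit := fun t ht => by
        rw [TracedIdeal.oneAdd_circ]
        exact (hx.isUnit t ht).mul (hy.isUnit t ht)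
      zero := by
        show (matTraced τ n).circ (x 0) (y 0) = 0
        rw [TracedIdeal.circ, hx.zero, hy.zero, map_zero, zero_apply, zero_add] }
  rw [logDet_eq hz (by rw [hx1, hy1, dev_mul]), TracedIdeal.logIntegral_circ hx.isPath hy.isPath,
    Complex.add_re, logDet_eq hx hx1, logDet_eq hy hy1]

theorem logDet_one : logDet (1 : GLnL1 τ n) = 0 := by
  have := logDet_mul (1 : GLnL1 τ n) 1
  rw [one_mul] at this
  linarith

theorem logDet_inv (g : GLnL1 τ n) : logDet g⁻¹ = -logDet g := by
  have := logDet_mul g g⁻¹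
  rw [mul_inv_cancel, logDet_one] at this
  linarith

theorem logDet_conj (g : GLnL1 τ n) (k : GLn N n) :
    logDet (⟨k * g * k⁻¹, conj_mem_GLnL1 g.2 k⟩ : GLnL1 τ n) = logDet g := by
  obtain ⟨x, hx, hx1⟩ := exists_isSmoothPath g
  have h1 : ∀ y, (matTraced τ n).oneAdd ((matTraced τ n).mulL k ((matTraced τ n).mulR y
      (k⁻¹ : GLn N n))) = k * (matTraced τ n).oneAdd y * (k⁻¹ : GLn N n) := fun y => by
    rw [TracedIdeal.oneAdd, TracedIdeal.oneAdd, TracedIdeal.incl_mulL, TracedIdeal.incl_mulR,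
      mul_add, add_mul, mul_one, Units.mul_inv, mul_assoc]
  have hz : IsSmoothPath fun t => (matTraced τ n).mulL k ((matTraced τ n).mulR (x t)
      (k⁻¹ : GLn N n)) :=
    { contDiffOn := ((matTraced τ n).mulL k ∘L
        (matTraced τ n).mulR.flip (k⁻¹ : GLn N n)).contDiff.comp_contDiffOn hx.contDiffOn
      isUnit := fun t ht => by
        rw [h1]
        exact (k.isUnit.mul (hx.isUnit t ht)).mul (Units.isUnit _)
      zero := by rw [hx.zero, map_zero, zero_apply, map_zero] }
  rw [logDet_eq hz (eq_of_oneAdd_eq (by rw [h1, hx1, oneAdd_dev]; rfl)),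
    TracedIdeal.logIntegral_conj hx.isPath, logDet_eq hx hx1]

/-- Extension of a matrix over the trace ideal by zero. -/
def padZero (τ : NFSTrace N) (n m : ℕ) : MatL1 τ n →L[ℝ] MatL1 τ m :=
  LinearMap.mkContinuous
    { toFun := fun x i j => if h : i.1 < n ∧ j.1 < n then x ⟨i, h.1⟩ ⟨j, h.2⟩ else 0
      map_add' := fun x y => by
        ext i j
        simp only [Pi.add_apply]
        split_ifs <;> simp
      map_smul' := fun c x => by
        ext i j
        simp only [Pi.smul_apply]
        split_ifs <;> simp } 1
    fun x => (pi_norm_le_iff_of_nonneg (by positivity)).2 fun i =>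
      (pi_norm_le_iff_of_nonneg (by positivity)).2 fun j => by
        rw [one_mul]
        show ‖dite _ _ _‖ ≤ _
        split_ifs
        · exact norm_matL1_entry_le x _ _
        · rw [norm_zero]; exact norm_nonneg x

theorem padZero_apply (x : MatL1 τ n) (i j : Fin m) : padZero τ n m x i j =
    if h : i.1 < n ∧ j.1 < n then x ⟨i, h.1⟩ ⟨j, h.2⟩ else 0 := rfl

/-- Because of its identity block, `pad` is not additive. Adding an element of the ideal only
changes the upper left corner. -/
theorem pad_add_incl (a : Matrix (Fin n) (Fin n) N) (x : MatL1 τ n) :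
    pad m (a + (matTraced τ n).incl x) = pad m a + (matTraced τ m).incl (padZero τ n m x) := by
  refine Matrix.ext fun i j => Subtype.ext ?_
  rw [Matrix.add_apply, AddMemClass.coe_add, matTraced_incl_apply, padZero_apply]
  simp only [pad, Matrix.of_apply]
  split_ifs with h
  · rfl
  · exact (add_zero _).symm
  · exact (add_zero _).symm

theorem oneAdd_padZero (x : MatL1 τ n) :
    (matTraced τ m).oneAdd (padZero τ n m x) = pad m ((matTraced τ n).oneAdd x) := by
  rw [TracedIdeal.oneAdd, TracedIdeal.oneAdd, pad_add_incl, pad_one]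

theorem mulR_padZero (h : n ≤ m) (x : MatL1 τ n) (a : Matrix (Fin n) (Fin n) N) :
    (matTraced τ m).mulR (padZero τ n m x) (pad m a) =
      padZero τ n m ((matTraced τ n).mulR x a) := by
  apply (matTraced τ m).incl_injective
  -- After adding `pad m a` both sides become the padding of `(1 + x) a`, so multiplicativity of
  -- `pad` applies.
  apply add_left_cancel (a := pad m a)
  rw [← pad_add_incl, TracedIdeal.incl_mulR, TracedIdeal.incl_mulR]
  have h1 : a + (matTraced τ n).incl x * a = (matTraced τ n).oneAdd x * a := by
    rw [TracedIdeal.oneAdd, add_mul, one_mul]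
  rw [h1, pad_mul h, ← oneAdd_padZero, TracedIdeal.oneAdd, add_mul, one_mul]

theorem trace_padZero (h : n ≤ m) (x : MatL1 τ n) :
    (matTraced τ m).trace (padZero τ n m x) = (matTraced τ n).trace x := by
  obtain ⟨k, rfl⟩ := Nat.exists_eq_add_of_le h
  rw [matTraced_trace_apply, matTraced_trace_apply, Fin.sum_univ_add]
  simp [padZero_apply]

theorem logDet_stab (h : n ≤ m) (g : GLnL1 τ n) :
    logDet (⟨stab N n m h g, stab_mem_GLnL1 h g.2⟩ : GLnL1 τ m) = logDet g := by
  obtain ⟨x, hx, hx1⟩ := exists_isSmoothPath g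
  have hz : IsSmoothPath fun t => padZero τ n m (x t) :=
    { contDiffOn := (padZero τ n m).contDiff.comp_contDiffOn hx.contDiffOn
      isUnit := fun t ht => by
        obtain ⟨u, hu⟩ := hx.isUnit t ht
        rw [oneAdd_padZero, ← hu]
        exact Units.isUnit (stab N n m h u)
      zero := by rw [hx.zero, map_zero] }
  rw [logDet_eq hz (eq_of_oneAdd_eq (by rw [oneAdd_padZero, hx1, oneAdd_dev]; rfl)),
    logDet_eq hx hx1]
  congr 1
  refine intervalIntegral.integral_congr fun t ht => ?_
  rw [Set.uIcc_of_le zero_le_one] at ht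
  have hd : HasDerivWithinAt (fun t => padZero τ n m (x t))
      (padZero τ n m (derivWithin x (Set.Icc 0 1) t)) (Set.Icc 0 1) t :=
    (padZero τ n m).hasFDerivAt.comp_hasDerivWithinAt t (hx.isPath.hasDerivWithinAt ht)
  obtain ⟨u, hu⟩ := hx.isUnit t ht
  have h1 : Ring.inverse (pad m (u : Matrix (Fin n) (Fin n) N)) =
      pad m ((u⁻¹ : GLn N n) : Matrix (Fin n) (Fin n) N) := by
    rw [← coe_stab h, Ring.inverse_unit, ← map_inv, coe_stab]
  rw [TracedIdeal.logDeriv, TracedIdeal.derivWithin_eq ht hd, TracedIdeal.logDeriv,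
    oneAdd_padZero, ← hu, h1, Ring.inverse_unit, mulR_padZero h, trace_padZero h]

end LogDet

/-! ## The determinant on the relative algebraic `K`-group -/

section ExpPath

open NormedSpace

variable {A J : Type*} [NormedRing A] [NormedAlgebra ℝ A] [CompleteSpace A]
  [NormedAddCommGroup J] [NormedSpace ℝ J] [CompleteSpace J] (I : TracedIdeal A J)

/-- The path `exp (t h)` of invertible elements has logarithmic integral `T h`. -/
theorem TracedIdeal.exists_exp_path (h : J) : ∃ x : ℝ → J, ContDiff ℝ ∞ x ∧
    (∀ t, I.oneAdd (x t) = exp (t • I.incl h)) ∧ (∀ t, IsUnit (I.oneAdd (x t))) ∧ x 0 = 0 ∧ I.logIntegral x = I.trace h := by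
  set a := I.incl h with ha
  have hd : ∀ t : ℝ, HasDerivAt (fun u : ℝ => exp (u • a)) (a * exp (t • a)) t :=
    hasDerivAt_exp_smul_const' a
  have hE : ContDiff ℝ ∞ fun u : ℝ => exp (u • a) :=
    contDiff_iff_contDiffAt.2 fun u =>
      (exp_analytic (𝕂 := ℝ) (u • a)).contDiffAt.comp u (by fun_prop)
  have hf : ContDiff ℝ ∞ fun u : ℝ => I.mulR h (exp (u • a)) := (I.mulR h).contDiff.comp hE
  -- This is `exp(ta) - 1` written as the integral of its derivative, which makes it a curve in `J`
  -- that is smooth for the norm of `J`. Completeness of `J` enters here.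
  set x : ℝ → J := fun t => ∫ s in (0 : ℝ)..t, I.mulR h (exp (s • a)) with hx
  have hdx : ∀ t, HasDerivAt x (I.mulR h (exp (t • a))) t := fun t =>
    intervalIntegral.integral_hasDerivAt_right (hf.continuous.intervalIntegrable _ _)
      (hf.continuous.stronglyMeasurableAtFilter _ _) hf.continuous.continuousAt
  have h0 : x 0 = 0 := intervalIntegral.integral_same
  have hexp : ∀ t, I.oneAdd (x t) = exp (t • a) := by
    have h1 : ∀ t, HasDerivAt (fun t => I.oneAdd (x t) - exp (t • a)) 0 t := fun t => by
      have h2 := (I.incl.hasFDerivAt.comp_hasDerivAt t (hdx t)).const_add 1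
      have h3 := h2.sub (hd t)
      rw [I.incl_mulR, sub_self] at h3
      exact h3
    intro t
    have h4 := is_const_of_deriv_eq_zero (fun t => (h1 t).differentiableAt)
      (fun t => (h1 t).deriv) t 0
    simp only [h0, TracedIdeal.oneAdd, map_zero, add_zero, zero_smul, exp_zero, sub_self] at h4
    exact sub_eq_zero.1 h4
  have hu : ∀ t, IsUnit (I.oneAdd (x t)) := fun t => by
    rw [hexp]
    exact isUnit_exp_of_mem_ball (𝕂 := ℝ)
      ((expSeries_radius_eq_top ℝ A).symm ▸ edist_lt_top _ _)
  refine ⟨x, contDiff_infty_iff_deriv.2 ⟨fun t => (hdx t).differentiableAt, ?_⟩, hexp, hu, h0, ?_⟩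
  · rwa [show deriv x = _ from funext fun t => (hdx t).deriv]
  -- Since `x' = h (1 + x)`, the logarithmic derivative is the constant `T h`.
  · have h5 : ∀ t ∈ Set.uIcc (0 : ℝ) 1, I.logDeriv x t = I.trace h := fun t ht => by
      rw [Set.uIcc_of_le zero_le_one] at ht
      rw [TracedIdeal.logDeriv, TracedIdeal.derivWithin_eq ht (hdx t).hasDerivWithinAt, ← hexp,
        TracedIdeal.mulR_mulR, Ring.mul_inverse_cancel _ (hu t), TracedIdeal.mulR_one]
    rw [TracedIdeal.logIntegral, intervalIntegral.integral_congr h5]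
    simp

end ExpPath

/-! ### Descent of the logarithm of the determinant to the K-group. -/

section KTheory

variable {H : Type*} [NormedAddCommGroup H] [InnerProductSpace ℂ H] [CompleteSpace H]
  {N : VonNeumannAlgebra H} {τ : NFSTrace N} {n m : ℕ}

theorem logDet_eq_of_of_eq {g : GLnL1 τ n} {h : GLnL1 τ m}
    (heq : GLInf.of N n g = GLInf.of N m h) : logDet g = logDet h := by
  obtain ⟨k, hn, hm, hk⟩ := Quotient.exact heq
  rw [← logDet_stab hn g, ← logDet_stab hm h]
  congr 1
  exact Subtype.ext hk

/-- The logarithm of the determinant on `GL_∞(L¹_τ(N))`. -/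
def logDetInf (x : GLInfL1 τ) : ℝ :=
  logDet (⟨x.2.choose_spec.choose, x.2.choose_spec.choose_spec.1⟩ : GLnL1 τ x.2.choose)

theorem logDetInf_of (x : GLInfL1 τ) (g : GLnL1 τ n) (h : GLInf.of N n g = x) :
    logDetInf x = logDet g :=
  logDet_eq_of_of_eq (x.2.choose_spec.choose_spec.2.trans h.symm)

/-- The logarithm of the determinant, as a homomorphism on `GL_∞(L¹_τ(N))`. -/
def logDetHom (τ : NFSTrace N) : GLInfL1 τ →* Multiplicative ℝ :=
  MonoidHom.mk' (fun x => Multiplicative.ofAdd (logDetInf x)) <| by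
    rintro ⟨_, n, g, hg, rfl⟩ ⟨_, m, h, hh, rfl⟩
    rw [← ofAdd_add]
    congr 1
    have hg' := stab_mem_GLnL1 (le_max_left n m) hg
    have hh' := stab_mem_GLnL1 (le_max_right n m) hh
    rw [logDetInf_of ⟨_, n, g, hg, rfl⟩ (⟨_, hg'⟩ : GLnL1 τ (max n m)) (GLInf.of_stab _ _),
      logDetInf_of ⟨_, m, h, hh, rfl⟩ (⟨_, hh'⟩ : GLnL1 τ (max n m)) (GLInf.of_stab _ _),
      ← logDet_mul]
    refine logDetInf_of _ _ ?_
    show GLInf.of N _ (_ * _) = _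
    rw [map_mul, GLInf.of_stab, GLInf.of_stab]
    rfl

/-- Grouped as `y · (z y⁻¹ z⁻¹)`, the commutator is a product of two elements of `GL_∞(L¹)`,
although `z` need not lie there. Conjugation invariance makes the two contributions cancel. -/
theorem logDetInf_of_commutator {x : GLInfL1 τ} {y z : GLInf N} (hy : y ∈ GLInfL1 τ)
    (hx : (x : GLInf N) = y * z * y⁻¹ * z⁻¹) : logDetInf x = 0 := by
  obtain ⟨n, g, hg, rfl⟩ := hy
  obtain ⟨m, k, rfl⟩ := GLInf.exists_of z
  have hn := GLInf.of_stab (le_max_left n m) g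
  have hm := GLInf.of_stab (le_max_right n m) k
  have hg' := stab_mem_GLnL1 (le_max_left n m) hg
  generalize stab N n (max n m) (le_max_left n m) g = g' at hn hg'
  generalize stab N m (max n m) (le_max_right n m) k = k' at hm
  let a : GLnL1 τ (max n m) := ⟨g', hg'⟩
  let b : GLnL1 τ (max n m) := ⟨k' * (a⁻¹ : GLnL1 τ (max n m)) * k'⁻¹, conj_mem_GLnL1 (a⁻¹).2 k'⟩
  have hc : GLInf.of N (max n m) ((a * b : GLnL1 τ (max n m)) : GLn N (max n m)) = x := by
    have h1 : ((a * b : GLnL1 τ (max n m)) : GLn N (max n m)) = g' * (k' * g'⁻¹ * k'⁻¹) := rfl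
    rw [h1, hx, map_mul, map_mul, map_mul, map_inv, map_inv, hn, hm]
    simp only [mul_assoc]
  rw [logDetInf_of x _ hc, logDet_mul, logDet_conj, logDet_inv, add_neg_cancel]

theorem commutator_le_ker_logDetHom (τ : NFSTrace N) :
    (⁅GLInfL1 τ, (⊤ : Subgroup (GLInf N))⁆).subgroupOf (GLInfL1 τ) ≤ (logDetHom τ).ker := by
  -- The commutator subgroup lives in `GL_∞(N)`, the kernel in the subgroup `GL_∞(L¹)`. They are
  -- compared on generators inside `GL_∞(N)`.
  have h : ⁅GLInfL1 τ, (⊤ : Subgroup (GLInf N))⁆ ≤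
      (logDetHom τ).ker.map (GLInfL1 τ).subtype := by
    rw [Subgroup.commutator_le]
    intro y hy z _
    have hm := Subgroup.mul_mem _ hy (Subgroup.Normal.conj_mem inferInstance _
      (Subgroup.inv_mem _ hy) z)
    refine ⟨⟨_, hm⟩, ?_, by simp only [Subgroup.subtype_apply, commutatorElement_def, mul_assoc]⟩
    exact congrArg Multiplicative.ofAdd
      (logDetInf_of_commutator hy (z := z) (by simp only [mul_assoc]))
  intro x hx
  obtain ⟨y, hy, hyx⟩ := h (Subgroup.mem_subgroupOf.1 hx)
  rwa [← Subtype.ext hyx]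

theorem logDet_eq_of_mk_eq {g : GLnL1 τ n} {h : GLnL1 τ m}
    (heq : K1alg.mk τ g = K1alg.mk τ h) : logDet g = logDet h := by
  have h1 := commutator_le_ker_logDetHom τ (QuotientGroup.eq.1 heq)
  rw [MonoidHom.mem_ker, map_mul, map_inv, inv_mul_eq_one] at h1
  have h2 := Multiplicative.ofAdd.injective h1
  rwa [logDetInf_of _ g rfl, logDetInf_of _ h rfl] at h2

/-- The minus sign in `tauTilde` accounts for the inverse in `IsLift`. -/
theorem re_tauTilde (σ : SmoothPath τ n) : σ.tauTilde.re = logDet (σ.toFun 1)⁻¹ := by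
  rw [tauTilde_eq, logDet_inv, logDet_eq σ.isSmoothPath_dev rfl, Complex.neg_re]

theorem K1alg.exists_mk (κ : K1alg τ) : ∃ (n : ℕ) (g : GLnL1 τ n), K1alg.mk τ g = κ := by
  induction κ using QuotientGroup.induction_on with
  | H x =>
    obtain ⟨_, n, g, hg, rfl⟩ := x
    exact ⟨n, ⟨g, hg⟩, rfl⟩

theorem exists_isLift (κ : K1alg τ) : ∃ (n : ℕ) (σ : SmoothPath τ n), σ.IsLift κ := by
  obtain ⟨n, g, rfl⟩ := κ.exists_mk
  obtain ⟨x, hx, hx1⟩ := exists_isSmoothPath g⁻¹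
  obtain ⟨σ, hσ⟩ := hx.exists_smoothPath
  refine ⟨n, σ, ?_⟩
  have h1 : σ.toFun 1 = g⁻¹ := dev_injective ((hσ 1 ⟨zero_le_one, le_rfl⟩).trans hx1)
  rw [SmoothPath.IsLift, h1, inv_inv]

theorem detTau_mk (g : GLnL1 τ n) : detTau τ (K1alg.mk τ g) = Real.exp (logDet g) := by
  obtain ⟨m, σ, hσ⟩ := exists_isLift (K1alg.mk τ g)
  have h : ∃ p : (n : ℕ) × SmoothPath τ n, p.2.IsLift (K1alg.mk τ g) := ⟨⟨m, σ⟩, hσ⟩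
  rw [detTau, dif_pos h, re_tauTilde, logDet_eq_of_mk_eq h.choose_spec]

theorem detTau_eq_of_isLift {κ : K1alg τ} {σ : SmoothPath τ n} (h : σ.IsLift κ) :
    detTau τ κ = Real.exp σ.tauTilde.re := by
  rw [← h, detTau_mk, re_tauTilde]

end KTheory

/-! ### Brown's formula. -/

section Brown

open NormedSpace

variable {H : Type*} [NormedAddCommGroup H] [InnerProductSpace ℂ H] [CompleteSpace H]
  {N : VonNeumannAlgebra H} {τ : NFSTrace N}

theorem isStrictlyPositive_abs {a : H →L[ℂ] H} (ha : IsUnit a) :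
    IsStrictlyPositive (CFC.abs a) := by
  refine IsUnit.isStrictlyPositive ?_ (CFC.abs_nonneg a)
  rw [← isUnit_pow_iff two_ne_zero, CFC.abs_sq]
  exact ha.star.mul ha

/-- On `(0, ∞)` one has `log s = (s² - 1) k(s)` with `k(s) = (log s / (s - 1)) / (s + 1)`,
continuous once `dslope` fills in the value at `1`. Hence `log|a|` is a multiple of `|a|² - 1 = a*(a
- 1) + (a - 1)*`, which lies in the ideal. -/
theorem log_abs_mem_traceIdeal {a : H →L[ℂ] H} (haN : a ∈ N) (ha : IsUnit a)
    (h : a - 1 ∈ traceIdeal τ) : CFC.log (CFC.abs a) ∈ traceIdeal τ := by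
  have hp := isStrictlyPositive_abs ha
  set p := CFC.abs a with hpdef
  have hpos : ∀ s ∈ spectrum ℝ p, 0 < s := fun s hs => hp.spectrum_pos hs
  set k : ℝ → ℝ := fun s => dslope Real.log 1 s * (s + 1)⁻¹ with hk
  have hkc : ContinuousOn k (spectrum ℝ p) := by
    refine ContinuousOn.mul ?_ ?_
    · refine ContinuousOn.mono (s := Set.Ioi 0) ?_ hpos
      refine (continuousOn_dslope (Ioi_mem_nhds zero_lt_one)).2
        ⟨Real.continuousOn_log.mono fun s (hs : 0 < s) => hs.ne', Real.differentiableAt_log one_ne_zero⟩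
    · exact ContinuousOn.inv₀ (by fun_prop) fun s hs => by linarith [hpos s hs]
  have hlog : CFC.log p = (p ^ 2 - 1) * cfc k p := by
    have h1 : p ^ 2 - 1 = cfc (fun s : ℝ => s ^ 2 - 1) p := by
      rw [cfc_sub .., cfc_pow_id .., cfc_const_one ..]
    rw [h1, ← cfc_mul .., CFC.log]
    refine cfc_congr fun s hs => ?_
    have h2 := sub_smul_dslope Real.log 1 s
    rw [Real.log_one, sub_zero, smul_eq_mul] at h2
    have h3 : s + 1 ≠ 0 := by linarith [hpos s hs]
    simp only [hk]
    rw [← h2]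
    field_simp
    ring
  have h4 : p ^ 2 - 1 = star a * (a - 1) * 1 + star (a - 1) := by
    rw [hpdef, CFC.abs_sq, star_sub, star_one]
    noncomm_ring
  have h5 : p ^ 2 - 1 ∈ traceIdeal τ := by
    rw [h4]
    exact add_mem (mul_mem_traceIdeal τ (star_mem haN) h (one_mem N)) (star_mem_traceIdeal h)
  rw [hlog, ← one_mul (p ^ 2 - 1)]
  exact mul_mem_traceIdeal τ (one_mem N) h5 (cfc_mem (abs_mem haN) k)

attribute [local instance] Matrix.linftyOpNormedRing Matrix.linftyOpNormedAlgebra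

/-- The entry of a `1 × 1` matrix. -/
def entryHom (N : VonNeumannAlgebra H) : Matrix (Fin 1) (Fin 1) N →+* (H →L[ℂ] H) where
  toFun a := a 0 0
  map_one' := rfl
  map_zero' := rfl
  map_add' _ _ := rfl
  map_mul' a b := by
    rw [Matrix.mul_apply, Fin.sum_univ_one]
    rfl

theorem entryHom_injective : Function.Injective (entryHom N) := fun a b h => by
  refine Matrix.ext fun i j => ?_
  rw [Subsingleton.elim i 0, Subsingleton.elim j 0]
  exact Subtype.ext h

theorem continuous_entryHom : Continuous (entryHom N) :=
  AddMonoidHomClass.continuous_of_bound (entryHom N) 1 fun a => by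
    rw [one_mul]
    exact norm_entry_le a 0 0

theorem entryHom_star (a : Matrix (Fin 1) (Fin 1) N) :
    entryHom N (star a) = star (entryHom N a) := rfl

/-- The path `exp(t log|g|)` has integral `τ(log|g|)`. It ends at `|g|` instead of `g`, which is
enough since `|g|*|g| = g*g`. -/
theorem logDet_toGL1 (g : Nˣ) (hg : ((g : N) : H →L[ℂ] H) - 1 ∈ traceIdeal τ)
    (h : CFC.log (CFC.abs ((g : N) : H →L[ℂ] H)) ∈ traceIdeal τ)
    (hp : IsStrictlyPositive (CFC.abs ((g : N) : H →L[ℂ] H))) :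
    logDet (toGL1 τ g hg) = (τ.ext (CFC.log (CFC.abs ((g : N) : H →L[ℂ] H)))).re := by
  set y : MatL1 τ 1 := fun _ _ => L1.mk _ h with hy
  obtain ⟨x, hx, hexp, hu, h0, hint⟩ := (matTraced τ 1).exists_exp_path y
  have hsm : IsSmoothPath x :=
    { contDiffOn := hx.contDiffOn
      isUnit := fun t _ => hu t
      zero := h0 }
  -- A continuous ring homomorphism commutes with the exponential, which moves the computation to
  -- operators on `H`, where `exp` inverts the logarithm of the functional calculus.
  have h1 : entryHom N ((matTraced τ 1).oneAdd (x 1)) = CFC.abs ((g : N) : H →L[ℂ] H) := by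
    rw [hexp, one_smul, map_exp_of_mem_ball (𝕂 := ℝ) _ continuous_entryHom _
      ((expSeries_radius_eq_top ℝ (Matrix (Fin 1) (Fin 1) N)).symm ▸ edist_lt_top _ _)]
    exact CFC.exp_log _ hp
  have h2 : entryHom N (((toGL1 τ g hg : GLnL1 τ 1) : GLn N 1) : Matrix (Fin 1) (Fin 1) N) =
      ((g : N) : H →L[ℂ] H) := by
    show ((Matrix.scalar (Fin 1) (g : N) 0 0 : N) : H →L[ℂ] H) = _
    rw [Matrix.scalar_apply, Matrix.diagonal_apply_eq]
  rw [logDet_eq_of_star_mul_self hsm, hint, matTraced_trace_apply, Fin.sum_univ_one,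
    L1.trace_apply]
  · rfl
  · apply entryHom_injective
    rw [map_mul, map_mul, entryHom_star, entryHom_star, h1, h2,
      (CFC.abs_nonneg _).isSelfAdjoint.star_eq, CFC.abs_mul_abs]

/-- Brown's formula. -/
theorem detTau_toGL1 (g : Nˣ) (hg : ((g : N) : H →L[ℂ] H) - 1 ∈ traceIdeal τ) :
    CFC.log (CFC.abs ((g : N) : H →L[ℂ] H)) ∈ traceIdeal τ ∧
      (detTau τ (K1alg.mk τ (toGL1 τ g hg)) : ℂ) =
        Complex.exp (τ.ext (CFC.log (CFC.abs ((g : N) : H →L[ℂ] H)))) := by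
  have hu : IsUnit ((g : N) : H →L[ℂ] H) :=
    ⟨⟨(g : N), ((g⁻¹ : Nˣ) : N), congrArg Subtype.val g.mul_inv,
      congrArg Subtype.val g.inv_mul⟩, rfl⟩
  have h := log_abs_mem_traceIdeal (τ := τ) (g : N).2 hu hg
  refine ⟨h, ?_⟩
  rw [detTau_mk, logDet_toGL1 g hg h (isStrictlyPositive_abs hu),
    ext_of_isSelfAdjoint τ IsSelfAdjoint.log, Complex.ofReal_re, Complex.ofReal_exp]

end Brown

end FugledeKadison
end

theorem mainTheorem3 {H : Type*} [NormedAddCommGroup H] [InnerProductSpace ℂ H] [CompleteSpace H]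
    (N : VonNeumannAlgebra H) (τ : FugledeKadison.NFSTrace N) :
    -- `det_τ` is defined on every class and does not depend on the lift
    (∀ κ : FugledeKadison.K1alg τ, ∃ (n : ℕ) (σ : FugledeKadison.SmoothPath τ n), σ.IsLift κ) ∧
    (∀ (κ : FugledeKadison.K1alg τ) (n : ℕ) (σ : FugledeKadison.SmoothPath τ n), σ.IsLift κ →
      FugledeKadison.detTau τ κ = Real.exp σ.tauTilde.re) ∧
    -- the explicit formula
    ∀ (g : Nˣ) (hg : ((g : N) : H →L[ℂ] H) - 1 ∈ FugledeKadison.traceIdeal τ),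
      CFC.log (CFC.abs ((g : N) : H →L[ℂ] H)) ∈ FugledeKadison.traceIdeal τ ∧
      (FugledeKadison.detTau τ (FugledeKadison.K1alg.mk τ (FugledeKadison.toGL1 τ g hg)) : ℂ) =
        Complex.exp (τ.ext (CFC.log (CFC.abs ((g : N) : H →L[ℂ] H)))) := by
  exact ⟨fun κ => FugledeKadison.exists_isLift κ,
    fun κ n σ h => FugledeKadison.detTau_eq_of_isLift h,
    fun g hg => FugledeKadison.detTau_toGL1 g hg⟩
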